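/- Let $1<\alpha\le 2$, $\Omega=[a,b]\times[c,d]$ with $a<b$, $c<d$, and $T>0$. For $1<\alpha<2$ let $$L_x^\alpha u(x,y,t)=-\frac{1}{2\cos(\alpha\pi/2)\,\Gamma(2-\alpha)}\Big(\partial_x^2\int_{-\infty}^x\frac{u(\xi,y,t)}{(x-\xi)^{\alpha-1}}d\xi+\partial_x^2\int_x^{\infty}\frac{u(\xi,y,t)}{(\xi-x)^{\alpha-1}}d\xi\Big)$$ be the Riesz derivative in $x$, let $L_x^2=\partial_x^2$, and define $L_y^\alpha$ similarly. Let $u$ solve the space-fractional nonlinear Schrödinger equation $$\mathbf i u_t+L_x^\alpha u+L_y^\alpha u+|u|^2u=0\quad\text{in the interior of }\Omega,\ 0<t<T,\qquad u(x,y,0)=u_0(x,y),$$ with the homogeneous Dirichlet condition: $u$ vanishes on $\partial\Omega$ for $t\in[0,T]$ and is extended by zero outside $\Omega$. For positive integers $N,M_x,M_y$ put $\tau=T/N$, $h_x=(b-a)/M_x$, $h_y=(d-c)/M_y$, $x_j=a+jh_x$, $y_k=c+kh_y$, $t_n=n\tau$. For grid functions $V$ and $1\le j\le M_x-1$, $1\le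 k\le M_y-1$ let $$(\mathcal L_x^\alpha V)_{j,k}=-\frac1{h_x^\alpha}\sum_{s=1}^{M_x-1}c^\alpha_{j-s}V_{s,k},\quad(\mathcal L_y^\alpha V)_{j,k}=-\frac1{h_y^\alpha}\sum_{s=1}^{M_y-1}c^\alpha_{k-s}V_{j,s},\quad c_s^\alpha=\frac{(-1)^s\,\Gamma(\alpha+1)}{\Gamma(\frac\alpha2-s+1)\,\Gamma(\frac\alpha2+s+1)}$$ (where $1/\Gamma=0$ at the poles of $\Gamma$). Let $U^n$ $(0\le n\le N)$ vanish at the boundary nodes and satisfy, at the interior nodes, $U^0_{j,k}=u_0(x_j,y_k)$, $$U^1_{j,k}=U^0_{j,k}+\tau\big(\mathbf i(\mathcal L_x^\alpha u_0)_{j,k}+\mathbf i(\mathcal L_y^\alpha u_0)_{j,k}+\mathbf i|u_0(x_j,y_k)|^2u_0(x_j,y_k)\big),$$ $$\Big(\frac1\tau-\mathbf i|U^n_{j,k}|^2-\mathbf i\mathcal L_x^\alpha-\mathbf i\mathcal L_y^\alpha\Big)U^{n+1}_{j,k}=\Big(\frac1\tau+\mathbf i|U^n_{j,k}|^2+\mathbf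 i\mathcal L_x^\alpha+\mathbf i\mathcal L_y^\alpha\Big)U^{n-1}_{j,k},\quad 1\le n\le N-1.$$ Assume that $u$ is smooth enough, that is, of class $C^m$ in $(x,y,t)$ for a sufficiently large absolute integer $m$: on $\Omega\times[0,T]$ if $\alpha=2$, and, as the function extended by zero, on $\mathbb R^2\times[0,T]$ if $\alpha<2$. Then there are positive constants $\tau_0,h_0,C_0$, independent of $\tau,h_x,h_y$, such that whenever $\tau<\tau_0$, $h_x<h_0$ and $h_y<h_0$, $$\max_{1\le j\le M_x-1,\;1\le k\le M_y-1}|u(x_j,y_k,t_n)-U^n_{j,k}|\le C_0(\tau^2+h_x^2+h_y^2),\qquad 1\le n\le N.$$ -/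

import Mathlib

open Set
open scoped NNReal

noncomputable section

namespace FracNLS

/-! ### The continuous problem -/

/-- Left Riemann-Liouville derivative of order `α ∈ (1, 2)` on the whole line. -/
def leftRL (α : ℝ) (f : ℝ → ℂ) (x : ℝ) : ℂ :=
  ((1 / Real.Gamma (2 - α) : ℝ) : ℂ) *
    iteratedDeriv 2 (fun z : ℝ => ∫ ξ in Iio z, f ξ / (((z - ξ) ^ (α - 1) : ℝ) : ℂ)) x

/-- Right Riemann-Liouville derivative of order `α ∈ (1, 2)` on the whole line. -/
def rightRL (α : ℝ) (f : ℝ → ℂ) (x : ℝ) : ℂ :=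
  ((1 / Real.Gamma (2 - α) : ℝ) : ℂ) *
    iteratedDeriv 2 (fun z : ℝ => ∫ ξ in Ioi z, f ξ / (((ξ - z) ^ (α - 1) : ℝ) : ℂ)) x

/-- One-dimensional Riesz derivative of order `α ∈ (1, 2]`. For `α = 2` the integrals above diverge
and the prefactor `1 / Γ(0)` vanishes; there the Riesz derivative is the second derivative. -/
def riesz (α : ℝ) (f : ℝ → ℂ) (x : ℝ) : ℂ :=
  if α = 2 then iteratedDeriv 2 f x
  else -((1 / (2 * Real.cos (α * Real.pi / 2)) : ℝ) : ℂ) * (leftRL α f x + rightRL α f x)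

/-- `u x y t` solves the fractional nonlinear Schrödinger equation in the interior of the rectangle
`Ω = [a,b] × [c,d]` for `0 < t < T`, with initial value `u₀` and with the homogeneous Dirichlet
condition; since the Riesz derivative is nonlocal, `u` is extended by zero to the whole plane. -/
structure IsDirichletSolution (α a b c d T : ℝ) (u₀ : ℝ → ℝ → ℂ) (u : ℝ → ℝ → ℝ → ℂ) :
    Prop where
  equation : ∀ x ∈ Ioo a b, ∀ y ∈ Ioo c d, ∀ t ∈ Ioo 0 T,
    Complex.I * deriv (fun s => u x y s) t
      + (riesz α (fun ξ => u ξ y t) x + riesz α (fun η => u x η t) y)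
      + ((‖u x y t‖ ^ 2 : ℝ) : ℂ) * u x y t = 0
  initial : ∀ x ∈ Icc a b, ∀ y ∈ Icc c d, u x y 0 = u₀ x y
  vanishes : ∀ x y : ℝ, ¬ (x ∈ Ioo a b ∧ y ∈ Ioo c d) → ∀ t ∈ Icc 0 T, u x y t = 0

/-- Smoothness of order `m` in space and time. It is smoothness up to the boundary of `Ω × [0,T]`;
in the nonlocal case `α < 2`, where the operator acts on the extension by zero, that extension has
to be smooth on the whole plane. -/
structure IsSmooth (m : ℕ) (α a b c d T : ℝ) (u : ℝ → ℝ → ℝ → ℂ) : Prop where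
  upToBoundary : ContDiffOn ℝ m (fun p : ℝ × ℝ × ℝ => u p.1 p.2.1 p.2.2)
    (Icc a b ×ˢ Icc c d ×ˢ Icc 0 T)
  extension : α < 2 → ContDiffOn ℝ m (fun p : ℝ × ℝ × ℝ => u p.1 p.2.1 p.2.2)
    (univ ×ˢ univ ×ˢ Icc 0 T)

/-! ### The difference scheme -/

/-- Coefficients of the fractional centered difference. Mathlib's `Γ` is `0` at its poles, so that
the quotient is `0` there, as it should be (this occurs only for `α = 2` and `|s| ≥ 2`). -/
def coeff (α : ℝ) (s : ℤ) : ℝ :=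
  (-1 : ℝ) ^ s * Real.Gamma (α + 1) /
    (Real.Gamma (α / 2 - s + 1) * Real.Gamma (α / 2 + s + 1))

/-- Fractional centered difference in `x`, with mesh size `h` and `M` subintervals, of a grid
function with zero boundary values. -/
def diffX (α h : ℝ) (M : ℕ) (V : ℕ → ℕ → ℂ) (j k : ℕ) : ℂ :=
  -((1 / h ^ α : ℝ) : ℂ) * ∑ s ∈ Finset.Ioo 0 M, (coeff α ((j : ℤ) - (s : ℤ)) : ℂ) * V s k

/-- Fractional centered difference in `y`. -/
def diffY (α h : ℝ) (M : ℕ) (V : ℕ → ℕ → ℂ) (j k : ℕ) : ℂ :=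
  -((1 / h ^ α : ℝ) : ℂ) * ∑ s ∈ Finset.Ioo 0 M, (coeff α ((k : ℤ) - (s : ℤ)) : ℂ) * V j s

/-- Maximum norm of a grid function over the interior nodes. -/
def supNorm (Mx My : ℕ) (V : ℕ → ℕ → ℂ) : ℝ :=
  (((Finset.Ioo 0 Mx ×ˢ Finset.Ioo 0 My).sup fun p => ‖V p.1 p.2‖₊ : ℝ≥0) : ℝ)

/-- Values of a function on the nodes `(a + j hx, c + k hy)`. -/
def sample (a c hx hy : ℝ) (f : ℝ → ℝ → ℂ) (j k : ℕ) : ℂ :=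
  f (a + j * hx) (c + k * hy)

/-- `U n j k` solves the linearized three-level scheme with `N` time steps of length `τ` on the grid
with `Mx × My` cells of size `hx × hy` and lower left corner `(a, c)`. -/
structure IsSchemeSolution (α a c hx hy τ : ℝ) (Mx My N : ℕ) (u₀ : ℝ → ℝ → ℂ)
    (U : ℕ → ℕ → ℕ → ℂ) : Prop where
  boundaryX : ∀ n ≤ N, ∀ k ≤ My, U n 0 k = 0 ∧ U n Mx k = 0
  boundaryY : ∀ n ≤ N, ∀ j ≤ Mx, U n j 0 = 0 ∧ U n j My = 0
  initial : ∀ j ∈ Ioo 0 Mx, ∀ k ∈ Ioo 0 My, U 0 j k = sample a c hx hy u₀ j k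
  firstStep : ∀ j ∈ Ioo 0 Mx, ∀ k ∈ Ioo 0 My,
    U 1 j k = U 0 j k + (τ : ℂ) *
      (Complex.I * diffX α hx Mx (sample a c hx hy u₀) j k
        + Complex.I * diffY α hy My (sample a c hx hy u₀) j k
        + Complex.I * ((‖sample a c hx hy u₀ j k‖ ^ 2 : ℝ) : ℂ) * sample a c hx hy u₀ j k)
  step : ∀ n, 1 ≤ n → n < N → ∀ j ∈ Ioo 0 Mx, ∀ k ∈ Ioo 0 My,
    ((1 / τ : ℝ) : ℂ) * U (n + 1) j k
        - Complex.I * ((‖U n j k‖ ^ 2 : ℝ) : ℂ) * U (n + 1) j k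
        - Complex.I * diffX α hx Mx (U (n + 1)) j k
        - Complex.I * diffY α hy My (U (n + 1)) j k
      = ((1 / τ : ℝ) : ℂ) * U (n - 1) j k
        + Complex.I * ((‖U n j k‖ ^ 2 : ℝ) : ℂ) * U (n - 1) j k
        + Complex.I * diffX α hx Mx (U (n - 1)) j k
        + Complex.I * diffY α hy My (U (n - 1)) j k

end FracNLS

end

/-!
The proof measures the error in one norm that does everything at once. Let `A` be the positive
matrix of the one-dimensional fractional centered difference, so that the discrete operator is
`L = -(Aₓ + A_y)`, and let `N v ^ 2 = ⟨(1 + Aₓ)(1 + A_y) v, v⟩`, scaled by the mesh (`energy`,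
`gridEnergy`). All constants below are independent of the mesh.

* `N` controls the maximum norm (`norm_le_energy`). This is the product of two one-dimensional
  Sobolev inequalities, which hold because `α > 1`: the symbol of `h ^ α A` is `|2 sin π x| ^ α`
  (`hasSum_symbol`), and the reciprocal of the symbol of `1 + A` has an integral of order `h`.
* `N` is submultiplicative up to a constant (`energy_mul_le`). The coefficients off the center are
  nonpositive and the row sums nonnegative, so `N v ^ 2` is a sum of weighted squares of mixed
  increments of `v` over pairs of edges of a graph, and products can be estimated edge by edge.
* `N` is not increased by an implicit midpoint step for `L`, which commutes with the form
  (`energy_step`).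

Therefore the cubic term is locally Lipschitz in `N`, and a discrete Gronwall argument gives
convergence as long as the consistency errors are small in `N` (`stability`). The solution stays in
a ball on which the Lipschitz constant applies because the error bound itself keeps it there.

Errors in time are estimated by Taylor's formula, applied to spatial differences of `u`
(`Jet.corner_chain`), since bounds on mixed difference quotients bound `N` (`energy_interior_le`).
Errors in space are of second order in the maximum norm (`Profile.consistency`): for `α < 2` the
Riesz derivative is the Fourier multiplier `-|2πk| ^ α` (`FourierPair.riesz_eq`), which the symbol
of the difference approximates to second order (`abs_symbol_sub_le`); for `α = 2` this is Taylor's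
formula. In `N`, however, the spatial residual `r` is only bounded to first order: it is cut off at
the boundary nodes, so that its differences have no better bound than its values. This is enough in
the first time step, where `r` carries a factor `τ`.
In all other steps `r` is removed by an elliptic corrector `η` with `η - L η = -r`: the norm `N η`
is bounded by the maximum of `r` (`gridEnergy_elliptic_le`), and so are the time differences of `η`
by those of `r`, which are of order `τ (hₓ ^ 2 + h_y ^ 2)`.
-/

noncomputable section
namespace FracNLS

/-! ### The coefficients of the fractional centered difference -/

lemma coeff_neg (α : ℝ) (s : ℤ) : coeff α (-s) = coeff α s := by
  unfold coeff
  rw [zpow_neg, ← inv_zpow, inv_neg_one]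
  push_cast
  rw [mul_comm (Real.Gamma _) (Real.Gamma _)]
  congr 3
  ring_nf

/-- The recurrence for the coefficients. For `α = 2` and `n ≥ 1` both sides vanish, as `Γ` takes the
value `0` at its poles. -/
lemma coeff_succ {α : ℝ} (hα : 0 < α) (n : ℕ) :
    ((n : ℝ) + 1 + α / 2) * coeff α ((n : ℤ) + 1) = ((n : ℝ) - α / 2) * coeff α n := by
  unfold coeff
  have hp : 0 < α / 2 + (n : ℝ) + 1 := by positivity
  have e1 : Real.Gamma (α / 2 + (((n : ℤ) + 1 : ℤ) : ℝ) + 1)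
      = (α / 2 + n + 1) * Real.Gamma (α / 2 + n + 1) := by
    rw [← Real.Gamma_add_one hp.ne']; push_cast; ring_nf
  have e2 : α / 2 - (((n : ℤ) + 1 : ℤ) : ℝ) + 1 = α / 2 - n := by push_cast; ring
  have hg : Real.Gamma (α / 2 + n + 1) ≠ 0 := (Real.Gamma_pos_of_pos hp).ne'
  have e3 : ((n : ℤ) : ℝ) = n := by simp
  rw [e1, e2, e3, zpow_add_one₀ (by norm_num)]
  by_cases h : α / 2 - n = 0
  · have h' : (n : ℝ) - α / 2 = 0 := by linarith
    rw [h, h', Real.Gamma_zero]; simp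
  · rw [Real.Gamma_add_one h]
    by_cases hz : Real.Gamma (α / 2 - n) = 0
    · rw [hz]; simp
    · have hd : (n : ℝ) - α / 2 = -(α / 2 - n) := by ring
      have hp' : (n : ℝ) + 1 + α / 2 = α / 2 + n + 1 := by ring
      rw [hd, hp']
      generalize α / 2 - (n : ℝ) = d at *
      generalize α / 2 + (n : ℝ) + 1 = p at *
      have := hp.ne'
      field_simp

lemma coeff_zero (α : ℝ) :
    coeff α 0 = Real.Gamma (α + 1) / (Real.Gamma (α / 2 + 1)) ^ 2 := by
  unfold coeff; simp [sq]

/-- By the recurrence all coefficients beyond the first have its sign, since `α / 2 ≤ 1`. -/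
lemma coeff_nonpos {α : ℝ} (h1 : 1 < α) (h2 : α ≤ 2) (n : ℕ) :
    coeff α ((n : ℤ) + 1) ≤ 0 := by
  induction n with
  | zero =>
    have h := coeff_succ (by linarith : 0 < α) 0
    have h0 : 0 ≤ coeff α 0 := by
      rw [coeff_zero]
      have := Real.Gamma_nonneg_of_nonneg (by linarith : 0 ≤ α + 1)
      positivity
    simp only [Nat.cast_zero, zero_add] at h ⊢
    simp only [zero_sub] at h
    have hh : (1 + α / 2) * coeff α 1 ≤ 0 := by
      rw [h]; nlinarith
    by_contra hc
    push Not at hc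
    have : 0 < (1 + α / 2) * coeff α 1 := by positivity
    linarith
  | succ n ih =>
    have h := coeff_succ (by linarith : 0 < α) (n + 1)
    push_cast at *
    by_contra hc
    push Not at hc
    have : 0 < ((n : ℝ) + 1 + 1 + α / 2) * coeff α ((n : ℤ) + 1 + 1) := by positivity
    rw [h] at this
    have h3 : 0 ≤ (n : ℝ) + 1 - α / 2 := by
      have : (0 : ℝ) ≤ n := by positivity
      linarith
    nlinarith

lemma coeff_nonpos_of_ne {α : ℝ} (h1 : 1 < α) (h2 : α ≤ 2) {s : ℤ} (hs : s ≠ 0) :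
    coeff α s ≤ 0 := by
  rcases lt_or_gt_of_ne hs with h | h
  · obtain ⟨n, hn⟩ : ∃ n : ℕ, s = -((n : ℤ) + 1) := ⟨(-s - 1).toNat, by omega⟩
    rw [hn, coeff_neg]; exact coeff_nonpos h1 h2 n
  · obtain ⟨n, hn⟩ : ∃ n : ℕ, s = (n : ℤ) + 1 := ⟨(s - 1).toNat, by omega⟩
    rw [hn]; exact coeff_nonpos h1 h2 n

/-- The recurrence for the coefficients telescopes, so that their sums stay bounded. -/
lemma sum_coeff {α : ℝ} (hα : 0 < α) (n : ℕ) :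
    α * ∑ i ∈ Finset.range n, coeff α ((i : ℤ) + 1)
      = (1 + α / 2) * coeff α 1 - ((n : ℝ) + 1 + α / 2) * coeff α ((n : ℤ) + 1) := by
  induction n with
  | zero => simp
  | succ n ih =>
    rw [Finset.sum_range_succ, mul_add, ih]
    have h := coeff_succ hα (n + 1)
    push_cast at *
    rw [h]
    ring

/-- Partial sums of terms of one sign that stay bounded. -/
lemma summable_coeff {α : ℝ} (h1 : 1 < α) (h2 : α ≤ 2) : Summable (coeff α) := by
  have key : Summable fun n : ℕ => coeff α ((n : ℤ) + 1) := by
    rw [← summable_neg_iff]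
    refine summable_of_sum_range_le (c := -((1 + α / 2) * coeff α 1) / α)
      (fun n => by simpa using coeff_nonpos h1 h2 n) (fun n => ?_)
    rw [le_div_iff₀ (by linarith), Finset.sum_neg_distrib]
    have h := sum_coeff (by linarith : 0 < α) n
    have h' := coeff_nonpos h1 h2 n
    have : 0 ≤ (n : ℝ) + 1 + α / 2 := by positivity
    nlinarith
  refine Summable.of_nat_of_neg_add_one ?_ ?_
  · refine (summable_nat_add_iff 1).1 ?_
    simpa using key
  · have : (fun n : ℕ => coeff α (-((n : ℤ) + 1))) = fun n : ℕ => coeff α ((n : ℤ) + 1) := by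
      ext n; rw [coeff_neg]
    rw [this]; exact key

/-! ### The symbol -/

/-- The symbol `(2 sin π x) ^ α` of the centered difference, as a function on `ℝ`; the absolute
value makes it periodic of period one. -/
def symbol (α x : ℝ) : ℝ := |2 * Real.sin (Real.pi * x)| ^ α

lemma symbol_nonneg (α x : ℝ) : 0 ≤ symbol α x := by unfold symbol; positivity

lemma continuous_symbol {α : ℝ} (hα : 0 < α) : Continuous (symbol α) := by
  unfold symbol
  refine Continuous.rpow_const (by fun_prop) (fun x => Or.inr hα.le)

lemma symbol_periodic (α : ℝ) : Function.Periodic (symbol α) 1 := by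
  intro x
  unfold symbol
  rw [mul_add, mul_one, Real.sin_add_pi, mul_neg, abs_neg]

lemma symbol_eq {α x : ℝ} (hx : x ∈ Icc (0 : ℝ) 1) :
    symbol α x = (2 * Real.sin (Real.pi * x)) ^ α := by
  unfold symbol
  rw [abs_of_nonneg]
  have := Real.sin_nonneg_of_nonneg_of_le_pi (mul_nonneg Real.pi_pos.le hx.1)
    (mul_le_of_le_one_right Real.pi_pos.le hx.2)
  positivity

/-- The cosine coefficients of the symbol obey the recurrence `coeff_succ`: integrate the
derivative of `(2 sin π x) ^ α (sin (2 π (n + 1) x) - sin (2 π n x))`. -/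
lemma cosine_coeff_succ {α : ℝ} (h1 : 1 < α) (n : ℕ) :
    ((n : ℝ) + 1 + α / 2) * ∫ x in (0 : ℝ)..1, symbol α x * Real.cos (2 * Real.pi * (n + 1) * x)
      = ((n : ℝ) - α / 2) * ∫ x in (0 : ℝ)..1, symbol α x * Real.cos (2 * Real.pi * n * x) := by
  have hcs := continuous_symbol (by linarith : 0 < α)
  set F : ℝ → ℝ := fun x => (2 * Real.sin (Real.pi * x)) ^ α
    * (Real.sin (2 * Real.pi * (n + 1) * x) - Real.sin (2 * Real.pi * n * x)) with hF
  have hder : ∀ x ∈ uIcc (0 : ℝ) 1, HasDerivAt F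
      (2 * Real.pi * (((n : ℝ) + 1 + α / 2) * (symbol α x * Real.cos (2 * Real.pi * (n + 1) * x))
        - ((n : ℝ) - α / 2) * (symbol α x * Real.cos (2 * Real.pi * n * x)))) x := by
    intro x hx
    rw [uIcc_of_le zero_le_one] at hx
    have hs0 : 0 ≤ 2 * Real.sin (Real.pi * x) := by
      have := Real.sin_nonneg_of_nonneg_of_le_pi (mul_nonneg Real.pi_pos.le hx.1)
        (mul_le_of_le_one_right Real.pi_pos.le hx.2)
      positivity
    have hlin : ∀ k : ℝ, HasDerivAt (fun x : ℝ => k * x) k x := fun k => by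
      simpa using (hasDerivAt_id x).const_mul k
    have d1 : HasDerivAt (fun x => 2 * Real.sin (Real.pi * x))
        (2 * (Real.cos (Real.pi * x) * Real.pi)) x := ((hlin Real.pi).sin).const_mul 2
    have d2 := d1.rpow_const (p := α) (Or.inr h1.le)
    have d3 := ((hlin (2 * Real.pi * (n + 1))).sin).sub ((hlin (2 * Real.pi * n)).sin)
    refine (d2.mul d3).congr_deriv ?_
    rw [symbol_eq hx]
    have hpow : (2 * Real.sin (Real.pi * x)) ^ α
        = (2 * Real.sin (Real.pi * x)) ^ (α - 1) * (2 * Real.sin (Real.pi * x)) := by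
      rcases hs0.eq_or_lt with h | h
      · rw [← h, Real.zero_rpow (by linarith), mul_zero]
      · rw [← Real.rpow_add_one h.ne']; ring_nf
    have ea : Real.sin (2 * Real.pi * (n + 1) * x) - Real.sin (2 * Real.pi * n * x)
        = 2 * Real.sin (Real.pi * x) * Real.cos ((2 * n + 1) * Real.pi * x) := by
      rw [Real.sin_sub_sin]; ring_nf
    have eb : Real.cos (2 * Real.pi * (n + 1) * x) + Real.cos (2 * Real.pi * n * x)
        = 2 * Real.cos ((2 * n + 1) * Real.pi * x) * Real.cos (Real.pi * x) := by
      rw [Real.cos_add_cos]; ring_nf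
    rw [Pi.sub_apply, ea]
    set P := (2 * Real.sin (Real.pi * x)) ^ (α - 1)
    rw [hpow]
    set c1 := Real.cos (2 * Real.pi * (n + 1) * x)
    set c2 := Real.cos (2 * Real.pi * n * x)
    set S := Real.sin (Real.pi * x)
    set c3 := Real.cos ((2 * n + 1) * Real.pi * x)
    set C := Real.cos (Real.pi * x)
    linear_combination (-(P * (2 * S) * Real.pi * α)) * eb
  have hint := intervalIntegral.integral_eq_sub_of_hasDerivAt hder
    (Continuous.intervalIntegrable (by fun_prop) _ _)
  have h0 : F 1 - F 0 = 0 := by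
    simp [hF, Real.zero_rpow (by linarith : α ≠ 0)]
  rw [h0, intervalIntegral.integral_const_mul, intervalIntegral.integral_sub
    (Continuous.intervalIntegrable (by fun_prop) _ _)
    (Continuous.intervalIntegrable (by fun_prop) _ _), intervalIntegral.integral_const_mul,
    intervalIntegral.integral_const_mul] at hint
  have := (mul_eq_zero.1 hint).resolve_left (by positivity)
  linarith

/-- The mean of the symbol: a Beta integral, after the substitution `s = (1 - cos π x) / 2`,
combined with Legendre's duplication formula. -/
lemma integral_symbol {α : ℝ} (h1 : 1 < α) :
    ∫ x in (0 : ℝ)..1, symbol α x = coeff α 0 := by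
  have hp := Real.pi_pos
  set q : ℝ := (α + 1) / 2 with hq
  have hq0 : 0 < q := by rw [hq]; linarith
  have hbeta : ∫ s in (0 : ℝ)..1, s ^ (q - 1) * (1 - s) ^ (q - 1)
      = Real.Gamma q * Real.Gamma q / Real.Gamma (q + q) := by
    have h := Complex.betaIntegral_eq_Gamma_mul_div (q : ℂ) q (by simpa using hq0)
      (by simpa using hq0)
    rw [← Complex.ofReal_inj]
    rw [Complex.ofReal_div, Complex.ofReal_mul, ← Complex.Gamma_ofReal, ← Complex.Gamma_ofReal,
      Complex.ofReal_add, ← h, Complex.betaIntegral, ← intervalIntegral.integral_ofReal]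
    refine intervalIntegral.integral_congr fun s hs => ?_
    rw [uIcc_of_le zero_le_one] at hs
    rw [Complex.ofReal_mul, Complex.ofReal_cpow hs.1, Complex.ofReal_cpow (by linarith [hs.2])]
    push_cast
    ring_nf
  have hsub : ∫ x in (0 : ℝ)..1, ((fun s : ℝ => s ^ (q - 1) * (1 - s) ^ (q - 1)) ∘
        fun x => (1 - Real.cos (Real.pi * x)) / 2) x * (Real.pi * Real.sin (Real.pi * x) / 2)
      = ∫ s in (0 : ℝ)..1, s ^ (q - 1) * (1 - s) ^ (q - 1) := by
    have := intervalIntegral.integral_comp_mul_deriv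
      (f := fun x => (1 - Real.cos (Real.pi * x)) / 2)
      (f' := fun x => Real.pi * Real.sin (Real.pi * x) / 2)
      (g := fun s : ℝ => s ^ (q - 1) * (1 - s) ^ (q - 1)) (a := 0) (b := 1) ?_ ?_ ?_
    · rw [this]; simp
    · intro x _
      have hlin : HasDerivAt (fun x : ℝ => Real.pi * x) Real.pi x := by
        simpa using (hasDerivAt_id x).const_mul Real.pi
      refine ((hlin.cos.const_sub 1).div_const 2).congr_deriv ?_
      ring
    · fun_prop
    · refine Continuous.mul ?_ ?_
      · exact continuous_id.rpow_const (fun x => Or.inr (by rw [hq]; linarith))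
      · exact (continuous_const.sub continuous_id).rpow_const
          (fun x => Or.inr (by rw [hq]; linarith))
  have hpt : ∀ x ∈ uIcc (0 : ℝ) 1, ((fun s : ℝ => s ^ (q - 1) * (1 - s) ^ (q - 1)) ∘
        fun x => (1 - Real.cos (Real.pi * x)) / 2) x * (Real.pi * Real.sin (Real.pi * x) / 2)
      = (Real.pi * (2 : ℝ) ^ (-2 * α)) * symbol α x := by
    intro x hx
    rw [uIcc_of_le zero_le_one] at hx
    rw [symbol_eq hx]
    have hs0 : 0 ≤ Real.sin (Real.pi * x) :=
      Real.sin_nonneg_of_nonneg_of_le_pi (mul_nonneg Real.pi_pos.le hx.1)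
        (mul_le_of_le_one_right Real.pi_pos.le hx.2)
    simp only [Function.comp]
    have hc := Real.neg_one_le_cos (Real.pi * x)
    have hc' := Real.cos_le_one (Real.pi * x)
    rw [← Real.mul_rpow (by linarith) (by linarith)]
    have e : (1 - Real.cos (Real.pi * x)) / 2 * (1 - (1 - Real.cos (Real.pi * x)) / 2)
        = (Real.sin (Real.pi * x) / 2) ^ (2 : ℝ) := by
      rw [Real.rpow_two]
      have := Real.sin_sq_add_cos_sq (Real.pi * x)
      linear_combination (1 / 4 : ℝ) * (-this)
    rw [e, ← Real.rpow_mul (by positivity)]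
    have e2 : (2 : ℝ) * (q - 1) = α - 1 := by rw [hq]; ring
    rw [e2]
    rcases hs0.eq_or_lt with h | h
    · rw [← h]; simp [Real.zero_rpow (by linarith : α ≠ 0)]
    · have e3 : (Real.sin (Real.pi * x) / 2) ^ (α - 1) * (Real.sin (Real.pi * x) / 2)
          = (Real.sin (Real.pi * x) / 2) ^ α := by
        rw [← Real.rpow_add_one (by positivity)]; ring_nf
      have e4 : (Real.sin (Real.pi * x) / 2) ^ α
          = (2 : ℝ) ^ (-2 * α) * (2 * Real.sin (Real.pi * x)) ^ α := by
        rw [Real.rpow_mul (by norm_num), ← Real.mul_rpow (by positivity) (by positivity)]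
        congr 1
        rw [Real.rpow_neg (by norm_num), Real.rpow_two]; ring
      rw [mul_assoc, ← e4, ← e3]; ring
  rw [intervalIntegral.integral_congr hpt, intervalIntegral.integral_const_mul, hbeta] at hsub
  have hdup := Real.Gamma_mul_Gamma_add_half q
  have e5 : q + 1 / 2 = α / 2 + 1 := by rw [hq]; ring
  have e6 : 2 * q = α + 1 := by rw [hq]; ring
  have e7 : q + q = α + 1 := by rw [hq]; ring
  rw [e5, e6] at hdup
  rw [e7] at hsub
  rw [coeff_zero]
  have hG1 := Real.Gamma_pos_of_pos (by linarith : 0 < α + 1)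
  have hG2 := Real.Gamma_pos_of_pos (by linarith : 0 < α / 2 + 1)
  have hG3 := Real.Gamma_pos_of_pos hq0
  have e8 : (2 : ℝ) ^ (-2 * α) = ((2 : ℝ) ^ (1 - (α + 1))) ^ 2 := by
    rw [← Real.rpow_natCast, ← Real.rpow_mul (by norm_num)]; congr 1; push_cast; ring
  have h2p : (0 : ℝ) < (2 : ℝ) ^ (1 - (α + 1)) := by positivity
  rw [e8] at hsub
  set A := (2 : ℝ) ^ (1 - (α + 1))
  set J := ∫ x in (0 : ℝ)..1, symbol α x
  have hsq : √Real.pi * √Real.pi = Real.pi := Real.mul_self_sqrt hp.le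
  have h4 : (Real.Gamma q * Real.Gamma (α / 2 + 1)) ^ 2
      = Real.Gamma (α + 1) ^ 2 * A ^ 2 * Real.pi := by
    rw [hdup, mul_pow, mul_pow, sq (√Real.pi), hsq]
  rw [eq_div_iff hG1.ne'] at hsub
  rw [eq_div_iff (by positivity)]
  have h5 : (J * Real.Gamma (α / 2 + 1) ^ 2) * (Real.pi * A ^ 2 * Real.Gamma (α + 1))
      = Real.Gamma (α + 1) * (Real.pi * A ^ 2 * Real.Gamma (α + 1)) := by
    linear_combination (Real.Gamma (α / 2 + 1) ^ 2) * hsub + h4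
  exact mul_right_cancel₀ (by positivity) h5

lemma cosine_coeff {α : ℝ} (h1 : 1 < α) (n : ℕ) :
    ∫ x in (0 : ℝ)..1, symbol α x * Real.cos (2 * Real.pi * n * x) = coeff α n := by
  induction n with
  | zero => simpa using integral_symbol h1
  | succ n ih =>
    have e1 := cosine_coeff_succ h1 n
    have e2 := coeff_succ (by linarith : 0 < α) n
    rw [ih, ← e2] at e1
    have hp : (0 : ℝ) < (n : ℝ) + 1 + α / 2 := by
      have : (0 : ℝ) ≤ n := by positivity
      linarith
    push_cast
    exact mul_left_cancel₀ hp.ne' e1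

/-! ### Fourier series of the symbol -/

/-- The character `x ↦ exp (2 π i n x)`. -/
def chr (n : ℤ) (x : ℝ) : ℂ := Complex.exp (2 * Real.pi * Complex.I * n * x)

lemma continuous_chr (n : ℤ) : Continuous (chr n) := by unfold chr; fun_prop

lemma chr_add (m n : ℤ) (x : ℝ) : chr (m + n) x = chr m x * chr n x := by
  unfold chr; rw [← Complex.exp_add]; push_cast; ring_nf

lemma norm_chr (n : ℤ) (x : ℝ) : ‖chr n x‖ = 1 := by
  unfold chr
  have : (2 * Real.pi * Complex.I * n * x : ℂ) = ((2 * Real.pi * n * x : ℝ) : ℂ) * Complex.I := by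
    push_cast; ring
  rw [this, Complex.norm_exp_ofReal_mul_I]

lemma chr_conj (n : ℤ) (x : ℝ) : (starRingEnd ℂ) (chr n x) = chr (-n) x := by
  unfold chr
  rw [← Complex.exp_conj]
  simp [map_ofNat]

lemma chr_add_chr_neg (n : ℤ) (x : ℝ) :
    chr n x + chr (-n) x = ((2 * Real.cos (2 * Real.pi * n * x) : ℝ) : ℂ) := by
  unfold chr
  push_cast
  rw [Complex.two_cos]
  congr 2
  · ring
  · ring

lemma integral_chr (n : ℤ) : ∫ x in (0 : ℝ)..1, chr n x = if n = 0 then 1 else 0 := by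
  split_ifs with h
  · simp [chr, h]
  · unfold chr
    have hc : (2 * Real.pi * Complex.I * n : ℂ) ≠ 0 := by
      have := Real.pi_ne_zero
      simp [this, h]
    rw [integral_exp_mul_complex hc]
    have : Complex.exp (2 * Real.pi * Complex.I * n * (1 : ℝ)) = 1 := by
      rw [Complex.exp_eq_one_iff]; exact ⟨n, by push_cast; ring⟩
    rw [this]; simp

lemma integral_symbol_chr {α : ℝ} (h1 : 1 < α) (n : ℤ) :
    ∫ x in (0 : ℝ)..1, (symbol α x : ℂ) * chr n x = coeff α n := by
  have hcs := continuous_symbol (by linarith : 0 < α)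
  have hcc := continuous_chr
  have hcont : ∀ n, Continuous fun x => (symbol α x : ℂ) * chr n x := fun n =>
    (Complex.continuous_ofReal.comp hcs).mul (hcc n)
  have hrefl : ∀ n : ℤ, ∫ x in (0 : ℝ)..1, (symbol α x : ℂ) * chr n x
      = ∫ x in (0 : ℝ)..1, (symbol α x : ℂ) * chr (-n) x := by
    intro n
    have := intervalIntegral.integral_comp_sub_left (a := 0) (b := 1)
      (fun x => (symbol α x : ℂ) * chr n x) 1
    simp only [sub_self, sub_zero] at this
    rw [← this]
    congr 1; ext x
    congr 1
    · congr 1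
      unfold symbol
      rw [mul_sub, mul_one, Real.sin_pi_sub]
    · unfold chr
      have : (2 * Real.pi * Complex.I * n * ((1 - x : ℝ) : ℂ))
          = 2 * Real.pi * Complex.I * (-n : ℤ) * x + n * (2 * Real.pi * Complex.I) := by
        push_cast; ring
      rw [this, Complex.exp_add, Complex.exp_int_mul_two_pi_mul_I, mul_one]
  have hcos : ∀ n : ℤ, ∫ x in (0 : ℝ)..1, (symbol α x : ℂ) * chr n x
      = ((∫ x in (0 : ℝ)..1, symbol α x * Real.cos (2 * Real.pi * n * x) : ℝ) : ℂ) := by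
    intro n
    have h2 : ∫ x in (0 : ℝ)..1, (symbol α x : ℂ) * chr n x
        + (symbol α x : ℂ) * chr (-n) x
        = 2 * ((∫ x in (0 : ℝ)..1, symbol α x * Real.cos (2 * Real.pi * n * x) : ℝ) : ℂ) := by
      rw [← intervalIntegral.integral_ofReal, ← intervalIntegral.integral_const_mul]
      congr 1; ext x
      rw [← mul_add, chr_add_chr_neg]; push_cast; ring
    rw [intervalIntegral.integral_add ((hcont n).intervalIntegrable _ _)
      ((hcont (-n)).intervalIntegrable _ _), ← hrefl n, ← two_mul] at h2
    exact mul_left_cancel₀ two_ne_zero h2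
  rcases le_total 0 n with h | h
  · obtain ⟨k, rfl⟩ := Int.eq_ofNat_of_zero_le h
    rw [hcos]
    have := cosine_coeff h1 k
    push_cast at *
    rw [this]
  · obtain ⟨k, hk⟩ := Int.eq_ofNat_of_zero_le (neg_nonneg.2 h)
    rw [hrefl, hcos, ← coeff_neg, hk]
    have := cosine_coeff h1 k
    push_cast at *
    rw [this]

/-- The symbol is the sum of its Fourier series, whose coefficients are those of the difference
operator. -/
lemma hasSum_symbol {α : ℝ} (h1 : 1 < α) (h2 : α ≤ 2) (x : ℝ) :
    HasSum (fun n : ℤ => (coeff α n : ℂ) * chr n x) (symbol α x : ℂ) := by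
  have hper : Function.Periodic (fun x => (symbol α x : ℂ)) 1 := fun x => by
    simp only [symbol_periodic α x]
  have hcs := continuous_symbol (by linarith : 0 < α)
  let F : C(AddCircle (1 : ℝ), ℂ) :=
    ⟨hper.lift, continuous_coinduced_dom.mpr (by
      change Continuous fun x => (symbol α x : ℂ)
      fun_prop)⟩
  have hF : ∀ x : ℝ, F (x : AddCircle (1 : ℝ)) = symbol α x := fun x => rfl
  have : Fact ((0 : ℝ) < 1) := ⟨one_pos⟩
  have hcoef : ∀ n, fourierCoeff F n = coeff α n := by
    intro n
    rw [fourierCoeff_eq_intervalIntegral F n 0]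
    rw [← coeff_neg, ← integral_symbol_chr h1]
    simp only [zero_add, div_one, one_smul]
    congr 1; ext x
    rw [fourier_coe_apply, hF, smul_eq_mul, mul_comm]
    unfold chr
    push_cast
    ring_nf
  have hsum : Summable (fourierCoeff F) := by
    rw [funext hcoef]
    exact Complex.summable_ofReal.2 (summable_coeff h1 h2)
  have := has_pointwise_sum_fourier_series_of_summable hsum (x : AddCircle (1 : ℝ))
  rw [hF] at this
  refine this.congr_fun fun n => ?_
  rw [hcoef, fourier_coe_apply, smul_eq_mul]
  unfold chr
  push_cast
  ring_nf

lemma hasSum_coeff {α : ℝ} (h1 : 1 < α) (h2 : α ≤ 2) : HasSum (coeff α) 0 := by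
  have := hasSum_symbol h1 h2 0
  have h0 : symbol α 0 = 0 := by simp [symbol, Real.zero_rpow (by linarith : α ≠ 0)]
  rw [h0] at this
  simpa [chr] using Complex.hasSum_ofReal.1 (by simpa [chr] using this)

/-- All coefficients but the central one are nonpositive, and the total is zero. -/
lemma sum_coeff_nonneg {α : ℝ} (h1 : 1 < α) (h2 : α ≤ 2) {S : Finset ℤ} (hS : 0 ∈ S) :
    0 ≤ ∑ s ∈ S, coeff α s := by
  have := sum_le_hasSum S (fun i hi => ?_) (hasSum_coeff h1 h2).neg
  · rw [Finset.sum_neg_distrib] at this; linarith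
  · have := coeff_nonpos_of_ne h1 h2 (s := i) (fun h => hi (h ▸ hS))
    linarith

/-! ### Trigonometric polynomials -/

/-- The trigonometric polynomial with coefficient `v i` at the frequency `pos i`. -/
def trigPoly {ι : Type*} (S : Finset ι) (pos : ι → ℤ) (v : ι → ℂ) (x : ℝ) : ℂ :=
  ∑ i ∈ S, v i * chr (pos i) x

section
variable {ι : Type*} (S : Finset ι) (pos : ι → ℤ) (v : ι → ℂ)

lemma continuous_trigPoly : Continuous (trigPoly S pos v) := by
  unfold trigPoly
  exact continuous_finsetSum _ fun i _ => continuous_const.mul (continuous_chr _)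

lemma normSq_trigPoly (x : ℝ) : ((‖trigPoly S pos v x‖ ^ 2 : ℝ) : ℂ)
    = ∑ i ∈ S, ∑ j ∈ S, v i * (starRingEnd ℂ) (v j) * chr (pos i - pos j) x := by
  push_cast
  rw [← Complex.mul_conj', trigPoly, map_sum, Finset.sum_mul_sum]
  refine Finset.sum_congr rfl fun i _ => Finset.sum_congr rfl fun j _ => ?_
  rw [map_mul, chr_conj, sub_eq_add_neg, chr_add]; ring

lemma integral_mul_normSq_trigPoly {g : ℝ → ℝ} (hg : Continuous g) :
    ((∫ x in (0 : ℝ)..1, g x * ‖trigPoly S pos v x‖ ^ 2 : ℝ) : ℂ)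
      = ∑ i ∈ S, ∑ j ∈ S, v i * (starRingEnd ℂ) (v j)
          * ∫ x in (0 : ℝ)..1, (g x : ℂ) * chr (pos i - pos j) x := by
  have hc : ∀ n, Continuous fun x => (g x : ℂ) * chr n x := fun n =>
    (Complex.continuous_ofReal.comp hg).mul (continuous_chr n)
  have h : ∀ x, ((g x * ‖trigPoly S pos v x‖ ^ 2 : ℝ) : ℂ) = ∑ i ∈ S, ∑ j ∈ S,
      v i * (starRingEnd ℂ) (v j) * ((g x : ℂ) * chr (pos i - pos j) x) := by
    intro x
    rw [Complex.ofReal_mul, normSq_trigPoly, Finset.mul_sum]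
    refine Finset.sum_congr rfl fun i _ => ?_
    rw [Finset.mul_sum]
    refine Finset.sum_congr rfl fun j _ => ?_
    ring
  rw [← intervalIntegral.integral_ofReal]
  simp_rw [h]
  rw [intervalIntegral.integral_finsetSum fun i _ => Continuous.intervalIntegrable
    (by have := fun j => hc (pos i - pos j); fun_prop) _ _]
  refine Finset.sum_congr rfl fun i _ => ?_
  rw [intervalIntegral.integral_finsetSum fun j _ => Continuous.intervalIntegrable
    (by have := hc (pos i - pos j); fun_prop) _ _]
  refine Finset.sum_congr rfl fun j _ => ?_
  rw [intervalIntegral.integral_const_mul]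

lemma integral_symbol_mul_normSq_trigPoly {α : ℝ} (h1 : 1 < α) :
    ((∫ x in (0 : ℝ)..1, symbol α x * ‖trigPoly S pos v x‖ ^ 2 : ℝ) : ℂ)
      = ∑ i ∈ S, ∑ j ∈ S, v i * (starRingEnd ℂ) (v j) * coeff α (pos i - pos j) := by
  rw [integral_mul_normSq_trigPoly S pos v (continuous_symbol (by linarith))]
  simp_rw [integral_symbol_chr h1]

variable {pos} in
lemma integral_normSq_trigPoly (hpos : InjOn pos S) :
    ∫ x in (0 : ℝ)..1, ‖trigPoly S pos v x‖ ^ 2 = ∑ i ∈ S, ‖v i‖ ^ 2 := by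
  classical
  have h := integral_mul_normSq_trigPoly S pos v (g := fun _ => 1) continuous_const
  simp only [one_mul, Complex.ofReal_one, integral_chr] at h
  rw [← Complex.ofReal_inj, h]
  push_cast
  refine Finset.sum_congr rfl fun i hi => ?_
  rw [Finset.sum_eq_single i]
  · simp [Complex.mul_conj']
  · intro j hj hji
    have : pos i - pos j ≠ 0 := fun h0 => hji (hpos hj hi (by omega))
    simp [this]
  · intro h; exact absurd hi h

variable {pos} in
lemma integral_trigPoly_mul_chr (hpos : InjOn pos S) {i : ι} (hi : i ∈ S) :
    ∫ x in (0 : ℝ)..1, trigPoly S pos v x * chr (-pos i) x = v i := by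
  classical
  have h : ∀ x, trigPoly S pos v x * chr (-pos i) x
      = ∑ j ∈ S, v j * chr (pos j - pos i) x := by
    intro x
    rw [trigPoly, Finset.sum_mul]
    refine Finset.sum_congr rfl fun j _ => ?_
    rw [sub_eq_add_neg, chr_add, mul_assoc]
  simp_rw [h]
  rw [intervalIntegral.integral_finsetSum fun j _ => Continuous.intervalIntegrable
    (by have := continuous_chr (pos j - pos i); fun_prop) _ _]
  simp_rw [intervalIntegral.integral_const_mul, integral_chr]
  rw [Finset.sum_eq_single i]
  · simp
  · intro j hj hji
    have : pos j - pos i ≠ 0 := fun h0 => hji (hpos hj hi (by omega))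
    simp [this]
  · intro h; exact absurd hi h

end

/-- Here `α > 1` enters: the reciprocal of `1 + h⁻ᵅ (2 sin π x) ^ α` has an integral of
order `h`. -/
lemma integral_inv_one_add_symbol_le {α h : ℝ} (h1 : 1 < α) (h2 : α ≤ 2) (hh : 0 < h) :
    ∫ x in (0 : ℝ)..1, (1 + 1 / h ^ α * symbol α x)⁻¹ ≤ h / (α - 1) := by
  set k : ℝ := 4 / h with hk
  have hk0 : 0 < k := by positivity
  have hcs := continuous_symbol (by linarith : 0 < α)
  have hpt : ∀ x ∈ Icc (0 : ℝ) (1 / 2), (1 + 1 / h ^ α * symbol α x)⁻¹ ≤ 2 * (1 + k * x) ^ (-α) := by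
    intro x hx
    have hkx : 0 ≤ k * x := mul_nonneg hk0.le hx.1
    have hs : 4 * x ≤ 2 * Real.sin (Real.pi * x) := by
      have := Real.mul_le_sin (x := Real.pi * x) (mul_nonneg Real.pi_pos.le hx.1)
        (by nlinarith [Real.pi_pos, hx.2])
      have e : 2 / Real.pi * (Real.pi * x) = 2 * x := by field_simp
      rw [e] at this; linarith
    have hsym : (k * x) ^ α ≤ 1 / h ^ α * symbol α x := by
      rw [symbol_eq ⟨hx.1, by linarith [hx.2]⟩]
      have : k * x = (4 * x) / h := by rw [hk]; ring
      rw [this, Real.div_rpow (by linarith [hx.1]) hh.le, one_div, inv_mul_eq_div]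
      gcongr
      linarith [hx.1]
    have hconv : (1 + k * x) ^ α ≤ 2 * (1 + (k * x) ^ α) := by
      have : (1 + k * x) ^ α ≤ (2 : ℝ) ^ (α - 1) * ((1 : ℝ) ^ α + (k * x) ^ α) := by
        exact_mod_cast NNReal.rpow_add_le_mul_rpow_add_rpow 1 ⟨k * x, hkx⟩ h1.le
      rw [Real.one_rpow] at this
      refine this.trans ?_
      gcongr
      calc (2 : ℝ) ^ (α - 1) ≤ (2 : ℝ) ^ (1 : ℝ) :=
            Real.rpow_le_rpow_of_exponent_le (by norm_num) (by linarith)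
        _ = 2 := Real.rpow_one 2
    rw [Real.rpow_neg (by linarith), inv_le_comm₀]
    · rw [mul_inv, inv_inv]
      linarith
    · have := symbol_nonneg α x
      positivity
    · positivity
  have hexp : ∀ x ∈ Icc (0 : ℝ) 1, (1 + 1 / h ^ α * symbol α x)⁻¹
      ≤ 2 * (1 + k * x) ^ (-α) + 2 * (1 + k * (1 - x)) ^ (-α) := by
    intro x hx
    have p1 : 0 ≤ 1 + k * x := by have := mul_nonneg hk0.le hx.1; linarith
    have p2 : 0 ≤ 1 + k * (1 - x) := by
      have := mul_nonneg hk0.le (sub_nonneg.2 hx.2); linarith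
    have q1 := Real.rpow_nonneg p1 (-α)
    have q2 := Real.rpow_nonneg p2 (-α)
    rcases le_total x (1 / 2) with hx2 | hx2
    · have := hpt x ⟨hx.1, hx2⟩
      linarith
    · have := hpt (1 - x) ⟨by linarith [hx.2], by linarith⟩
      have e : symbol α (1 - x) = symbol α x := by
        unfold symbol; rw [mul_sub, mul_one, Real.sin_pi_sub]
      rw [e] at this
      linarith
  have hi : ContinuousOn (fun x => (1 + k * x) ^ (-α)) (uIcc (0 : ℝ) 1) := by
    refine ContinuousOn.rpow_const (by fun_prop) fun x hx => Or.inl ?_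
    rw [uIcc_of_le zero_le_one] at hx
    have := mul_nonneg hk0.le hx.1
    linarith
  have hi' : ContinuousOn (fun x => (1 + k * (1 - x)) ^ (-α)) (uIcc (0 : ℝ) 1) := by
    refine ContinuousOn.rpow_const (by fun_prop) fun x hx => Or.inl ?_
    rw [uIcc_of_le zero_le_one] at hx
    have := mul_nonneg hk0.le (sub_nonneg.2 hx.2)
    linarith
  have hval : ∫ x in (0 : ℝ)..1, (1 + k * x) ^ (-α) ≤ h / (4 * (α - 1)) := by
    have hd : ∀ x ∈ uIcc (0 : ℝ) 1, HasDerivAt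
        (fun x => (1 + k * x) ^ (1 - α) * (1 / (k * (1 - α)))) ((1 + k * x) ^ (-α)) x := by
      intro x hx
      rw [uIcc_of_le zero_le_one] at hx
      have hp : 0 < 1 + k * x := by
        have := mul_nonneg hk0.le hx.1
        linarith
      have hlin : HasDerivAt (fun x : ℝ => 1 + k * x) k x := by
        simpa using ((hasDerivAt_id x).const_mul k).const_add 1
      refine ((hlin.rpow_const (p := 1 - α) (Or.inl hp.ne')).mul_const _).congr_deriv ?_
      have e : (1 : ℝ) - α - 1 = -α := by ring
      rw [e]
      have : (1 : ℝ) - α ≠ 0 := by linarith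
      field_simp
    rw [intervalIntegral.integral_eq_sub_of_hasDerivAt hd hi.intervalIntegrable]
    have hp := Real.rpow_nonneg (by positivity : 0 ≤ 1 + k * 1) (1 - α)
    have hneg : 1 / (k * (1 - α)) = -(h / (4 * (α - 1))) := by
      have : (1 : ℝ) - α ≠ 0 := by linarith
      have : α - 1 ≠ 0 := by linarith
      rw [hk]; field_simp; ring
    rw [hneg]
    have : 0 ≤ h / (4 * (α - 1)) := div_nonneg hh.le (by linarith)
    simp only [mul_zero, add_zero, Real.one_rpow]
    nlinarith
  have hsym : ∫ x in (0 : ℝ)..1, (1 + k * (1 - x)) ^ (-α)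
      = ∫ x in (0 : ℝ)..1, (1 + k * x) ^ (-α) := by
    have := intervalIntegral.integral_comp_sub_left (a := 0) (b := 1)
      (fun x => (1 + k * x) ^ (-α)) 1
    simpa using this
  have hden : ∀ x, 1 + 1 / h ^ α * symbol α x ≠ 0 := fun x => by
    have := symbol_nonneg α x
    positivity
  calc ∫ x in (0 : ℝ)..1, (1 + 1 / h ^ α * symbol α x)⁻¹
      ≤ ∫ x in (0 : ℝ)..1, (2 * (1 + k * x) ^ (-α) + 2 * (1 + k * (1 - x)) ^ (-α)) := by
        refine intervalIntegral.integral_mono_on zero_le_one ?_ ?_ hexp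
        · exact Continuous.intervalIntegrable
            ((by fun_prop : Continuous fun x => 1 + 1 / h ^ α * symbol α x).inv₀ hden) _ _
        · exact ((hi.const_mul 2).add (hi'.const_mul 2)).intervalIntegrable
    _ = 2 * (∫ x in (0 : ℝ)..1, (1 + k * x) ^ (-α))
          + 2 * (∫ x in (0 : ℝ)..1, (1 + k * x) ^ (-α)) := by
        rw [intervalIntegral.integral_add (hi.const_mul 2).intervalIntegrable
          (hi'.const_mul 2).intervalIntegrable, intervalIntegral.integral_const_mul,
          intervalIntegral.integral_const_mul, hsym]
    _ ≤ 2 * (h / (4 * (α - 1))) + 2 * (h / (4 * (α - 1))) := by gcongr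
    _ = h / (α - 1) := by
        have : α - 1 ≠ 0 := by linarith
        field_simp; ring

/-- One-dimensional discrete Sobolev inequality. -/
lemma normSq_le_integral_symbol {ι : Type*} (S : Finset ι) {pos : ι → ℤ} (hpos : InjOn pos S)
    (v : ι → ℂ) {α h : ℝ} (h1 : 1 < α) (h2 : α ≤ 2) (hh : 0 < h) {i : ι} (hi : i ∈ S) :
    ‖v i‖ ^ 2 ≤ 1 / (α - 1) *
      (h * ∫ x in (0 : ℝ)..1, (1 + 1 / h ^ α * symbol α x) * ‖trigPoly S pos v x‖ ^ 2) := by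
  have hcs := continuous_symbol (by linarith : 0 < α)
  have hcv := continuous_trigPoly S pos v
  set w : ℝ → ℝ := fun x => 1 + 1 / h ^ α * symbol α x with hw
  have hwp : ∀ x, 0 < w x := fun x => by
    have := symbol_nonneg α x
    simp only [hw]; positivity
  have hwc : Continuous w := by simp only [hw]; fun_prop
  have hwi : Continuous fun x => (w x)⁻¹ := hwc.inv₀ fun x => (hwp x).ne'
  set X := ∫ x in (0 : ℝ)..1, (w x)⁻¹
  set Y := ∫ x in (0 : ℝ)..1, w x * ‖trigPoly S pos v x‖ ^ 2
  set Z := ∫ x in (0 : ℝ)..1, ‖trigPoly S pos v x‖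
  have hX : X ≤ h / (α - 1) := integral_inv_one_add_symbol_le h1 h2 hh
  have hX0 : 0 < X := intervalIntegral.intervalIntegral_pos_of_pos
    (hwi.intervalIntegrable _ _) (fun x => inv_pos.2 (hwp x)) one_pos
  have hY0 : 0 ≤ Y := intervalIntegral.integral_nonneg zero_le_one fun x _ =>
    mul_nonneg (hwp x).le (by positivity)
  have hvi : ‖v i‖ ≤ Z := by
    rw [← integral_trigPoly_mul_chr S v hpos hi]
    refine (intervalIntegral.norm_integral_le_integral_norm zero_le_one).trans (le_of_eq ?_)
    congr 1; ext x
    rw [norm_mul, norm_chr, mul_one]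
  -- Cauchy-Schwarz for `w⁻¹` and `w ‖V‖ ^ 2`, as a quadratic polynomial in `t`.
  have hZ : ∀ t : ℝ, 2 * t * Z ≤ t ^ 2 * X + Y := by
    intro t
    rw [← intervalIntegral.integral_const_mul, ← intervalIntegral.integral_const_mul,
      ← intervalIntegral.integral_add (Continuous.intervalIntegrable (by fun_prop) _ _)
      (Continuous.intervalIntegrable (by fun_prop) _ _)]
    refine intervalIntegral.integral_mono_on zero_le_one
      (Continuous.intervalIntegrable (by fun_prop) _ _)
      (Continuous.intervalIntegrable (by fun_prop) _ _) fun x _ => ?_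
    have hp := hwp x
    set n := ‖trigPoly S pos v x‖
    have : t ^ 2 * (w x)⁻¹ + w x * n ^ 2 - 2 * t * n = (w x)⁻¹ * (t - w x * n) ^ 2 := by
      field_simp; ring
    have h0 : 0 ≤ (w x)⁻¹ * (t - w x * n) ^ 2 := by positivity
    linarith
  have hZ2 : Z ^ 2 ≤ X * Y := by
    have := hZ (Z / X)
    have e1 : 2 * (Z / X) * Z = 2 * (Z ^ 2 / X) := by ring
    have e2 : (Z / X) ^ 2 * X = Z ^ 2 / X := by field_simp
    rw [e1, e2] at this
    have h3 : Z ^ 2 / X ≤ Y := by linarith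
    rw [div_le_iff₀ hX0] at h3
    linarith
  calc ‖v i‖ ^ 2 ≤ Z ^ 2 := by gcongr
    _ ≤ X * Y := hZ2
    _ ≤ h / (α - 1) * Y := by gcongr
    _ = 1 / (α - 1) * (h * Y) := by ring

/-! ### Dirichlet forms on finite grids -/

section Edges
variable {ι κ : Type}

/-- Extension of a grid function by zero to the boundary vertex. -/
def ext (v : ι → ℂ) (p : Option ι) : ℂ := p.elim 0 v

/-- Increment of a grid function along an edge. -/
def incr (e : Option ι × Option ι) (v : ι → ℂ) : ℂ := ext v e.1 - ext v e.2

/-- Extension by zero of a grid function of two variables. -/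
def ext₂ (v : ι → κ → ℂ) (p : Option ι) (q : Option κ) : ℂ := ext (fun i => ext (v i) q) p

/-- Mixed increment along an edge in each variable. -/
def incr₂ (e : Option ι × Option ι) (f : Option κ × Option κ) (v : ι → κ → ℂ) : ℂ :=
  ext₂ v e.1 f.1 - ext₂ v e.2 f.1 - (ext₂ v e.1 f.2 - ext₂ v e.2 f.2)

lemma ext₂_add (v w : ι → κ → ℂ) (p q) : ext₂ (v + w) p q = ext₂ v p q + ext₂ w p q := by
  cases p <;> cases q <;> simp [ext₂, ext]

lemma ext₂_smul (c : ℂ) (v : ι → κ → ℂ) (p q) : ext₂ (c • v) p q = c * ext₂ v p q := by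
  cases p <;> cases q <;> simp [ext₂, ext]

lemma ext₂_mul (v w : ι → κ → ℂ) (p q) : ext₂ (v * w) p q = ext₂ v p q * ext₂ w p q := by
  cases p <;> cases q <;> simp [ext₂, ext]

lemma ext₂_star (v : ι → κ → ℂ) (p q) : ext₂ (star v) p q = starRingEnd ℂ (ext₂ v p q) := by
  cases p <;> cases q <;> simp [ext₂, ext]

lemma incr₂_eq_incr_incr (e : Option ι × Option ι) (f : Option κ × Option κ) (v : ι → κ → ℂ) :
    incr₂ e f v = incr e fun i => incr f (v i) := by
  obtain ⟨p, p'⟩ := e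
  obtain ⟨q, q'⟩ := f
  cases p <;> cases p' <;> simp [incr₂, incr, ext₂, ext] <;> ring

lemma incr₂_eq_incr_incr' (e : Option ι × Option ι) (f : Option κ × Option κ) (v : ι → κ → ℂ) :
    incr₂ e f v = incr f fun j => incr e fun i => v i j := by
  obtain ⟨p, p'⟩ := e
  obtain ⟨q, q'⟩ := f
  cases p <;> cases p' <;> cases q <;> cases q' <;> simp [incr₂, incr, ext₂, ext]

variable [Fintype ι] [DecidableEq ι]

/-- Weights of the edges of a finite graph with an additional vertex `none`, the boundary, for
which the form `∑ B i j conj (v i) (v j)` is a sum of weighted squared increments. -/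
def edgeWeight (B : Matrix ι ι ℝ) : Option ι × Option ι → ℝ
  | (some i, some j) => if i = j then 0 else -B i j / 2
  | (some i, none) => ∑ j, B i j
  | (none, _) => 0

/-- Summation by parts: a symmetric matrix is the form of its edge weights. -/
lemma sum_edgeWeight {B : Matrix ι ι ℝ} (hB : B.IsSymm) (v w : ι → ℂ) :
    ∑ e, (edgeWeight B e : ℂ) * (starRingEnd ℂ (incr e v) * incr e w)
      = ∑ i, ∑ j, (B i j : ℂ) * (starRingEnd ℂ (v i) * w j) := by
  have h1 : ∑ e, (edgeWeight B e : ℂ) * (starRingEnd ℂ (incr e v) * incr e w)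
      = ∑ i, ∑ j, ((B i j : ℂ) * (starRingEnd ℂ (v i) * w i)
        + (-B i j / 2 : ℂ) * (starRingEnd ℂ (v i - v j) * (w i - w j))) := by
    rw [Fintype.sum_prod_type, Fintype.sum_option]
    simp only [edgeWeight, Complex.ofReal_zero, zero_mul, Finset.sum_const_zero, zero_add]
    refine Finset.sum_congr rfl fun i _ => ?_
    rw [Fintype.sum_option, Finset.sum_add_distrib, ← Finset.sum_mul]
    congr 1
    · simp [incr, ext]
    · refine Finset.sum_congr rfl fun j _ => ?_
      by_cases h : i = j
      · subst h; simp
      · simp [incr, ext, h]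
  rw [h1]
  have s1 : ∑ i, ∑ j, (B i j : ℂ) * (starRingEnd ℂ (v j) * w j)
      = ∑ i, ∑ j, (B i j : ℂ) * (starRingEnd ℂ (v i) * w i) := by
    rw [Finset.sum_comm]
    refine Finset.sum_congr rfl fun i _ => Finset.sum_congr rfl fun j _ => ?_
    rw [hB.apply]
  have s2 : ∑ i, ∑ j, (B i j : ℂ) * (starRingEnd ℂ (v j) * w i)
      = ∑ i, ∑ j, (B i j : ℂ) * (starRingEnd ℂ (v i) * w j) := by
    rw [Finset.sum_comm]
    refine Finset.sum_congr rfl fun i _ => Finset.sum_congr rfl fun j _ => ?_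
    rw [hB.apply]
  have h2 : ∀ i j, (B i j : ℂ) * (starRingEnd ℂ (v i) * w i)
        + (-B i j / 2 : ℂ) * (starRingEnd ℂ (v i - v j) * (w i - w j))
      = (1 / 2 : ℂ) * ((B i j : ℂ) * (starRingEnd ℂ (v i) * w i))
        - (1 / 2 : ℂ) * ((B i j : ℂ) * (starRingEnd ℂ (v j) * w j))
        + (1 / 2 : ℂ) * ((B i j : ℂ) * (starRingEnd ℂ (v i) * w j))
        + (1 / 2 : ℂ) * ((B i j : ℂ) * (starRingEnd ℂ (v j) * w i)) := by
    intro i j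
    rw [map_sub]; ring
  simp_rw [h2, Finset.sum_add_distrib, Finset.sum_sub_distrib, ← Finset.mul_sum]
  rw [s1, s2]
  ring

lemma sum_edgeWeight_normSq {B : Matrix ι ι ℝ} (hB : B.IsSymm) (v : ι → ℂ) :
    ((∑ e, edgeWeight B e * ‖incr e v‖ ^ 2 : ℝ) : ℂ)
      = ∑ i, ∑ j, (B i j : ℂ) * (starRingEnd ℂ (v i) * v j) := by
  rw [← sum_edgeWeight hB]
  push_cast
  simp_rw [Complex.conj_mul']

lemma edgeWeight_nonneg {B : Matrix ι ι ℝ} (hoff : ∀ i j, i ≠ j → B i j ≤ 0)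
    (hrow : ∀ i, 0 ≤ ∑ j, B i j) (e : Option ι × Option ι) : 0 ≤ edgeWeight B e := by
  obtain ⟨p | i, q | j⟩ := e
  · simp [edgeWeight]
  · simp [edgeWeight]
  · simpa [edgeWeight] using hrow i
  · simp only [edgeWeight]
    split_ifs with h
    · exact le_rfl
    · linarith [hoff i j h]

end Edges

/-! ### Tensor-product forms and the energy norm -/

section TensorForms
variable {ι κ : Type} [Fintype ι] [Fintype κ]

/-- The complexification of a real matrix. -/
abbrev cmat {m n : Type} (A : Matrix m n ℝ) : Matrix m n ℂ := A.map Complex.ofReal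

/-- The sesquilinear form of the tensor product of two matrices. -/
def tensorForm (P : Matrix ι ι ℝ) (Q : Matrix κ κ ℝ) (v w : ι → κ → ℂ) : ℂ :=
  Matrix.trace ((Matrix.of v).conjTranspose * cmat P * Matrix.of w * (cmat Q).transpose)

/-- Action of a matrix in the first variable. -/
def opX (A : Matrix ι ι ℝ) : (ι → κ → ℂ) →ₗ[ℂ] (ι → κ → ℂ) where
  toFun v i j := ∑ i', (A i i' : ℂ) * v i' j
  map_add' v w := by
    ext i j; simp [mul_add, Finset.sum_add_distrib]
  map_smul' c v := by
    ext i j; simp [Finset.mul_sum, mul_left_comm]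

/-- Action of a matrix in the second variable. -/
def opY (A : Matrix κ κ ℝ) : (ι → κ → ℂ) →ₗ[ℂ] (ι → κ → ℂ) where
  toFun v i j := ∑ j', (A j j' : ℂ) * v i j'
  map_add' v w := by
    ext i j; simp [mul_add, Finset.sum_add_distrib]
  map_smul' c v := by
    ext i j; simp [Finset.mul_sum, mul_left_comm]

lemma of_opX {κ' : Type} (A : Matrix ι ι ℝ) (v : ι → κ' → ℂ) :
    Matrix.of (opX A v) = cmat A * Matrix.of v := by
  ext i j; simp [opX, Matrix.mul_apply]

lemma of_opY {ι' : Type} (A : Matrix κ κ ℝ) (v : ι' → κ → ℂ) :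
    Matrix.of (opY A v) = Matrix.of v * (cmat A).transpose := by
  ext i j; simp [opY, Matrix.mul_apply, mul_comm]

lemma cmat_mul (P A : Matrix ι ι ℝ) : cmat (P * A) = cmat P * cmat A := by
  exact Matrix.map_mul (f := Complex.ofRealHom)

lemma tensorForm_opX (P A : Matrix ι ι ℝ) (Q : Matrix κ κ ℝ) (v w : ι → κ → ℂ) :
    tensorForm P Q v (opX A w) = tensorForm (P * A) Q v w := by
  unfold tensorForm
  rw [of_opX, cmat_mul]
  simp only [Matrix.mul_assoc]

lemma tensorForm_opY (P : Matrix ι ι ℝ) (Q A : Matrix κ κ ℝ) (v w : ι → κ → ℂ) :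
    tensorForm P Q v (opY A w) = tensorForm P (Q * A) v w := by
  unfold tensorForm
  rw [of_opY, cmat_mul, Matrix.transpose_mul]
  simp only [Matrix.mul_assoc]

lemma conj_tensorForm (P : Matrix ι ι ℝ) (Q : Matrix κ κ ℝ) (v w : ι → κ → ℂ) :
    starRingEnd ℂ (tensorForm P Q v w) = tensorForm P.transpose Q.transpose w v := by
  have hP : (cmat P).conjTranspose = cmat P.transpose := by ext; simp
  have hQ : (cmat Q).transpose.conjTranspose = cmat Q := by ext; simp
  have hQ' : (cmat Q.transpose).transpose = cmat Q := by ext; simp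
  unfold tensorForm
  rw [starRingEnd_apply, ← Matrix.trace_conjTranspose, Matrix.conjTranspose_mul,
    Matrix.conjTranspose_mul, Matrix.conjTranspose_mul, Matrix.conjTranspose_conjTranspose,
    hP, hQ, hQ', Matrix.trace_mul_comm]
  simp only [Matrix.mul_assoc]

lemma tensorForm_add_right (P : Matrix ι ι ℝ) (Q : Matrix κ κ ℝ) (v w w' : ι → κ → ℂ) :
    tensorForm P Q v (w + w') = tensorForm P Q v w + tensorForm P Q v w' := by
  unfold tensorForm
  rw [← Matrix.of_add_of, Matrix.mul_add, Matrix.add_mul, Matrix.trace_add]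

lemma tensorForm_smul_right (P : Matrix ι ι ℝ) (Q : Matrix κ κ ℝ) (c : ℂ) (v w : ι → κ → ℂ) :
    tensorForm P Q v (c • w) = c * tensorForm P Q v w := by
  unfold tensorForm
  rw [← Matrix.smul_of, Matrix.mul_smul, Matrix.smul_mul, Matrix.trace_smul, smul_eq_mul]

lemma tensorForm_eq_sum (P : Matrix ι ι ℝ) (Q : Matrix κ κ ℝ) (v w : ι → κ → ℂ) :
    tensorForm P Q v w = ∑ j, ∑ j', (Q j j' : ℂ)
      * ∑ i, ∑ i', (P i i' : ℂ) * (starRingEnd ℂ (v i j) * w i' j') := by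
  unfold tensorForm
  simp only [Matrix.trace, Matrix.diag_apply, Matrix.mul_apply, Matrix.transpose_apply,
    Matrix.conjTranspose_apply, Matrix.map_apply, Matrix.of_apply]
  refine Finset.sum_congr rfl fun j _ => Finset.sum_congr rfl fun j' _ => ?_
  rw [mul_comm]
  congr 1
  simp_rw [Finset.sum_mul]
  rw [Finset.sum_comm]
  refine Finset.sum_congr rfl fun i _ => Finset.sum_congr rfl fun i' _ => ?_
  rw [starRingEnd_apply]; ring

/-- A real symmetric tensor form takes real values on the diagonal. -/
lemma im_tensorForm_self {P : Matrix ι ι ℝ} {Q : Matrix κ κ ℝ} (hP : P.IsSymm) (hQ : Q.IsSymm)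
    (v : ι → κ → ℂ) : (tensorForm P Q v v).im = 0 := by
  have := conj_tensorForm P Q v v
  rw [hP, hQ] at this
  exact Complex.conj_eq_iff_im.1 this

variable [DecidableEq ι] [DecidableEq κ]

/-- A symmetric discrete diffusion operator `A` with Dirichlet condition, on a grid of mesh size
`h`, for which the form of `1 + A` controls the maximum norm with constant `C`. -/
structure IsDirichletOp (A : Matrix ι ι ℝ) (h C : ℝ) : Prop where
  symm : A.IsSymm
  off_diag : ∀ i j, i ≠ j → A i j ≤ 0
  row_sum : ∀ i, 0 ≤ ∑ j, A i j
  mesh_pos : 0 < h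
  sobolev : ∀ (v : ι → ℂ) (i : ι), ‖v i‖ ^ 2
    ≤ C * ∑ e, edgeWeight (h • (1 + A)) e * ‖incr e v‖ ^ 2

/-- The matrix of the one-dimensional energy form. -/
abbrev formMatrix (A : Matrix ι ι ℝ) (h : ℝ) : Matrix ι ι ℝ := h • (1 + A)

namespace IsDirichletOp
variable {A : Matrix ι ι ℝ} {h C : ℝ} (hA : IsDirichletOp A h C)
include hA

lemma form_symm : (formMatrix A h).IsSymm := by
  unfold formMatrix
  rw [Matrix.IsSymm, Matrix.transpose_smul, Matrix.transpose_add, Matrix.transpose_one, hA.symm]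

lemma weight_nonneg (e) : 0 ≤ edgeWeight (formMatrix A h) e := by
  refine edgeWeight_nonneg (fun i j hij => ?_) (fun i => ?_) e
  · simp only [formMatrix, Matrix.smul_apply, Matrix.add_apply, Matrix.one_apply_ne hij, zero_add,
      smul_eq_mul]
    exact mul_nonpos_of_nonneg_of_nonpos hA.mesh_pos.le (hA.off_diag i j hij)
  · simp only [formMatrix, Matrix.smul_apply, Matrix.add_apply, smul_eq_mul]
    rw [← Finset.mul_sum, Finset.sum_add_distrib]
    refine mul_nonneg hA.mesh_pos.le (add_nonneg ?_ (hA.row_sum i))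
    exact Finset.sum_nonneg fun j _ => by rw [Matrix.one_apply]; split_ifs <;> norm_num

lemma re_form_nonneg (v : ι → ℂ) :
    0 ≤ (∑ i, ∑ j, (A i j : ℂ) * (starRingEnd ℂ (v i) * v j)).re := by
  rw [← sum_edgeWeight_normSq hA.symm, Complex.ofReal_re]
  exact Finset.sum_nonneg fun e _ => mul_nonneg
    (edgeWeight_nonneg hA.off_diag hA.row_sum e) (by positivity)

lemma normSq_ext_le (v : ι → ℂ) (p : Option ι) (hC : 0 ≤ C) :
    ‖ext v p‖ ^ 2 ≤ C * ∑ e, edgeWeight (formMatrix A h) e * ‖incr e v‖ ^ 2 := by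
  cases p with
  | none =>
    simp only [ext, Option.elim_none, norm_zero]
    have : 0 ≤ ∑ e, edgeWeight (formMatrix A h) e * ‖incr e v‖ ^ 2 :=
      Finset.sum_nonneg fun e _ => mul_nonneg (hA.weight_nonneg e) (by positivity)
    simpa using mul_nonneg hC this
  | some i => exact hA.sobolev v i

lemma normSq_incr_snd_le {κ' : Type} (hC : 0 ≤ C) (v : ι → κ' → ℂ) (f : Option κ' × Option κ')
    (p : Option ι) : ‖ext₂ v p f.1 - ext₂ v p f.2‖ ^ 2
      ≤ C * ∑ e, edgeWeight (formMatrix A h) e * ‖incr₂ e f v‖ ^ 2 := by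
  have := hA.normSq_ext_le (fun i => incr f (v i)) p hC
  simp_rw [← incr₂_eq_incr_incr] at this
  refine le_trans (le_of_eq ?_) this
  cases p <;> simp [ext₂, ext, incr]

lemma normSq_incr_fst_le {κ' : Type} (hC : 0 ≤ C) (v : κ' → ι → ℂ) (e : Option κ' × Option κ')
    (q : Option ι) : ‖ext₂ v e.1 q - ext₂ v e.2 q‖ ^ 2
      ≤ C * ∑ f, edgeWeight (formMatrix A h) f * ‖incr₂ e f v‖ ^ 2 := by
  have := hA.normSq_ext_le (fun j => incr e fun i => v i j) q hC
  simp_rw [← incr₂_eq_incr_incr'] at this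
  refine le_trans (le_of_eq ?_) this
  obtain ⟨p, p'⟩ := e
  cases q <;> cases p <;> cases p' <;> simp [ext₂, ext, incr]

end IsDirichletOp

/-- The weighted mixed increments of a grid function, over all pairs of edges. -/
def gradMap (B : Matrix ι ι ℝ) (B' : Matrix κ κ ℝ) : (ι → κ → ℂ) →ₗ[ℂ]
    EuclideanSpace ℂ ((Option ι × Option ι) × (Option κ × Option κ)) where
  toFun v := WithLp.toLp 2 fun ef =>
    ((√(edgeWeight B ef.1) * √(edgeWeight B' ef.2) : ℝ) : ℂ) * incr₂ ef.1 ef.2 v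
  map_add' v w := by
    ext ef
    simp only [incr₂, ext₂_add, PiLp.add_apply]
    ring
  map_smul' c v := by
    ext ef
    simp only [incr₂, ext₂_smul, PiLp.smul_apply, smul_eq_mul, RingHom.id_apply]
    ring

/-- The energy norm `⟨(1 + Aₓ)(1 + A_y) v, v⟩ ^ (1/2)`: a product of one half of a derivative of
order `α` in each variable. -/
def energy (B : Matrix ι ι ℝ) (B' : Matrix κ κ ℝ) : Seminorm ℂ (ι → κ → ℂ) :=
  (normSeminorm ℂ _).comp (gradMap B B')

lemma energy_apply (B : Matrix ι ι ℝ) (B' : Matrix κ κ ℝ) (v : ι → κ → ℂ) :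
    energy B B' v = ‖gradMap B B' v‖ := rfl

section
variable {A : Matrix ι ι ℝ} {A' : Matrix κ κ ℝ} {h h' C C' : ℝ}
  (hA : IsDirichletOp A h C) (hA' : IsDirichletOp A' h' C')
include hA hA'

lemma inner_gradMap (v w : ι → κ → ℂ) :
    inner ℂ (gradMap (formMatrix A h) (formMatrix A' h') v)
        (gradMap (formMatrix A h) (formMatrix A' h') w)
      = tensorForm (formMatrix A h) (formMatrix A' h') v w := by
  have e1 : inner ℂ (gradMap (formMatrix A h) (formMatrix A' h') v)
        (gradMap (formMatrix A h) (formMatrix A' h') w)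
      = ∑ e, ∑ f, (edgeWeight (formMatrix A h) e : ℂ) * ((edgeWeight (formMatrix A' h') f : ℂ)
          * (starRingEnd ℂ (incr₂ e f v) * incr₂ e f w)) := by
    rw [PiLp.inner_apply, Fintype.sum_prod_type]
    refine Finset.sum_congr rfl fun e _ => Finset.sum_congr rfl fun f _ => ?_
    simp only [gradMap, LinearMap.coe_mk, AddHom.coe_mk, RCLike.inner_apply]
    have s1 := Real.mul_self_sqrt (hA.weight_nonneg e)
    have s2 := Real.mul_self_sqrt (hA'.weight_nonneg f)
    rw [map_mul, Complex.conj_ofReal]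
    nth_rw 3 [← s1]
    nth_rw 3 [← s2]
    push_cast
    ring
  rw [e1, tensorForm_eq_sum]
  simp_rw [← Finset.mul_sum, incr₂_eq_incr_incr']
  simp_rw [sum_edgeWeight hA'.form_symm, Finset.mul_sum]
  rw [Finset.sum_comm]
  refine Finset.sum_congr rfl fun j _ => ?_
  rw [Finset.sum_comm]
  refine Finset.sum_congr rfl fun j' _ => ?_
  simp_rw [← Finset.mul_sum]
  rw [← sum_edgeWeight hA.form_symm, Finset.mul_sum]
  refine Finset.sum_congr rfl fun e _ => ?_
  ring

/-- The energy as a sum over pairs of edges, one in each variable. -/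
lemma energy_sq (v : ι → κ → ℂ) : energy (formMatrix A h) (formMatrix A' h') v ^ 2
    = ∑ e, ∑ f, edgeWeight (formMatrix A h) e * (edgeWeight (formMatrix A' h') f
        * ‖incr₂ e f v‖ ^ 2) := by
  rw [energy_apply, EuclideanSpace.norm_sq_eq, Fintype.sum_prod_type]
  refine Finset.sum_congr rfl fun e _ => Finset.sum_congr rfl fun f _ => ?_
  simp only [gradMap, LinearMap.coe_mk, AddHom.coe_mk]
  rw [norm_mul, mul_pow, Complex.norm_real, Real.norm_eq_abs, sq_abs, mul_pow,
    Real.sq_sqrt (hA.weight_nonneg e), Real.sq_sqrt (hA'.weight_nonneg f), mul_assoc]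

lemma energy_sq_eq_re (v : ι → κ → ℂ) : energy (formMatrix A h) (formMatrix A' h') v ^ 2
    = (tensorForm (formMatrix A h) (formMatrix A' h') v v).re := by
  rw [energy_apply, ← inner_gradMap hA hA', ← inner_self_eq_norm_sq (𝕜 := ℂ)]; rfl

/-- The implicit midpoint step of the Schrödinger equation does not increase the energy norm, since
the energy form commutes with the operator. -/
lemma energy_step {τ : ℝ} (hτ : 0 ≤ τ) {p m F : ι → κ → ℂ}
    (heq : p - m = (τ : ℂ) • (-Complex.I • (opX A (p + m) + opY A' (p + m)) + F)) :
    energy (formMatrix A h) (formMatrix A' h') p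
      ≤ energy (formMatrix A h) (formMatrix A' h') m
        + τ * energy (formMatrix A h) (formMatrix A' h') F := by
  set B := formMatrix A h with hB
  set B' := formMatrix A' h' with hB'
  have hsB := hA.form_symm
  have hsB' := hA'.form_symm
  rw [← hB] at hsB
  rw [← hB'] at hsB'
  set D := gradMap B B'
  simp only [energy_apply]
  change ‖D p‖ ≤ ‖D m‖ + τ * ‖D F‖
  have hcomm : (B * A).IsSymm := by
    rw [Matrix.IsSymm, Matrix.transpose_mul, hsB, hA.symm]
    simp [hB, formMatrix, Matrix.mul_add, Matrix.add_mul]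
  have hcomm' : (B' * A').IsSymm := by
    rw [Matrix.IsSymm, Matrix.transpose_mul, hsB', hA'.symm]
    simp [hB', formMatrix, Matrix.mul_add, Matrix.add_mul]
  have hre : (inner ℂ (D (p + m)) (D (p - m))).re = ‖D p‖ ^ 2 - ‖D m‖ ^ 2 := by
    rw [map_add, map_sub, inner_sub_right, inner_add_left, inner_add_left]
    have h1 : (inner ℂ (D m) (D p)).re = (inner ℂ (D p) (D m)).re := inner_re_symm (𝕜 := ℂ) _ _
    have h2 : (inner ℂ (D p) (D p)).re = ‖D p‖ ^ 2 := inner_self_eq_norm_sq (𝕜 := ℂ) _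
    have h3 : (inner ℂ (D m) (D m)).re = ‖D m‖ ^ 2 := inner_self_eq_norm_sq (𝕜 := ℂ) _
    simp only [Complex.sub_re, Complex.add_re]
    linarith
  have hre2 : (inner ℂ (D (p + m)) (D (p - m))).re = τ * (inner ℂ (D (p + m)) (D F)).re := by
    have hD : D (p - m) = (τ : ℂ) • (-Complex.I • D (opX A (p + m) + opY A' (p + m)) + D F) := by
      rw [heq, map_smul, map_add D (-Complex.I • _), map_smul]
    rw [hD, inner_smul_right, inner_add_right, inner_smul_right,
      inner_gradMap hA hA', tensorForm_add_right, tensorForm_opX, tensorForm_opY]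
    have i1 := im_tensorForm_self hcomm hsB' (p + m)
    have i2 := im_tensorForm_self hsB hcomm' (p + m)
    simp only [Complex.ofReal_re, Complex.ofReal_im, Complex.add_re, Complex.mul_re, Complex.neg_re,
      Complex.neg_im, Complex.I_re, Complex.I_im, Complex.add_im]
    rw [i1, i2]
    ring
  have hcs : (inner ℂ (D (p + m)) (D F)).re ≤ (‖D p‖ + ‖D m‖) * ‖D F‖ := by
    refine (Complex.re_le_norm _).trans ((norm_inner_le_norm _ _).trans ?_)
    gcongr
    rw [map_add]; exact norm_add_le _ _
  have hmain : (‖D p‖ - ‖D m‖) * (‖D p‖ + ‖D m‖) ≤ (τ * ‖D F‖) * (‖D p‖ + ‖D m‖) := by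
    have := mul_le_mul_of_nonneg_left hcs hτ
    nlinarith
  have n1 := norm_nonneg (D p)
  have n2 := norm_nonneg (D m)
  have n3 := mul_nonneg hτ (norm_nonneg (D F))
  rcases (add_nonneg n1 n2).eq_or_lt with h0 | h0
  · linarith
  · have := le_of_mul_le_mul_right hmain h0
    linarith

lemma normSq_ext₂_le (hC : 0 ≤ C) (hC' : 0 ≤ C') (v : ι → κ → ℂ) (p : Option ι) (q : Option κ) :
    ‖ext₂ v p q‖ ^ 2 ≤ C * C' * energy (formMatrix A h) (formMatrix A' h') v ^ 2 := by
  have h1 := hA.normSq_ext_le (fun i => ext (v i) q) p hC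
  refine h1.trans ?_
  rw [energy_sq hA hA', mul_assoc]
  refine mul_le_mul_of_nonneg_left ?_ hC
  rw [Finset.mul_sum]
  refine Finset.sum_le_sum fun e _ => ?_
  rw [← Finset.mul_sum, mul_left_comm]
  refine mul_le_mul_of_nonneg_left ?_ (hA.weight_nonneg e)
  refine le_trans (le_of_eq ?_) (hA'.normSq_incr_fst_le hC' v e q)
  rfl

/-- The maximum norm is controlled by the energy norm. -/
lemma norm_le_energy (hC : 0 ≤ C) (hC' : 0 ≤ C') (v : ι → κ → ℂ) (i : ι) (j : κ) :
    ‖v i j‖ ≤ √(C * C') * energy (formMatrix A h) (formMatrix A' h') v := by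
  have := normSq_ext₂_le hA hA' hC hC' v (some i) (some j)
  rw [← Real.sqrt_sq (apply_nonneg (energy (formMatrix A h) (formMatrix A' h')) v),
    ← Real.sqrt_mul (by positivity)]
  exact Real.le_sqrt_of_sq_le this

/-- The energy norm is submultiplicative up to a constant: the mixed increment of a product splits
into four products, in each of which every increment is paired with a maximum. -/
lemma energy_mul_le (hC : 0 ≤ C) (hC' : 0 ≤ C') (v w : ι → κ → ℂ) :
    energy (formMatrix A h) (formMatrix A' h') (v * w)
      ≤ 4 * √(C * C') * energy (formMatrix A h) (formMatrix A' h') v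
        * energy (formMatrix A h) (formMatrix A' h') w := by
  set a := edgeWeight (formMatrix A h) with ha
  set b := edgeWeight (formMatrix A' h') with hb
  set N := energy (formMatrix A h) (formMatrix A' h') with hN
  have a0 : ∀ e, 0 ≤ a e := hA.weight_nonneg
  have b0 : ∀ f, 0 ≤ b f := hA'.weight_nonneg
  set R : (ι → κ → ℂ) → Option ι × Option ι → ℝ := fun v e => ∑ f, b f * ‖incr₂ e f v‖ ^ 2 with hR
  set S : (ι → κ → ℂ) → Option κ × Option κ → ℝ := fun v f => ∑ e, a e * ‖incr₂ e f v‖ ^ 2 with hS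
  have R0 : ∀ v e, 0 ≤ R v e := fun v e =>
    Finset.sum_nonneg fun f _ => mul_nonneg (b0 f) (by positivity)
  have S0 : ∀ v f, 0 ≤ S v f := fun v f =>
    Finset.sum_nonneg fun e _ => mul_nonneg (a0 e) (by positivity)
  have sumR : ∀ v, ∑ e, a e * R v e = N v ^ 2 := by
    intro v; rw [hN, energy_sq hA hA']; simp_rw [hR, Finset.mul_sum]; rfl
  have sumS : ∀ v, ∑ f, b f * S v f = N v ^ 2 := by
    intro v; rw [hN, energy_sq hA hA', Finset.sum_comm]; simp_rw [hS, Finset.mul_sum]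
    refine Finset.sum_congr rfl fun f _ => Finset.sum_congr rfl fun e _ => ?_
    rw [mul_left_comm]
  have pt : ∀ e f, ‖incr₂ e f (v * w)‖ ^ 2 ≤ 4 * (C * C') * (N v ^ 2 * ‖incr₂ e f w‖ ^ 2
      + S v f * R w e + N w ^ 2 * ‖incr₂ e f v‖ ^ 2 + S w f * R v e) := by
    intro e f
    have hdec : incr₂ e f (v * w) = ext₂ v e.1 f.1 * incr₂ e f w
        + (ext₂ v e.1 f.1 - ext₂ v e.1 f.2) * (ext₂ w e.1 f.2 - ext₂ w e.2 f.2)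
        + ext₂ w e.2 f.1 * incr₂ e f v
        + (ext₂ w e.2 f.1 - ext₂ w e.2 f.2) * (ext₂ v e.1 f.2 - ext₂ v e.2 f.2) := by
      simp only [incr₂, ext₂_mul]; ring
    have t1 := mul_le_mul_of_nonneg_right (normSq_ext₂_le hA hA' hC hC' v e.1 f.1)
      (sq_nonneg ‖incr₂ e f w‖)
    have t3 := mul_le_mul_of_nonneg_right (normSq_ext₂_le hA hA' hC hC' w e.2 f.1)
      (sq_nonneg ‖incr₂ e f v‖)
    have t2 := mul_le_mul (hA.normSq_incr_snd_le hC v f e.1)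
      (hA'.normSq_incr_fst_le hC' w e f.2) (by positivity) (mul_nonneg hC (S0 v f))
    have t4 := mul_le_mul (hA.normSq_incr_snd_le hC w f e.2)
      (hA'.normSq_incr_fst_le hC' v e f.2) (by positivity) (mul_nonneg hC (S0 w f))
    rw [← mul_pow, ← norm_mul] at t1 t2 t3 t4
    rw [hdec]
    set X1 := ext₂ v e.1 f.1 * incr₂ e f w
    set X2 := (ext₂ v e.1 f.1 - ext₂ v e.1 f.2) * (ext₂ w e.1 f.2 - ext₂ w e.2 f.2)
    set X3 := ext₂ w e.2 f.1 * incr₂ e f v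
    set X4 := (ext₂ w e.2 f.1 - ext₂ w e.2 f.2) * (ext₂ v e.1 f.2 - ext₂ v e.2 f.2)
    have hn : ‖X1 + X2 + X3 + X4‖ ≤ ‖X1‖ + ‖X2‖ + ‖X3‖ + ‖X4‖ := norm_add₄_le
    have hsq : ‖X1 + X2 + X3 + X4‖ ^ 2
        ≤ 4 * (‖X1‖ ^ 2 + ‖X2‖ ^ 2 + ‖X3‖ ^ 2 + ‖X4‖ ^ 2) := by
      refine (pow_le_pow_left₀ (norm_nonneg _) hn 2).trans ?_
      nlinarith [sq_nonneg (‖X1‖ - ‖X2‖), sq_nonneg (‖X1‖ - ‖X3‖), sq_nonneg (‖X1‖ - ‖X4‖),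
        sq_nonneg (‖X2‖ - ‖X3‖), sq_nonneg (‖X2‖ - ‖X4‖), sq_nonneg (‖X3‖ - ‖X4‖)]
    refine hsq.trans ?_
    change _ ≤ C * S v f * (C' * R w e) at t2
    change _ ≤ C * S w f * (C' * R v e) at t4
    linarith
  have hsq : N (v * w) ^ 2 ≤ 16 * (C * C') * (N v ^ 2 * N w ^ 2) := by
    have e1 : N (v * w) ^ 2 ≤ ∑ e, ∑ f, a e * (b f * (4 * (C * C') * (N v ^ 2 * ‖incr₂ e f w‖ ^ 2
        + S v f * R w e + N w ^ 2 * ‖incr₂ e f v‖ ^ 2 + S w f * R v e))) := by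
      rw [hN, energy_sq hA hA']
      refine Finset.sum_le_sum fun e _ => Finset.sum_le_sum fun f _ => ?_
      exact mul_le_mul_of_nonneg_left (mul_le_mul_of_nonneg_left (pt e f) (b0 f)) (a0 e)
    refine e1.trans (le_of_eq ?_)
    have e2 : ∀ e f, a e * (b f * (4 * (C * C') * (N v ^ 2 * ‖incr₂ e f w‖ ^ 2
        + S v f * R w e + N w ^ 2 * ‖incr₂ e f v‖ ^ 2 + S w f * R v e)))
        = 4 * (C * C') * (N v ^ 2 * (a e * (b f * ‖incr₂ e f w‖ ^ 2))
          + (a e * R w e) * (b f * S v f) + N w ^ 2 * (a e * (b f * ‖incr₂ e f v‖ ^ 2))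
          + (a e * R v e) * (b f * S w f)) := by
      intro e f; ring
    simp_rw [e2, ← Finset.mul_sum, Finset.sum_add_distrib, ← Finset.mul_sum]
    have e3 : ∀ v w, ∑ e, ∑ f, (a e * R v e) * (b f * S w f) = N v ^ 2 * N w ^ 2 := by
      intro v w
      rw [← Finset.sum_mul_sum, sumR, sumS]
    have e4 : ∀ v, ∑ e, a e * ∑ f, b f * ‖incr₂ e f v‖ ^ 2 = N v ^ 2 := sumR
    simp_rw [← Finset.mul_sum] at e3
    rw [e3, e3, e4, e4]
    ring
  have h0 : 0 ≤ 4 * √(C * C') * N v * N w := by positivity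
  refine abs_le_of_sq_le_sq' ?_ h0 |>.2
  have : √(C * C') ^ 2 = C * C' := Real.sq_sqrt (by positivity)
  calc N (v * w) ^ 2 ≤ 16 * (C * C') * (N v ^ 2 * N w ^ 2) := hsq
    _ = (4 * √(C * C') * N v * N w) ^ 2 := by
        rw [mul_pow, mul_pow, mul_pow, this]; ring

lemma energy_star (v : ι → κ → ℂ) : energy (formMatrix A h) (formMatrix A' h') (star v)
    = energy (formMatrix A h) (formMatrix A' h') v := by
  rw [← sq_eq_sq₀ (apply_nonneg _ _) (apply_nonneg _ _), energy_sq hA hA', energy_sq hA hA']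
  refine Finset.sum_congr rfl fun e _ => Finset.sum_congr rfl fun f _ => ?_
  congr 3
  simp only [incr₂, ext₂_star]
  rw [← map_sub, ← map_sub, ← map_sub, RCLike.norm_conj]

/-- Elliptic estimate: the square of `1 + Aₓ + A_y` dominates `(1 + Aₓ)(1 + A_y)`. -/
lemma energy_sq_le_of_elliptic {η r : ι → κ → ℂ} (hr : η + (opX A η + opY A' η) = r) :
    energy (formMatrix A h) (formMatrix A' h') η ^ 2 ≤ h * h' * ∑ i, ∑ j, ‖r i j‖ ^ 2 := by
  have hmul : ∀ v w : ι → κ → ℂ, tensorForm (1 : Matrix ι ι ℝ) (1 : Matrix κ κ ℝ) v w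
      = ∑ i, ∑ j, starRingEnd ℂ (v i j) * w i j := by
    intro v w
    rw [tensorForm_eq_sum, Finset.sum_comm]
    simp only [Matrix.one_apply]
    rw [Finset.sum_comm]
    simp [apply_ite, Finset.sum_comm (γ := κ)]
  have hx : ∀ w : ι → κ → ℂ, opX (formMatrix A h) w = (h : ℂ) • (w + opX A w) := by
    intro w; ext i j
    simp [opX, formMatrix, Matrix.one_apply, apply_ite, add_mul, mul_add, mul_assoc,
      Finset.sum_add_distrib, Finset.mul_sum]
  have hy : ∀ w : ι → κ → ℂ, opY (formMatrix A' h') w = (h' : ℂ) • (w + opY A' w) := by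
    intro w; ext i j
    simp [opY, formMatrix, Matrix.one_apply, apply_ite, add_mul, mul_add, mul_assoc,
      Finset.sum_add_distrib, Finset.mul_sum]
  set a := opX A η with ha
  set b := opY A' η with hb
  have hcross : (tensorForm (1 : Matrix ι ι ℝ) (1 : Matrix κ κ ℝ) η (opX A b)).re
      = (tensorForm (1 : Matrix ι ι ℝ) (1 : Matrix κ κ ℝ) b a).re := by
    rw [tensorForm_opX, one_mul, ← Complex.conj_re, conj_tensorForm, hA.symm, Matrix.transpose_one,
      ha, tensorForm_opX, one_mul]
  have hpa : 0 ≤ (tensorForm (1 : Matrix ι ι ℝ) (1 : Matrix κ κ ℝ) η a).re := by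
    rw [ha, tensorForm_opX, one_mul, tensorForm_eq_sum, Complex.re_sum]
    refine Finset.sum_nonneg fun j _ => ?_
    simp only [Matrix.one_apply]
    simpa [apply_ite] using hA.re_form_nonneg fun i => η i j
  have hpb : 0 ≤ (tensorForm (1 : Matrix ι ι ℝ) (1 : Matrix κ κ ℝ) η b).re := by
    rw [hmul, Complex.re_sum]
    refine Finset.sum_nonneg fun i _ => ?_
    refine (hA'.re_form_nonneg (η i)).trans (le_of_eq ?_)
    congr 1
    refine Finset.sum_congr rfl fun j _ => ?_
    simp only [hb, opY, LinearMap.coe_mk, AddHom.coe_mk, Finset.mul_sum]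
    refine Finset.sum_congr rfl fun j' _ => ?_
    ring
  have hN : energy (formMatrix A h) (formMatrix A' h') η ^ 2
      = h * h' * ((tensorForm (1 : Matrix ι ι ℝ) (1 : Matrix κ κ ℝ) η η).re
        + (tensorForm (1 : Matrix ι ι ℝ) (1 : Matrix κ κ ℝ) η b).re
        + (tensorForm (1 : Matrix ι ι ℝ) (1 : Matrix κ κ ℝ) η a).re
        + (tensorForm (1 : Matrix ι ι ℝ) (1 : Matrix κ κ ℝ) b a).re) := by
    rw [energy_sq_eq_re hA hA', ← one_mul (formMatrix A h), ← one_mul (formMatrix A' h'),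
      ← tensorForm_opY, ← tensorForm_opX, ← hcross, hy, map_smul, hx, ← hb, map_add, ← ha,
      tensorForm_smul_right, tensorForm_smul_right, ← mul_assoc, ← Complex.ofReal_mul,
      Complex.re_ofReal_mul, tensorForm_add_right, tensorForm_add_right, tensorForm_add_right,
      Complex.add_re, Complex.add_re, Complex.add_re]
    ring
  have hR : (tensorForm (1 : Matrix ι ι ℝ) (1 : Matrix κ κ ℝ) η η).re
        + 2 * (tensorForm (1 : Matrix ι ι ℝ) (1 : Matrix κ κ ℝ) η b).re
        + 2 * (tensorForm (1 : Matrix ι ι ℝ) (1 : Matrix κ κ ℝ) η a).re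
        + (tensorForm (1 : Matrix ι ι ℝ) (1 : Matrix κ κ ℝ) b a).re
      ≤ ∑ i, ∑ j, ‖r i j‖ ^ 2 := by
    simp only [hmul, Complex.re_sum, Finset.mul_sum, ← Finset.sum_add_distrib]
    refine Finset.sum_le_sum fun i _ => Finset.sum_le_sum fun j _ => ?_
    have : r i j = η i j + (a i j + b i j) := by rw [← hr]; rfl
    rw [this, ← Complex.normSq_eq_norm_sq, Complex.normSq_apply]
    simp only [Complex.mul_re, Complex.conj_re, Complex.conj_im, Complex.add_re, Complex.add_im]
    nlinarith [sq_nonneg ((a i j).re + (b i j).re), sq_nonneg ((a i j).im + (b i j).im),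
      sq_nonneg ((a i j).re), sq_nonneg ((b i j).re), sq_nonneg ((a i j).im),
      sq_nonneg ((b i j).im)]
  rw [hN]
  refine mul_le_mul_of_nonneg_left ?_ (mul_pos hA.mesh_pos hA'.mesh_pos).le
  linarith

/-- The operator `1 + Aₓ + A_y` is onto, since it is injective on a finite-dimensional space. -/
lemma exists_elliptic (hC : 0 ≤ C) (hC' : 0 ≤ C') (r : ι → κ → ℂ) :
    ∃ η : ι → κ → ℂ, η + (opX A η + opY A' η) = r := by
  set L : (ι → κ → ℂ) →ₗ[ℂ] (ι → κ → ℂ) := LinearMap.id + (opX A + opY A') with hL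
  have hinj : Function.Injective L := by
    rw [← LinearMap.ker_eq_bot, LinearMap.ker_eq_bot']
    intro η hη
    have h1 := energy_sq_le_of_elliptic hA hA' (η := η) (r := 0) (by simpa [hL] using hη)
    simp only [Pi.zero_apply, norm_zero] at h1
    have h2 : energy (formMatrix A h) (formMatrix A' h') η = 0 := by
      have : energy (formMatrix A h) (formMatrix A' h') η ^ 2 ≤ 0 := by simpa using h1
      exact pow_eq_zero_iff two_ne_zero |>.1 (le_antisymm this (sq_nonneg _))
    ext i j
    have := norm_le_energy hA hA' hC hC' η i j
    rw [h2, mul_zero] at this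
    simpa using this
  obtain ⟨η, hη⟩ := LinearMap.injective_iff_surjective.1 hinj r
  exact ⟨η, by simpa [hL] using hη⟩

end
end TensorForms

/-! ### The fractional difference operator as a Dirichlet operator -/

/-- Interior nodes of a grid with `M` cells. -/
abbrev Node (M : ℕ) : Type := ↥(Finset.Ioo 0 M)

/-- The matrix of the fractional centered difference, with the sign that makes it positive. -/
def diffMatrix (α h : ℝ) (M : ℕ) : Matrix (Node M) (Node M) ℝ := fun j s =>
  1 / h ^ α * coeff α (((j : ℕ) : ℤ) - ((s : ℕ) : ℤ))

lemma sum_edgeWeight_diffMatrix {α h : ℝ} (h1 : 1 < α) (M : ℕ) (v : Node M → ℂ) :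
    ∑ e, edgeWeight (formMatrix (diffMatrix α h M) h) e * ‖incr e v‖ ^ 2
      = h * ∫ x in (0 : ℝ)..1, (1 + 1 / h ^ α * symbol α x)
          * ‖trigPoly Finset.univ (fun i : Node M => ((i : ℕ) : ℤ)) v x‖ ^ 2 := by
  have hcs := continuous_symbol (by linarith : 0 < α)
  have hct := continuous_trigPoly Finset.univ (fun i : Node M => ((i : ℕ) : ℤ)) v
  have hsymm : (formMatrix (diffMatrix α h M) h).IsSymm := by
    ext i j
    simp only [formMatrix, diffMatrix, Matrix.transpose_apply, Matrix.smul_apply, Matrix.add_apply,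
      Matrix.one_apply]
    rw [← coeff_neg, neg_sub]
    simp only [eq_comm]
  have hpos : InjOn (fun i : Node M => ((i : ℕ) : ℤ)) (Finset.univ : Finset (Node M)) := by
    intro i _ j _ hij
    exact Subtype.ext (by simpa using hij)
  have e1 := integral_normSq_trigPoly Finset.univ v hpos
  have e2 := integral_symbol_mul_normSq_trigPoly Finset.univ (fun i : Node M => ((i : ℕ) : ℤ)) v h1
  have e3 : ∫ x in (0 : ℝ)..1, (1 + 1 / h ^ α * symbol α x)
          * ‖trigPoly Finset.univ (fun i : Node M => ((i : ℕ) : ℤ)) v x‖ ^ 2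
      = (∑ i, ‖v i‖ ^ 2) + 1 / h ^ α * ∫ x in (0 : ℝ)..1, symbol α x
          * ‖trigPoly Finset.univ (fun i : Node M => ((i : ℕ) : ℤ)) v x‖ ^ 2 := by
    rw [← e1, ← intervalIntegral.integral_const_mul, ← intervalIntegral.integral_add
      (Continuous.intervalIntegrable (by fun_prop) _ _)
      (Continuous.intervalIntegrable (by fun_prop) _ _)]
    congr 1; ext x; ring
  rw [e3, ← Complex.ofReal_inj, sum_edgeWeight_normSq hsymm]
  rw [Complex.ofReal_mul, Complex.ofReal_add, Complex.ofReal_mul, e2]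
  have e4 : ∀ i j, ((formMatrix (diffMatrix α h M) h i j : ℝ) : ℂ) * (starRingEnd ℂ (v i) * v j)
      = h * (if i = j then (‖v i‖ : ℂ) ^ 2 else 0) + h * (((1 / h ^ α : ℝ) : ℂ)
        * (v j * starRingEnd ℂ (v i) * coeff α (((j : ℕ) : ℤ) - ((i : ℕ) : ℤ)))) := by
    intro i j
    simp only [formMatrix, diffMatrix, Matrix.smul_apply, Matrix.add_apply, Matrix.one_apply,
      smul_eq_mul]
    rw [← coeff_neg, neg_sub]
    split_ifs with hij
    · subst hij
      rw [← Complex.conj_mul']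
      push_cast; ring
    · push_cast; ring
  simp_rw [e4, Finset.sum_add_distrib, ← Finset.mul_sum]
  simp only [Finset.sum_ite_eq, Finset.mem_univ, if_true]
  rw [mul_add]
  push_cast
  congr 3
  exact Finset.sum_comm

/-- The fractional difference operator fits the abstract setting, with a Sobolev constant that does
not depend on the mesh. -/
lemma isDirichletOp_diffMatrix {α h : ℝ} (h1 : 1 < α) (h2 : α ≤ 2) (hh : 0 < h) (M : ℕ) :
    IsDirichletOp (diffMatrix α h M) h (1 / (α - 1)) where
  symm := by
    ext i j
    simp only [diffMatrix, Matrix.transpose_apply]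
    rw [← coeff_neg, neg_sub]
  off_diag i j hij := by
    refine mul_nonpos_of_nonneg_of_nonpos (by positivity) (coeff_nonpos_of_ne h1 h2 ?_)
    intro h0
    exact hij (Subtype.ext (by omega))
  row_sum i := by
    simp only [diffMatrix]
    rw [← Finset.mul_sum]
    refine mul_nonneg (by positivity) ?_
    have hinj : Function.Injective fun j : Node M => ((i : ℕ) : ℤ) - ((j : ℕ) : ℤ) := by
      intro j k hjk
      exact Subtype.ext (by simpa using hjk)
    have := sum_coeff_nonneg h1 h2
      (S := Finset.univ.map ⟨fun j : Node M => ((i : ℕ) : ℤ) - ((j : ℕ) : ℤ), hinj⟩)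
      (Finset.mem_map.2 ⟨i, Finset.mem_univ _, by simp⟩)
    simpa using this
  mesh_pos := hh
  sobolev v i := by
    have hpos : InjOn (fun i : Node M => ((i : ℕ) : ℤ)) (Finset.univ : Finset (Node M)) := by
      intro i _ j _ hij
      exact Subtype.ext (by simpa using hij)
    rw [sum_edgeWeight_diffMatrix h1]
    exact normSq_le_integral_symbol Finset.univ hpos v h1 h2 hh (Finset.mem_univ i)

/-- The one-dimensional form is controlled by divided differences: its symbol `y ^ α` is at most
`1 + y ^ 2`. -/
lemma sum_edgeWeight_le_divided {α h : ℝ} (h1 : 1 < α) (h2 : α ≤ 2) (hh : 0 < h) {M : ℕ}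
    {v : ℕ → ℂ} (h0 : v 0 = 0) (hvM : v M = 0) :
    ∑ e, edgeWeight (formMatrix (diffMatrix α h M) h) e * ‖incr e fun i : Node M => v i‖ ^ 2
      ≤ h * (2 * ∑ s ∈ Finset.range M, ‖v s‖ ^ 2
          + 1 / h ^ 2 * ∑ s ∈ Finset.range M, ‖v (s + 1) - v s‖ ^ 2) := by
  rw [sum_edgeWeight_diffMatrix h1]
  set V := trigPoly Finset.univ (fun i : Node M => ((i : ℕ) : ℤ)) fun i : Node M => v i with hV
  have hVeq : ∀ x, V x = trigPoly (Finset.range M) (fun s : ℕ => (s : ℤ)) v x := by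
    intro x
    simp only [hV, trigPoly]
    rw [Finset.sum_coe_sort (Finset.Ioo 0 M) (fun i => v i * chr (i : ℤ) x)]
    refine Finset.sum_subset (fun s hs => ?_) fun s hs hs' => ?_
    · rw [Finset.mem_Ioo] at hs; exact Finset.mem_range.2 hs.2
    · rw [Finset.mem_range] at hs
      rw [Finset.mem_Ioo] at hs'
      have : s = 0 := by omega
      rw [this, h0, zero_mul]
  have hVeq' : ∀ x, V x = ∑ s ∈ Finset.range M, v (s + 1) * chr ((s + 1 : ℕ) : ℤ) x := by
    intro x
    have h1 := Finset.sum_range_succ (fun s => v s * chr (s : ℤ) x) M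
    have h2 := Finset.sum_range_succ' (fun s => v s * chr (s : ℤ) x) M
    rw [h0, zero_mul, add_zero] at h2
    rw [hvM, zero_mul, add_zero, h2] at h1
    rw [hVeq, trigPoly, ← h1]
  have hinj : InjOn (fun s : ℕ => (s : ℤ)) (Finset.range M) := fun i _ j _ hij => by simpa using hij
  have hinj' : InjOn (fun s : ℕ => ((s + 1 : ℕ) : ℤ)) (Finset.range M) :=
    fun i _ j _ hij => by simpa using hij
  have hp1 := integral_normSq_trigPoly (Finset.range M) v hinj
  have hp2 := integral_normSq_trigPoly (Finset.range M) (fun s => v (s + 1) - v s) hinj'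
  have hdiff : ∀ x, symbol 2 x * ‖V x‖ ^ 2 = ‖trigPoly (Finset.range M)
      (fun s : ℕ => ((s + 1 : ℕ) : ℤ)) (fun s => v (s + 1) - v s) x‖ ^ 2 := by
    intro x
    have e1 : trigPoly (Finset.range M) (fun s : ℕ => ((s + 1 : ℕ) : ℤ))
        (fun s => v (s + 1) - v s) x = (1 - chr 1 x) * V x := by
      have e2 : chr 1 x * V x = ∑ s ∈ Finset.range M, v s * chr ((s + 1 : ℕ) : ℤ) x := by
        rw [hVeq, trigPoly, Finset.mul_sum]
        refine Finset.sum_congr rfl fun s _ => ?_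
        push_cast
        rw [chr_add]; ring
      rw [sub_mul, one_mul, e2, hVeq', trigPoly, ← Finset.sum_sub_distrib]
      refine Finset.sum_congr rfl fun s _ => ?_
      ring
    rw [e1, norm_mul, mul_pow]
    congr 1
    have e3 : (1 - chr 1 x : ℂ) = ((1 - Real.cos (2 * (Real.pi * x)) : ℝ) : ℂ)
        + ((-Real.sin (2 * (Real.pi * x)) : ℝ) : ℂ) * Complex.I := by
      have : (2 * Real.pi * Complex.I * (1 : ℤ) * x : ℂ)
          = ((2 * (Real.pi * x) : ℝ) : ℂ) * Complex.I := by push_cast; ring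
      rw [chr, this, Complex.exp_mul_I]
      push_cast; ring
    rw [e3, ← Complex.normSq_eq_norm_sq, Complex.normSq_add_mul_I, symbol, Real.rpow_two, sq_abs,
      Real.cos_two_mul, Real.sin_two_mul]
    have := Real.sin_sq_add_cos_sq (Real.pi * x)
    set s := Real.sin (Real.pi * x)
    set c := Real.cos (Real.pi * x)
    have hs : s ^ 2 = 1 - c ^ 2 := by linarith
    simp only [mul_pow, neg_sq, hs]
    ring
  have hcs := continuous_symbol (by linarith : 0 < α)
  have hcs2 := continuous_symbol (by norm_num : (0 : ℝ) < 2)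
  have hct : Continuous V := continuous_trigPoly _ _ _
  refine mul_le_mul_of_nonneg_left ?_ hh.le
  rw [← hp1, ← hp2, ← intervalIntegral.integral_const_mul, ← intervalIntegral.integral_const_mul]
  simp_rw [← hdiff, ← hVeq]
  rw [← intervalIntegral.integral_add (Continuous.intervalIntegrable (by fun_prop) _ _)
    (Continuous.intervalIntegrable (by fun_prop) _ _)]
  refine intervalIntegral.integral_mono_on zero_le_one
    (Continuous.intervalIntegrable (by fun_prop) _ _)
    (Continuous.intervalIntegrable (by fun_prop) _ _) fun x _ => ?_
  have key : 1 / h ^ α * symbol α x ≤ 1 + 1 / h ^ 2 * symbol 2 x := by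
    unfold symbol
    set y := |2 * Real.sin (Real.pi * x)| with hy
    have hy0 : 0 ≤ y := abs_nonneg _
    have e1 : 1 / h ^ α * y ^ α = (y / h) ^ α := by
      rw [Real.div_rpow hy0 hh.le]; ring
    have e2 : 1 / h ^ 2 * y ^ (2 : ℝ) = (y / h) ^ (2 : ℝ) := by
      rw [Real.div_rpow hy0 hh.le, Real.rpow_two, Real.rpow_two]; ring
    rw [e1, e2]
    have hz : 0 ≤ y / h := by positivity
    rcases le_total (y / h) 1 with hc | hc
    · have := Real.rpow_le_one hz hc (by linarith : 0 ≤ α)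
      have := Real.rpow_nonneg hz 2
      linarith
    · have := Real.rpow_le_rpow_of_exponent_le hc h2
      linarith
  have hn : 0 ≤ ‖V x‖ ^ 2 := by positivity
  nlinarith

lemma sum_edgeWeight_le {α h : ℝ} (h1 : 1 < α) (h2 : α ≤ 2) (hh : 0 < h) {M : ℕ}
    {v : ℕ → ℂ} (h0 : v 0 = 0) (hvM : v M = 0) {m : ℝ}
    (hv : ∀ s < M, ‖v s‖ ≤ m) (hd : ∀ s < M, ‖v (s + 1) - v s‖ ≤ m * h) :
    ∑ e, edgeWeight (formMatrix (diffMatrix α h M) h) e * ‖incr e fun i : Node M => v i‖ ^ 2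
      ≤ 3 * (M * h) * m ^ 2 := by
  refine (sum_edgeWeight_le_divided h1 h2 hh h0 hvM).trans ?_
  have s1 : ∑ s ∈ Finset.range M, ‖v s‖ ^ 2 ≤ M * m ^ 2 := by
    refine (Finset.sum_le_card_nsmul _ _ (m ^ 2) fun s hs => ?_).trans (by simp)
    exact pow_le_pow_left₀ (norm_nonneg _) (hv s (Finset.mem_range.1 hs)) 2
  have s2 : ∑ s ∈ Finset.range M, ‖v (s + 1) - v s‖ ^ 2 ≤ M * (m * h) ^ 2 := by
    refine (Finset.sum_le_card_nsmul _ _ ((m * h) ^ 2) fun s hs => ?_).trans (by simp)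
    exact pow_le_pow_left₀ (norm_nonneg _) (hd s (Finset.mem_range.1 hs)) 2
  calc _ ≤ h * (2 * (M * m ^ 2) + 1 / h ^ 2 * (M * (m * h) ^ 2)) := by gcongr
    _ = 3 * (M * h) * m ^ 2 := by field_simp; ring

/-- Restriction of a grid function to the interior nodes. -/
def interior (Mx My : ℕ) (V : ℕ → ℕ → ℂ) : Node Mx → Node My → ℂ := fun i j => V i j

/-- The energy norm of a grid function with zero boundary values is controlled by its values, its
divided differences, and its mixed divided differences. -/
lemma energy_interior_le {α hx hy : ℝ} (h1 : 1 < α) (h2 : α ≤ 2) (hhx : 0 < hx) (hhy : 0 < hy)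
    {Mx My : ℕ} {V : ℕ → ℕ → ℂ} {m : ℝ} (hm : 0 ≤ m)
    (bx0 : ∀ k, V 0 k = 0) (bx1 : ∀ k, V Mx k = 0) (by0 : ∀ j, V j 0 = 0) (by1 : ∀ j, V j My = 0)
    (hv : ∀ j < Mx, ∀ k < My, ‖V j k‖ ≤ m)
    (hdx : ∀ j < Mx, ∀ k < My, ‖V (j + 1) k - V j k‖ ≤ m * hx)
    (hdy : ∀ j < Mx, ∀ k < My, ‖V j (k + 1) - V j k‖ ≤ m * hy)
    (hdxy : ∀ j < Mx, ∀ k < My,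
      ‖V (j + 1) (k + 1) - V j (k + 1) - (V (j + 1) k - V j k)‖ ≤ m * hx * hy) :
    energy (formMatrix (diffMatrix α hx Mx) hx) (formMatrix (diffMatrix α hy My) hy)
      (interior Mx My V) ≤ 3 * √(Mx * hx * (My * hy)) * m := by
  have hA := isDirichletOp_diffMatrix h1 h2 hhx Mx
  have hA' := isDirichletOp_diffMatrix h1 h2 hhy My
  set a := edgeWeight (formMatrix (diffMatrix α hx Mx) hx) with ha
  set b := edgeWeight (formMatrix (diffMatrix α hy My) hy) with hb
  have b0 : ∀ f, 0 ≤ b f := hA'.weight_nonneg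
  have incr_zero : ∀ f : Option (Node My) × Option (Node My), incr f (fun _ => (0 : ℂ)) = 0 := by
    rintro ⟨p, q⟩; cases p <;> cases q <;> simp [incr, ext]
  have incr_sub : ∀ (f : Option (Node My) × Option (Node My)) (v w : Node My → ℂ),
      incr f v - incr f w = incr f fun j => v j - w j := by
    rintro ⟨p, q⟩ v w; cases p <;> cases q <;> simp [incr, ext] <;> ring
  have step1 : ∀ f, ∑ e, a e * ‖incr₂ e f (interior Mx My V)‖ ^ 2
      ≤ hx * (2 * ∑ s ∈ Finset.range Mx, ‖incr f fun j : Node My => V s j‖ ^ 2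
          + 1 / hx ^ 2 * ∑ s ∈ Finset.range Mx,
            ‖incr f fun j : Node My => V (s + 1) j - V s j‖ ^ 2) := by
    intro f
    have := sum_edgeWeight_le_divided h1 h2 hhx (M := Mx)
      (v := fun s => incr f fun j : Node My => V s j) (by simp only [bx0, incr_zero])
      (by simp only [bx1, incr_zero])
    simp only [incr_sub] at this
    simp_rw [incr₂_eq_incr_incr]
    exact this
  have step2 : ∀ s < Mx, ∑ f, b f * ‖incr f fun j : Node My => V s j‖ ^ 2
      ≤ 3 * (My * hy) * m ^ 2 := fun s hs =>
    sum_edgeWeight_le h1 h2 hhy (by0 s) (by1 s) (hv s hs) (hdy s hs)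
  have step3 : ∀ s < Mx, ∑ f, b f * ‖incr f fun j : Node My => V (s + 1) j - V s j‖ ^ 2
      ≤ 3 * (My * hy) * (m * hx) ^ 2 := fun s hs =>
    sum_edgeWeight_le h1 h2 hhy (v := fun k => V (s + 1) k - V s k)
      (by simp only [by0, sub_zero]) (by simp only [by1, sub_zero]) (hdx s hs) (hdxy s hs)
  have hsq : energy (formMatrix (diffMatrix α hx Mx) hx) (formMatrix (diffMatrix α hy My) hy)
      (interior Mx My V) ^ 2 ≤ 9 * (Mx * hx * (My * hy)) * m ^ 2 := by
    rw [energy_sq hA hA', Finset.sum_comm]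
    calc ∑ f, ∑ e, a e * (b f * ‖incr₂ e f (interior Mx My V)‖ ^ 2)
        = ∑ f, b f * ∑ e, a e * ‖incr₂ e f (interior Mx My V)‖ ^ 2 := by
          refine Finset.sum_congr rfl fun f _ => ?_
          rw [Finset.mul_sum]
          refine Finset.sum_congr rfl fun e _ => ?_
          rw [mul_left_comm]
      _ ≤ ∑ f, b f * (hx * (2 * ∑ s ∈ Finset.range Mx, ‖incr f fun j : Node My => V s j‖ ^ 2
          + 1 / hx ^ 2 * ∑ s ∈ Finset.range Mx,
            ‖incr f fun j : Node My => V (s + 1) j - V s j‖ ^ 2)) :=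
          Finset.sum_le_sum fun f _ => mul_le_mul_of_nonneg_left (step1 f) (b0 f)
      _ = hx * (2 * ∑ s ∈ Finset.range Mx, ∑ f, b f * ‖incr f fun j : Node My => V s j‖ ^ 2
          + 1 / hx ^ 2 * ∑ s ∈ Finset.range Mx,
            ∑ f, b f * ‖incr f fun j : Node My => V (s + 1) j - V s j‖ ^ 2) := by
          have gen : ∀ (c : ℝ) (X Y : Option (Node My) × Option (Node My) → ℝ),
              ∑ f, hx * (2 * X f + c * Y f) = hx * (2 * ∑ f, X f + c * ∑ f, Y f) := by
            intro c X Y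
            rw [← Finset.mul_sum, Finset.sum_add_distrib, ← Finset.mul_sum, ← Finset.mul_sum]
          rw [Finset.sum_comm, Finset.sum_comm (s := Finset.range Mx) (t := Finset.univ), ← gen]
          refine Finset.sum_congr rfl fun f _ => ?_
          rw [← Finset.mul_sum, ← Finset.mul_sum]
          ring
      _ ≤ hx * (2 * (Mx * (3 * (My * hy) * m ^ 2))
          + 1 / hx ^ 2 * (Mx * (3 * (My * hy) * (m * hx) ^ 2))) := by
          gcongr
          · refine (Finset.sum_le_card_nsmul _ _ (3 * (My * hy) * m ^ 2) fun s hs => ?_).trans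
              (by simp)
            exact step2 s (Finset.mem_range.1 hs)
          · refine (Finset.sum_le_card_nsmul _ _ (3 * (My * hy) * (m * hx) ^ 2)
              fun s hs => ?_).trans (by simp)
            exact step3 s (Finset.mem_range.1 hs)
      _ = 9 * (Mx * hx * (My * hy)) * m ^ 2 := by field_simp; ring
  have h0 : 0 ≤ 3 * √(Mx * hx * (My * hy)) * m := by positivity
  refine abs_le_of_sq_le_sq' ?_ h0 |>.2
  rw [mul_pow, mul_pow, Real.sq_sqrt (by positivity)]
  linarith

/-! ### Stability of the linearized scheme in a submultiplicative norm -/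

section Stability
variable {ι κ : Type}

/-- The linearized cubic term is Lipschitz in a submultiplicative norm, on a neighbourhood of radius
one of a bounded set. -/
lemma cubic_difference_le {N : Seminorm ℂ (ι → κ → ℂ)} {K R : ℝ} (hK : 0 ≤ K) (hR : 0 ≤ R)
    (hmul : ∀ v w, N (v * w) ≤ K * N v * N w) (hstar : ∀ v, N (star v) = N v)
    {u up um e ep em : ι → κ → ℂ} (hu : N u ≤ R) (hup : N up ≤ R) (hum : N um ≤ R) (he : N e ≤ 1) :
    N (u * star u * (up + um) - (u - e) * star (u - e) * ((up - ep) + (um - em)))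
      ≤ 4 * K ^ 2 * (R + 1) ^ 2 * (N e + N ep + N em) := by
  have hdec : u * star u * (up + um) - (u - e) * star (u - e) * ((up - ep) + (um - em))
      = (u * star e + e * star u - e * star e) * (up + um)
        + (u - e) * star (u - e) * (ep + em) := by
    rw [star_sub]; ring
  have n0 : ∀ v, 0 ≤ N v := fun v => apply_nonneg N v
  have h1 : N (u * star e + e * star u - e * star e) ≤ K * (2 * R + 1) * N e := by
    have a1 := hmul u (star e)
    have a2 := hmul e (star u)
    have a3 := hmul e (star e)
    rw [hstar] at a1 a2 a3
    have t := (map_sub_le_add N (u * star e + e * star u) (e * star e)).trans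
      (add_le_add (map_add_le_add N (u * star e) (e * star u)) le_rfl)
    have b1 : K * N u * N e ≤ K * R * N e := by gcongr
    have b2 : K * N e * N u ≤ K * N e * R := by gcongr
    have b3 : K * N e * N e ≤ K * N e * 1 := by gcongr
    linarith
  have h2 : N (up + um) ≤ 2 * R := (map_add_le_add N _ _).trans (by linarith)
  have h3 : N (u - e) ≤ R + 1 := (map_sub_le_add N _ _).trans (by linarith)
  have h4 : N ((u - e) * star (u - e)) ≤ K * (R + 1) * (R + 1) := by
    refine (hmul _ _).trans ?_
    rw [hstar]
    gcongr
  have h5 : N (ep + em) ≤ N ep + N em := map_add_le_add N _ _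
  rw [hdec]
  refine (map_add_le_add N _ _).trans ?_
  have g1 : N ((u * star e + e * star u - e * star e) * (up + um))
      ≤ K * (K * (2 * R + 1) * N e) * (2 * R) := (hmul _ _).trans (by gcongr)
  have g2 : N ((u - e) * star (u - e) * (ep + em))
      ≤ K * (K * (R + 1) * (R + 1)) * (N ep + N em) := (hmul _ _).trans (by gcongr)
  have q := n0 e
  have qp := n0 ep
  have qm := n0 em
  have c1 : K * (K * (2 * R + 1) * N e) * (2 * R) ≤ 4 * K ^ 2 * (R + 1) ^ 2 * N e := by
    have : 0 ≤ K ^ 2 * N e := by positivity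
    nlinarith
  have c2 : K * (K * (R + 1) * (R + 1)) * (N ep + N em)
      ≤ 4 * K ^ 2 * (R + 1) ^ 2 * (N ep + N em) := by
    have : 0 ≤ K ^ 2 * (R + 1) ^ 2 * (N ep + N em) := by positivity
    nlinarith
  linarith

/-- One step of the Gronwall argument for the sum of two consecutive errors; the implicit part is
absorbed because `x ≤ 1 / 2`. -/
lemma three_level_step {x q E₀ E₁ E₂ : ℝ} (hx0 : 0 ≤ x) (hx : x ≤ 1 / 2) (hq : 0 ≤ q)
    (h0 : 0 ≤ E₀) (h1 : 0 ≤ E₁) (h : E₂ ≤ E₀ + (x * (E₁ + E₂ + E₀) + q)) :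
    E₂ + E₁ ≤ (1 + 4 * x) * (E₁ + E₀) + 2 * q := by
  have hpos : 0 < 1 - x := by linarith
  have p1 : 0 ≤ x * E₁ := mul_nonneg hx0 h1
  have p2 : 0 ≤ x * (1 - 2 * x) * (E₁ + E₀) :=
    mul_nonneg (mul_nonneg hx0 (by linarith)) (by linarith)
  have p3 : 0 ≤ (1 - 2 * x) * q := mul_nonneg (by linarith) hq
  refine le_of_mul_le_mul_left ?_ hpos
  have e1 : (1 - x) * ((1 + 4 * x) * (E₁ + E₀) + 2 * q)
      = (1 + x) * (E₁ + E₀) + 2 * (x * (1 - 2 * x) * (E₁ + E₀)) + q + (1 - 2 * x) * q := by ring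
  rw [e1]
  linarith

lemma one_add_mul_pow_le_exp {τ lam T : ℝ} {k Nt : ℕ} (hτ : 0 ≤ τ) (hlam : 0 ≤ lam) (hk : k ≤ Nt)
    (hT : Nt * τ ≤ T) : (1 + τ * lam) ^ k ≤ Real.exp (lam * T) := by
  have h1 : 1 + τ * lam ≤ Real.exp (τ * lam) := by
    linarith [Real.add_one_le_exp (τ * lam)]
  have hnT : (k : ℝ) * τ ≤ T := by
    refine le_trans ?_ hT
    gcongr
  calc (1 + τ * lam) ^ k ≤ Real.exp (τ * lam) ^ k := pow_le_pow_left₀ (by positivity) h1 _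
    _ = Real.exp (k * (τ * lam)) := by rw [← Real.exp_nat_mul]
    _ ≤ Real.exp (lam * T) := by
        apply Real.exp_le_exp.2
        have := mul_le_mul_of_nonneg_left hnT hlam
        linarith

/-- Convergence of the three-level scheme in a submultiplicative seminorm `N` that implicit midpoint
steps do not increase. The exact values `u` satisfy the scheme up to `ρ`, which is small in `N`, and
up to `η - L η`, where only `η` and its time differences are small in `N`. The solution stays in a
ball on which the nonlinearity is Lipschitz, as long as the error is at most one. -/
theorem stability (K R D T : ℝ) (hK : 0 ≤ K) (hR : 0 ≤ R) (hD : 0 ≤ D) :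
    ∃ τ₀ > 0, ∃ ε₀ > 0, ∃ C > 0, ∀ {ι κ : Type} (N : Seminorm ℂ (ι → κ → ℂ))
      (L : (ι → κ → ℂ) →ₗ[ℂ] (ι → κ → ℂ)),
      (∀ v w, N (v * w) ≤ K * N v * N w) → (∀ v, N (star v) = N v) →
      (∀ (τ : ℝ) (p m F : ι → κ → ℂ), 0 ≤ τ →
        p - m = (τ : ℂ) • (Complex.I • L (p + m) + F) → N p ≤ N m + τ * N F) →
      ∀ (u U η ρ : ℕ → ι → κ → ℂ) (Nt : ℕ) (τ ε : ℝ), 0 < τ → Nt * τ ≤ T → 0 ≤ ε →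
      τ ≤ τ₀ → ε ≤ ε₀ →
      (∀ n, n + 2 ≤ Nt → U (n + 2) - U n = (τ : ℂ) • (Complex.I • L (U (n + 2) + U n)
        + Complex.I • (U (n + 1) * star (U (n + 1)) * (U (n + 2) + U n)))) →
      (∀ n, n + 2 ≤ Nt → u (n + 2) - u n = (τ : ℂ) • (Complex.I • L (u (n + 2) + u n)
        + Complex.I • (u (n + 1) * star (u (n + 1)) * (u (n + 2) + u n))
        + Complex.I • (η (n + 2) + η n - L (η (n + 2) + η n)) + ρ n)) →
      (∀ n, n + 2 ≤ Nt → N (ρ n) ≤ D * ε) →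
      (∀ n ≤ Nt, N (η n) ≤ D * ε) →
      (∀ n, n + 2 ≤ Nt → N (η (n + 2) - η n) ≤ D * τ * ε) →
      (∀ n ≤ Nt, N (u n) ≤ R) →
      N (u 0 - U 0) ≤ D * ε → N (u 1 - U 1) ≤ D * ε →
      ∀ n ≤ Nt, N (u n - U n) ≤ C * ε := by
  set C1 : ℝ := 4 * K ^ 2 * (R + 1) ^ 2 with hC1
  have hC1' : 0 ≤ C1 := by positivity
  set C2 : ℝ := 3 * C1 * D + 4 * D with hC2
  have hC2' : 0 ≤ C2 := by positivity
  set lam : ℝ := 4 * C1 + 2 with hlam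
  have hlam' : 0 < lam := by positivity
  set C : ℝ := Real.exp (lam * T) * (4 * D + C2) + D + 1 with hC
  have hCpos : 0 < C := by positivity
  refine ⟨1 / (2 * (C1 + 1)), by positivity, 1 / C, by positivity, C, hCpos, ?_⟩
  intro ι κ N L hmul hstar hstep u U η ρ Nt τ ε hτ hT hε hτ₀ hε₀ hU hu hρ hη hdη hNu he0 he1
  have hτC : τ * C1 ≤ 1 / 2 := by
    rw [le_div_iff₀ (by positivity)] at hτ₀
    nlinarith
  have hCε : C * ε ≤ 1 := by
    rw [le_div_iff₀ hCpos] at hε₀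
    linarith
  set θ : ℕ → ι → κ → ℂ := fun n => u n - U n - η n with hθ
  have n0 : ∀ v, 0 ≤ N v := fun v => apply_nonneg N v
  have heθ : ∀ n ≤ Nt, N (u n - U n) ≤ N (θ n) + D * ε := by
    intro n hn
    have : u n - U n = θ n + η n := by simp only [hθ]; abel
    rw [this]
    exact (map_add_le_add N _ _).trans (by linarith [hη n hn])
  have hθe : ∀ n ≤ Nt, N (θ n) ≤ N (u n - U n) + D * ε := by
    intro n hn
    exact (map_sub_le_add N _ _).trans (by linarith [hη n hn])
  -- With the corrector subtracted, the residual `η - L η` leaves only `η` and its time differences.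
  have one_step : ∀ n, n + 2 ≤ Nt → N (u (n + 1) - U (n + 1)) ≤ 1 →
      N (θ (n + 2)) ≤ N (θ n) + τ * (C1 * (N (θ (n + 1)) + N (θ (n + 2)) + N (θ n)) + C2 * ε) := by
    intro n hn hb
    set G := u (n + 1) * star (u (n + 1)) * (u (n + 2) + u n)
      - U (n + 1) * star (U (n + 1)) * (U (n + 2) + U n) with hG
    have hGle : N G ≤ C1 * (N (u (n + 1) - U (n + 1)) + N (u (n + 2) - U (n + 2))
        + N (u n - U n)) := by
      have := cubic_difference_le (ep := u (n + 2) - U (n + 2)) (em := u n - U n) hK hR hmul hstar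
        (hNu (n + 1) (by omega)) (hNu (n + 2) hn) (hNu n (by omega)) hb
      simpa only [sub_sub_cancel, hG] using this
    set F := Complex.I • G + Complex.I • (η (n + 2) + η n) + ρ n
      - ((1 / τ : ℝ) : ℂ) • (η (n + 2) - η n) with hF
    have heq : θ (n + 2) - θ n = (τ : ℂ) • (Complex.I • L (θ (n + 2) + θ n) + F) := by
      have hτc : (τ : ℂ) • ((1 / τ : ℝ) : ℂ) • (η (n + 2) - η n) = η (n + 2) - η n := by
        rw [smul_smul, ← Complex.ofReal_mul, mul_one_div_cancel hτ.ne', Complex.ofReal_one, one_smul]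
      have e1 : θ (n + 2) - θ n = (u (n + 2) - u n) - (U (n + 2) - U n) - (η (n + 2) - η n) := by
        simp only [hθ]; abel
      have e2 : L (θ (n + 2) + θ n) = L (u (n + 2) + u n) - L (U (n + 2) + U n)
          - L (η (n + 2) + η n) := by
        simp only [hθ, ← map_sub]; congr 1; abel
      rw [e1, e2, hu n hn, hU n hn]
      nth_rw 1 [← hτc]
      rw [← smul_sub, ← smul_sub, hF, hG]
      congr 1
      simp only [smul_sub]
      abel
    have hstep' := hstep τ _ _ F hτ.le heq
    have hFle : N F ≤ N G + 4 * D * ε := by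
      have m1 : N (Complex.I • G) = N G := by rw [map_smul_eq_mul]; simp
      have m2 : N (Complex.I • (η (n + 2) + η n)) ≤ 2 * D * ε := by
        rw [map_smul_eq_mul]
        simp only [Complex.norm_I, one_mul]
        exact (map_add_le_add N _ _).trans (by linarith [hη n (by omega), hη (n + 2) hn])
      have m3 : N (((1 / τ : ℝ) : ℂ) • (η (n + 2) - η n)) ≤ D * ε := by
        rw [map_smul_eq_mul, Complex.norm_real, Real.norm_eq_abs, abs_of_pos (by positivity)]
        calc 1 / τ * N (η (n + 2) - η n) ≤ 1 / τ * (D * τ * ε) := by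
              gcongr; exact hdη n hn
          _ = D * ε := by field_simp
      have t1 := map_sub_le_add N (Complex.I • G + Complex.I • (η (n + 2) + η n) + ρ n)
        (((1 / τ : ℝ) : ℂ) • (η (n + 2) - η n))
      have t2 := map_add_le_add N (Complex.I • G + Complex.I • (η (n + 2) + η n)) (ρ n)
      have t3 := map_add_le_add N (Complex.I • G) (Complex.I • (η (n + 2) + η n))
      have := hρ n hn
      rw [hF]
      linarith
    have a1 := heθ (n + 1) (by omega)
    have a2 := heθ (n + 2) hn
    have a3 := heθ n (by omega)
    have hG2 : N G ≤ C1 * (N (θ (n + 1)) + N (θ (n + 2)) + N (θ n)) + 3 * C1 * D * ε := by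
      refine hGle.trans ?_
      have := mul_le_mul_of_nonneg_left (add_le_add (add_le_add a1 a2) a3) hC1'
      linarith
    refine hstep'.trans ?_
    gcongr
    rw [hC2]
    linarith
  -- The bound at the previous level keeps the error below one, as `one_step` requires.
  have main : ∀ n, n + 1 ≤ Nt → N (θ (n + 1)) + N (θ n) + C2 * ε
      ≤ (1 + τ * lam) ^ n * ((4 * D + C2) * ε) := by
    intro n
    induction n with
    | zero =>
      intro hn
      have a1 := hθe 0 (by omega)
      have a2 := hθe 1 hn
      simp only [pow_zero, one_mul, zero_add]
      linarith
    | succ n ih =>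
      intro hn
      have ih' := ih (by omega)
      have hgrow := one_add_mul_pow_le_exp hτ.le hlam'.le (by omega : n ≤ Nt) hT
      have hb : N (u (n + 1) - U (n + 1)) ≤ 1 := by
        have a1 := heθ (n + 1) (by omega)
        have a2 := n0 (θ n)
        have a3 : (1 + τ * lam) ^ n * ((4 * D + C2) * ε)
            ≤ Real.exp (lam * T) * ((4 * D + C2) * ε) := by gcongr
        have a4 : C * ε = Real.exp (lam * T) * ((4 * D + C2) * ε) + D * ε + ε := by
          rw [hC]; ring
        have a5 : 0 ≤ C2 * ε := by positivity
        linarith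
      have hs := one_step n (by omega) hb
      set E2 := N (θ (n + 2))
      set E1 := N (θ (n + 1))
      set E0 := N (θ n)
      have p0 := n0 (θ n)
      have p1 := n0 (θ (n + 1))
      have p2 := n0 (θ (n + 2))
      have key := three_level_step (x := τ * C1) (q := τ * (C2 * ε)) (by positivity) hτC
        (by positivity) p0 p1 (by linarith)
      have key3 : E2 + E1 + C2 * ε ≤ (1 + τ * lam) * (E1 + E0 + C2 * ε) := by
        have q1 : 0 ≤ τ * (E1 + E0) := mul_nonneg hτ.le (by linarith)
        have q2 : 0 ≤ τ * (C1 * (C2 * ε)) := by positivity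
        rw [hlam]
        linarith
      calc E2 + E1 + C2 * ε ≤ (1 + τ * lam) * (E1 + E0 + C2 * ε) := key3
        _ ≤ (1 + τ * lam) * ((1 + τ * lam) ^ n * ((4 * D + C2) * ε)) := by gcongr
        _ = (1 + τ * lam) ^ (n + 1) * ((4 * D + C2) * ε) := by ring
  intro n hn
  rcases Nat.eq_zero_or_pos n with rfl | hpos
  · refine he0.trans ?_
    gcongr
    rw [hC]
    have : 0 ≤ Real.exp (lam * T) * (4 * D + C2) := by positivity
    linarith
  · obtain ⟨k, rfl⟩ := Nat.exists_eq_add_of_lt hpos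
    simp only [zero_add] at hn ⊢
    have h1 := main k hn
    have h2 := heθ (k + 1) hn
    have h3 := n0 (θ k)
    have hgrow := one_add_mul_pow_le_exp hτ.le hlam'.le (by omega : k ≤ Nt) hT
    have h4 : (1 + τ * lam) ^ k * ((4 * D + C2) * ε)
        ≤ Real.exp (lam * T) * ((4 * D + C2) * ε) := by gcongr
    have h5 : 0 ≤ C2 * ε := by positivity
    have h6 : C * ε = Real.exp (lam * T) * ((4 * D + C2) * ε) + D * ε + ε := by
      rw [hC]; ring
    linarith

end Stability

/-! ### The Riesz derivative as a Fourier multiplier -/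

open MeasureTheory Filter Topology

lemma integrableOn_rpow_mul_exp {s b : ℝ} (hs : -1 < s) (hb : 0 < b) :
    IntegrableOn (fun t : ℝ => t ^ s * Real.exp (-(b * t))) (Ioi 0) := by
  have := integrableOn_rpow_mul_exp_neg_mul_rpow hs one_pos hb
  simpa only [Real.rpow_one, neg_mul] using this

/-- The Gamma integral with a complex rate, by analytic continuation from real rates. -/
lemma integral_rpow_mul_cexp {β : ℝ} (hβ : 0 < β) {r : ℂ} (hr : 0 < r.re) :
    ∫ t : ℝ in Ioi 0, ((t ^ (β - 1) : ℝ) : ℂ) * Complex.exp (-(r * t))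
      = Real.Gamma β * r ^ (-(β : ℂ)) := by
  set U : Set ℂ := {z | 0 < z.re} with hU
  have hUo : IsOpen U := isOpen_lt continuous_const Complex.continuous_re
  have hUc : IsPreconnected U := (convex_halfSpace_re_gt 0).isPreconnected
  have hnorm : ∀ (z : ℂ) (s t : ℝ), 0 < t →
      ‖((t ^ s : ℝ) : ℂ) * Complex.exp (-(z * t))‖ = t ^ s * Real.exp (-(z.re * t)) := by
    intro z s t ht
    rw [norm_mul, Complex.norm_real, Real.norm_eq_abs, abs_of_nonneg (Real.rpow_nonneg ht.le _),
      Complex.norm_exp]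
    simp
  have hmeas : ∀ (z : ℂ) (s : ℝ), AEStronglyMeasurable
      (fun t : ℝ => ((t ^ s : ℝ) : ℂ) * Complex.exp (-(z * t))) (volume.restrict (Ioi 0)) := by
    intro z s
    refine ContinuousOn.aestronglyMeasurable ?_ measurableSet_Ioi
    refine ContinuousOn.mul (Complex.continuous_ofReal.comp_continuousOn
      (continuousOn_id.rpow_const fun t ht => Or.inl (ne_of_gt ht))) (by fun_prop)
  have hint : ∀ (z : ℂ) (s : ℝ), -1 < s → 0 < z.re → IntegrableOn
      (fun t : ℝ => ((t ^ s : ℝ) : ℂ) * Complex.exp (-(z * t))) (Ioi 0) := by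
    intro z s hs hz
    refine (integrableOn_rpow_mul_exp hs hz).mono' (hmeas z s) ?_
    filter_upwards [ae_restrict_mem measurableSet_Ioi] with t ht
    exact (hnorm z s t ht).le
  have hdiff : DifferentiableOn ℂ
      (fun z : ℂ => ∫ t : ℝ in Ioi 0, ((t ^ (β - 1) : ℝ) : ℂ) * Complex.exp (-(z * t))) U := by
    intro z hz
    have hz' : 0 < z.re / 2 := half_pos hz
    have := (hasDerivAt_integral_of_dominated_loc_of_deriv_le (𝕜 := ℂ)
      (μ := volume.restrict (Ioi (0 : ℝ)))
      (F := fun (z : ℂ) (t : ℝ) => ((t ^ (β - 1) : ℝ) : ℂ) * Complex.exp (-(z * t)))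
      (F' := fun (z : ℂ) (t : ℝ) => -(((t ^ β : ℝ) : ℂ) * Complex.exp (-(z * t))))
      (x₀ := z) (s := {w | z.re / 2 < w.re})
      (bound := fun t => t ^ β * Real.exp (-(z.re / 2 * t)))
      ((isOpen_lt continuous_const Complex.continuous_re).mem_nhds (show z.re / 2 < z.re from half_lt_self hz))
      (Eventually.of_forall fun w => hmeas w _) (hint z _ (by linarith) hz)
      (hmeas z _).neg ?_ (integrableOn_rpow_mul_exp (by linarith) hz') ?_).2
    · exact this.differentiableAt.differentiableWithinAt
    · filter_upwards [ae_restrict_mem measurableSet_Ioi] with t ht w hw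
      rw [norm_neg, hnorm w β t ht]
      have ht' : (0 : ℝ) < t := ht
      have hw' : z.re / 2 < w.re := hw
      gcongr
    · filter_upwards [ae_restrict_mem measurableSet_Ioi] with t ht w hw
      have hlin : HasDerivAt (fun w : ℂ => -(w * t)) (-(t : ℂ)) w := by
        exact (((hasDerivAt_id' w).mul_const (t : ℂ)).neg).congr_deriv (by simp)
      refine (hlin.cexp.const_mul _).congr_deriv ?_
      have ht' : (0 : ℝ) < t := ht
      have : ((t ^ β : ℝ) : ℂ) = ((t ^ (β - 1) : ℝ) : ℂ) * t := by
        rw [← Complex.ofReal_mul, ← Real.rpow_add_one ht'.ne']; ring_nf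
      rw [this]; ring
  have hdiff2 : DifferentiableOn ℂ (fun z : ℂ => (Real.Gamma β : ℂ) * z ^ (-(β : ℂ))) U := by
    intro z hz
    refine (DifferentiableAt.const_mul ?_ _).differentiableWithinAt
    exact (differentiableAt_id).cpow_const (Or.inl hz)
  refine (hdiff.analyticOnNhd hUo).eqOn_of_preconnected_of_frequently_eq
    (hdiff2.analyticOnNhd hUo) hUc (z₀ := 1) (by simp [hU]) ?_ hr
  have hreal : ∀ x : ℝ, 0 < x →
      ∫ t : ℝ in Ioi 0, ((t ^ (β - 1) : ℝ) : ℂ) * Complex.exp (-((x : ℂ) * t))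
        = (Real.Gamma β : ℂ) * (x : ℂ) ^ (-(β : ℂ)) := by
    intro x hx
    have h := Complex.integral_cpow_mul_exp_neg_mul_Ioi (a := β) (r := x) (by simpa using hβ) hx
    rw [Complex.Gamma_ofReal] at h
    have e : ((1 / x : ℂ)) ^ (β : ℂ) = (x : ℂ) ^ (-(β : ℂ)) := by
      rw [one_div, Complex.inv_cpow _ _ (by rw [Complex.arg_ofReal_of_nonneg hx.le]; exact Real.pi_pos.ne),
        Complex.cpow_neg]
    rw [e, mul_comm] at h
    rw [← h]
    refine setIntegral_congr_fun measurableSet_Ioi fun t ht => ?_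
    have ht' : (0 : ℝ) < t := ht
    rw [Complex.ofReal_cpow ht'.le]
    push_cast
    rfl
  have htend : Tendsto (fun n : ℕ => ((1 + 1 / ((n : ℝ) + 1) : ℝ) : ℂ)) atTop (𝓝[≠] 1) := by
    refine tendsto_nhdsWithin_iff.2 ⟨?_, Eventually.of_forall fun n => ?_⟩
    · have := (tendsto_one_div_add_atTop_nhds_zero_nat (𝕜 := ℝ)).const_add 1
      rw [add_zero] at this
      have h2 := (Complex.continuous_ofReal.tendsto 1).comp this
      rwa [Complex.ofReal_one] at h2
    · have : (0 : ℝ) < 1 / ((n : ℝ) + 1) := by positivity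
      intro h
      rw [mem_singleton_iff, ← Complex.ofReal_one, Complex.ofReal_inj] at h
      linarith
  exact htend.frequently (Frequently.of_forall fun n => hreal _ (by positivity))

/-- The frequency weights that occur below. -/
lemma integrable_weight {p : ℝ} (hp : -1 < p) (hp4 : p ≤ 4) :
    Integrable fun k : ℝ => |2 * Real.pi * k| ^ p / (1 + |2 * Real.pi * k| ^ 6) := by
  suffices h : Integrable fun y : ℝ => |y| ^ p / (1 + |y| ^ 6) by
    exact h.comp_mul_left' (R := 2 * Real.pi) (by positivity)
  have hpos : IntegrableOn (fun y : ℝ => |y| ^ p / (1 + |y| ^ 6)) (Ioi 0) := by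
    rw [← Ioc_union_Ioi_eq_Ioi (zero_le_one (α := ℝ))]
    have hmeas : ∀ S : Set ℝ, AEStronglyMeasurable (fun y : ℝ => |y| ^ p / (1 + |y| ^ 6))
        (volume.restrict S) := fun S => by
      refine Measurable.aestronglyMeasurable ?_
      fun_prop
    refine IntegrableOn.union ?_ ?_
    · have h1 : IntegrableOn (fun y : ℝ => y ^ p) (Ioc 0 1) :=
        (intervalIntegrable_iff_integrableOn_Ioc_of_le zero_le_one).1
          (intervalIntegral.intervalIntegrable_rpow' hp)
      refine h1.mono' (hmeas _) ?_
      filter_upwards [ae_restrict_mem measurableSet_Ioc] with y hy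
      rw [abs_of_pos hy.1, Real.norm_of_nonneg (by have := hy.1; positivity)]
      exact div_le_self (Real.rpow_nonneg hy.1.le _) (by have := hy.1; linarith [pow_pos this 6])
    · have h1 : IntegrableOn (fun y : ℝ => y ^ (-2 : ℝ)) (Ioi 1) :=
        integrableOn_Ioi_rpow_of_lt (by norm_num) one_pos
      refine h1.mono' (hmeas _) ?_
      filter_upwards [ae_restrict_mem measurableSet_Ioi] with y hy
      have hy1 : (1 : ℝ) < y := hy
      have hy0 : 0 < y := by linarith
      rw [abs_of_pos hy0, Real.norm_of_nonneg (by positivity), div_le_iff₀ (by positivity)]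
      calc y ^ p ≤ y ^ (4 : ℝ) := Real.rpow_le_rpow_of_exponent_le hy1.le hp4
        _ = y ^ (-2 : ℝ) * y ^ (6 : ℝ) := by rw [← Real.rpow_add hy0]; norm_num
        _ = y ^ (-2 : ℝ) * y ^ 6 := by norm_cast
        _ ≤ y ^ (-2 : ℝ) * (1 + y ^ 6) := by gcongr; linarith
  have hneg : IntegrableOn (fun y : ℝ => |y| ^ p / (1 + |y| ^ 6)) (Iic 0) := by
    rw [← Measure.map_neg_eq_self (volume : Measure ℝ)]
    have m : MeasurableEmbedding fun x : ℝ => -x := (Homeomorph.neg ℝ).measurableEmbedding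
    rw [m.integrableOn_map_iff]
    simp_rw [Function.comp_def, abs_neg, neg_preimage, neg_Iic, neg_zero]
    exact Iff.mpr integrableOn_Ici_iff_integrableOn_Ioi hpos
  rw [← integrableOn_univ, ← Iic_union_Ioi (a := (0 : ℝ))]
  exact hneg.union hpos

open scoped FourierTransform

/-- `e k x = exp (-2 π i k x)`, the kernel of the Fourier transform. -/
def kern (k x : ℝ) : ℂ := Complex.exp (((-2 * Real.pi * k * x : ℝ) : ℂ) * Complex.I)

lemma norm_kern (k x : ℝ) : ‖kern k x‖ = 1 := by
  unfold kern; rw [Complex.norm_exp_ofReal_mul_I]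

lemma fourier_eq_kern (g : ℝ → ℂ) (x : ℝ) : 𝓕 g x = ∫ k, kern k x * g k := by
  rw [Real.fourier_real_eq_integral_exp_smul]
  rfl

/-- A pair of a function `f` of bounded support and its inverse Fourier transform `φ`, which decays
as for six derivatives. -/
structure FourierPair (f φ : ℝ → ℂ) (Q : ℝ) : Prop where
  cont : Continuous f
  bdd_supp : ∃ M R : ℝ, ∀ x, ‖f x‖ ≤ M ∧ (R < |x| → f x = 0)
  cont_freq : Continuous φ
  decay : ∀ k, ‖φ k‖ ≤ Q / (1 + |2 * Real.pi * k| ^ 6)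
  eq_fourier : f = 𝓕 φ

namespace FourierPair
variable {f φ : ℝ → ℂ} {Q : ℝ} (hf : FourierPair f φ Q)
include hf

lemma nonneg : 0 ≤ Q := by
  have := (norm_nonneg _).trans (hf.decay 0)
  simpa using this

lemma integrable_mul {w : ℝ → ℂ} (hw : AEStronglyMeasurable w) {p C : ℝ} (hp : -1 < p) (hp4 : p ≤ 4)
    (hwb : ∀ k, k ≠ 0 → ‖w k‖ ≤ C * |2 * Real.pi * k| ^ p) :
    Integrable fun k => φ k * w k := by
  refine ((integrable_weight hp hp4).const_mul (Q * C)).mono'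
    (hf.cont_freq.aestronglyMeasurable.mul hw) ?_
  have h0 : ∀ᵐ k : ℝ, k ≠ 0 := by simp [ae_iff, measure_singleton]
  filter_upwards [h0] with k hk
  rw [norm_mul]
  calc ‖φ k‖ * ‖w k‖ ≤ (Q / (1 + |2 * Real.pi * k| ^ 6)) * (C * |2 * Real.pi * k| ^ p) := by
        gcongr
        · exact div_nonneg hf.nonneg (by positivity)
        · exact hf.decay k
        · exact hwb k hk
    _ = _ := by ring

lemma integrable : Integrable φ := by
  have := hf.integrable_mul (w := fun _ => 1) aestronglyMeasurable_const (p := 0) (C := 1)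
    (by norm_num) (by norm_num) (fun k _ => by simp)
  simpa using this

lemma eq_integral (x : ℝ) : f x = ∫ k, kern k x * φ k := by
  rw [← fourier_eq_kern, ← hf.eq_fourier]

end FourierPair

namespace FourierPair
variable {f φ : ℝ → ℂ} {Q : ℝ} (hf : FourierPair f φ Q)
include hf

/-- One-sided Riesz potential with an exponential cut-off: Fubini and the Gamma integral. -/
lemma integral_cutoff {β : ℝ} (hβ : 0 < β) {ε : ℝ} (hε : 0 < ε) (σ z : ℝ) :
    ∫ s in Ioi (0 : ℝ), ((s ^ (β - 1) * Real.exp (-(ε * s)) : ℝ) : ℂ) * f (z - σ * s)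
      = Real.Gamma β * ∫ k, kern k z *
          (φ k * ((ε : ℂ) - ((2 * Real.pi * (σ * k) : ℝ) : ℂ) * Complex.I) ^ (-(β : ℂ))) := by
  set G : ℝ → ℝ → ℂ := fun s k =>
    ((s ^ (β - 1) * Real.exp (-(ε * s)) : ℝ) : ℂ) * (kern k (z - σ * s) * φ k) with hG
  have hint : Integrable (Function.uncurry G) ((volume.restrict (Ioi (0 : ℝ))).prod volume) := by
    have h1 := (integrableOn_rpow_mul_exp (s := β - 1) (by linarith) hε).ofReal (𝕜 := ℂ)
    have h2 := h1.mul_prod hf.integrable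
    have hc : Continuous fun p : ℝ × ℝ => kern p.2 (z - σ * p.1) := by unfold kern; fun_prop
    have h3 := h2.bdd_mul (c := 1) hc.aestronglyMeasurable
      (Eventually.of_forall fun p => (norm_kern _ _).le)
    refine h3.congr (Eventually.of_forall fun p => ?_)
    simp only [hG, Function.uncurry]
    simp only [RCLike.ofReal_mul, Complex.ofReal_mul, Complex.coe_algebraMap]
    ring_nf
  have e1 : ∫ s in Ioi (0 : ℝ), ((s ^ (β - 1) * Real.exp (-(ε * s)) : ℝ) : ℂ) * f (z - σ * s)
      = ∫ s in Ioi (0 : ℝ), ∫ k, G s k := by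
    refine setIntegral_congr_fun measurableSet_Ioi fun s _ => ?_
    simp only [hG]
    rw [integral_const_mul, ← hf.eq_integral]
  rw [e1, integral_integral_swap hint, ← integral_const_mul]
  congr 1; ext k
  have hr : 0 < ((ε : ℂ) - ((2 * Real.pi * (σ * k) : ℝ) : ℂ) * Complex.I).re := by simpa using hε
  have h := integral_rpow_mul_cexp hβ hr
  calc ∫ s in Ioi (0 : ℝ), G s k
      = ∫ s in Ioi (0 : ℝ), (kern k z * φ k) * (((s ^ (β - 1) : ℝ) : ℂ)
          * Complex.exp (-(((ε : ℂ) - ((2 * Real.pi * (σ * k) : ℝ) : ℂ) * Complex.I) * s))) := by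
        refine setIntegral_congr_fun measurableSet_Ioi fun s _ => ?_
        simp only [hG, kern]
        rw [Complex.ofReal_mul, Complex.ofReal_exp]
        have e2 : Complex.exp (((-2 * Real.pi * k * (z - σ * s) : ℝ) : ℂ) * Complex.I)
            * Complex.exp (((-(ε * s) : ℝ) : ℂ))
            = Complex.exp (((-2 * Real.pi * k * z : ℝ) : ℂ) * Complex.I)
            * Complex.exp (-(((ε : ℂ) - ((2 * Real.pi * (σ * k) : ℝ) : ℂ) * Complex.I) * s)) := by
          rw [← Complex.exp_add, ← Complex.exp_add]
          congr 1
          push_cast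
          ring
        linear_combination (((s ^ (β - 1) : ℝ) : ℂ) * φ k) * e2
    _ = _ := by
        rw [integral_const_mul, h]; ring

/-- One-sided Riesz potential of order `β` as a Fourier multiplier; the cut-off is removed by
dominated convergence on both sides. -/
lemma integral_riesz_potential {β : ℝ} (hβ : 0 < β) (hβ1 : β < 1) {σ : ℝ} (hσ : |σ| = 1) (z : ℝ) :
    ∫ s in Ioi (0 : ℝ), ((s ^ (β - 1) : ℝ) : ℂ) * f (z - σ * s)
      = Real.Gamma β * ∫ k, kern k z *
          (φ k * (-((2 * Real.pi * (σ * k) : ℝ) : ℂ) * Complex.I) ^ (-(β : ℂ))) := by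
  obtain ⟨M, R, hMR⟩ := hf.bdd_supp
  have hM : 0 ≤ M := (norm_nonneg _).trans (hMR 0).1
  have habs : ∀ k : ℝ, |2 * Real.pi * (σ * k)| = |2 * Real.pi * k| := fun k => by
    rw [abs_mul, abs_mul σ, hσ, one_mul, ← abs_mul]
  set ε : ℕ → ℝ := fun n => 1 / ((n : ℝ) + 1) with hε
  have hε0 : ∀ n, 0 < ε n := fun n => by positivity
  have hεt : Tendsto ε atTop (𝓝 0) := tendsto_one_div_add_atTop_nhds_zero_nat
  have hL : Tendsto (fun n => ∫ s in Ioi (0 : ℝ),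
      ((s ^ (β - 1) * Real.exp (-(ε n * s)) : ℝ) : ℂ) * f (z - σ * s)) atTop
      (𝓝 (∫ s in Ioi (0 : ℝ), ((s ^ (β - 1) : ℝ) : ℂ) * f (z - σ * s))) := by
    have hfc : Continuous fun s : ℝ => f (z - σ * s) := hf.cont.comp (by fun_prop)
    refine tendsto_integral_of_dominated_convergence
      (fun s => M * Real.exp (R + |z|) * (s ^ (β - 1) * Real.exp (-(1 * s)))) (fun n => ?_)
      ((integrableOn_rpow_mul_exp (by linarith) one_pos).const_mul _) (fun n => ?_) ?_
    · refine ContinuousOn.aestronglyMeasurable ?_ measurableSet_Ioi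
      refine ContinuousOn.mul (Complex.continuous_ofReal.comp_continuousOn
        (ContinuousOn.mul (continuousOn_id.rpow_const fun t ht => Or.inl (ne_of_gt ht))
          (by fun_prop))) hfc.continuousOn
    · filter_upwards [ae_restrict_mem measurableSet_Ioi] with s hs
      have hs0 : (0 : ℝ) < s := hs
      have hp : 0 ≤ s ^ (β - 1) := Real.rpow_nonneg hs0.le _
      rw [norm_mul, Complex.norm_real, Real.norm_of_nonneg (by positivity)]
      have hexp : Real.exp (-(ε n * s)) ≤ 1 := by
        rw [Real.exp_le_one_iff]
        have := mul_pos (hε0 n) hs0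
        linarith
      have hfb : ‖f (z - σ * s)‖ ≤ M * Real.exp (R + |z|) * Real.exp (-(1 * s)) := by
        by_cases hR : R < |z - σ * s|
        · rw [(hMR _).2 hR, norm_zero]; positivity
        · push Not at hR
          have h1 : s ≤ R + |z| := by
            have : |σ * s| ≤ |z| + |z - σ * s| := by
              have := abs_sub_abs_le_abs_sub (σ * s) z
              rw [abs_sub_comm] at this
              linarith
            rw [abs_mul, hσ, one_mul, abs_of_pos hs0] at this
            linarith
          have h2 : 1 ≤ Real.exp (R + |z|) * Real.exp (-(1 * s)) := by
            rw [← Real.exp_add]; exact Real.one_le_exp (by linarith)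
          calc ‖f (z - σ * s)‖ ≤ M * 1 := by rw [mul_one]; exact (hMR _).1
            _ ≤ M * (Real.exp (R + |z|) * Real.exp (-(1 * s))) := by gcongr
            _ = _ := by ring
      calc s ^ (β - 1) * Real.exp (-(ε n * s)) * ‖f (z - σ * s)‖
          ≤ s ^ (β - 1) * 1 * (M * Real.exp (R + |z|) * Real.exp (-(1 * s))) := by gcongr
        _ = _ := by ring
    · refine Eventually.of_forall fun s => ?_
      refine Tendsto.mul_const _ ?_
      refine (Complex.continuous_ofReal.tendsto _).comp ?_
      have h1 : Tendsto (fun n => Real.exp (-(ε n * s))) atTop (𝓝 1) := by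
        have : Tendsto (fun n => -(ε n * s)) atTop (𝓝 0) := by
          simpa using (hεt.mul_const s).neg
        have h2 := (Real.continuous_exp.tendsto 0).comp this
        rwa [Real.exp_zero] at h2
      simpa using h1.const_mul (s ^ (β - 1))
  have hRt : Tendsto (fun n => ∫ k, kern k z *
          (φ k * ((ε n : ℂ) - ((2 * Real.pi * (σ * k) : ℝ) : ℂ) * Complex.I) ^ (-(β : ℂ)))) atTop
      (𝓝 (∫ k, kern k z *
          (φ k * (-((2 * Real.pi * (σ * k) : ℝ) : ℂ) * Complex.I) ^ (-(β : ℂ))))) := by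
    have hkc : Continuous fun k => kern k z := by unfold kern; fun_prop
    have h0 : ∀ᵐ k : ℝ, k ≠ 0 := by simp [ae_iff, measure_singleton]
    have hσ0 : σ ≠ 0 := by rintro rfl; simp at hσ
    refine tendsto_integral_of_dominated_convergence
      (fun k => Q * (|2 * Real.pi * k| ^ (-β) / (1 + |2 * Real.pi * k| ^ 6))) (fun n => ?_)
      ((integrable_weight (by linarith) (by linarith)).const_mul _) (fun n => ?_) ?_
    · have : Measurable fun k : ℝ =>
          ((ε n : ℂ) - ((2 * Real.pi * (σ * k) : ℝ) : ℂ) * Complex.I) ^ (-(β : ℂ)) := by fun_prop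
      exact hkc.aestronglyMeasurable.mul
        (hf.cont_freq.aestronglyMeasurable.mul this.aestronglyMeasurable)
    · filter_upwards [h0] with k hk
      rw [norm_mul, norm_kern, one_mul, norm_mul]
      have hpos : 0 < |2 * Real.pi * k| := abs_pos.2 (by have := Real.pi_ne_zero; positivity)
      have hn : ‖((ε n : ℂ) - ((2 * Real.pi * (σ * k) : ℝ) : ℂ) * Complex.I) ^ (-(β : ℂ))‖
          ≤ |2 * Real.pi * k| ^ (-β) := by
        rw [← Complex.ofReal_neg, Complex.norm_cpow_real]
        refine Real.rpow_le_rpow_of_nonpos hpos ?_ (by linarith)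
        refine le_trans (le_of_eq ?_) (Complex.abs_im_le_norm _)
        simp [← habs k]
      calc _ ≤ (Q / (1 + |2 * Real.pi * k| ^ 6)) * |2 * Real.pi * k| ^ (-β) := by
            gcongr
            · exact div_nonneg hf.nonneg (by positivity)
            · exact hf.decay k
        _ = _ := by ring
    · filter_upwards [h0] with k hk
      refine Tendsto.const_mul _ (Tendsto.const_mul _ ?_)
      have hslit : (0 : ℂ) - ((2 * Real.pi * (σ * k) : ℝ) : ℂ) * Complex.I ∈ Complex.slitPlane := by
        right
        have := Real.pi_ne_zero
        simp [hσ0, hk, this]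
      have hcont := (continuousAt_cpow_const (b := -(β : ℂ)) hslit).tendsto
      have htend : Tendsto (fun n => (ε n : ℂ) - ((2 * Real.pi * (σ * k) : ℝ) : ℂ) * Complex.I) atTop
          (𝓝 ((0 : ℂ) - ((2 * Real.pi * (σ * k) : ℝ) : ℂ) * Complex.I)) := by
        refine Tendsto.sub_const ?_ _
        have := (Complex.continuous_ofReal.tendsto 0).comp hεt
        rwa [Complex.ofReal_zero] at this
      have := hcont.comp htend
      rw [zero_sub, ← neg_mul] at this
      exact this
  have heq : ∀ n, ∫ s in Ioi (0 : ℝ),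
      ((s ^ (β - 1) * Real.exp (-(ε n * s)) : ℝ) : ℂ) * f (z - σ * s)
      = Real.Gamma β * ∫ k, kern k z *
          (φ k * ((ε n : ℂ) - ((2 * Real.pi * (σ * k) : ℝ) : ℂ) * Complex.I) ^ (-(β : ℂ))) :=
    fun n => hf.integral_cutoff hβ (hε0 n) σ z
  simp_rw [heq] at hL
  exact tendsto_nhds_unique hL (hRt.const_mul _)

end FourierPair

/-- The multiplier of the one-sided Riesz potential of order `β`, on the side `σ = ± 1`. -/
def halfMult (β σ k : ℝ) : ℂ := (-((2 * Real.pi * (σ * k) : ℝ) : ℂ) * Complex.I) ^ (-(β : ℂ))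

lemma norm_halfMult {β σ : ℝ} (hσ : |σ| = 1) (k : ℝ) :
    ‖halfMult β σ k‖ = |2 * Real.pi * k| ^ (-β) := by
  unfold halfMult
  rw [← Complex.ofReal_neg β, Complex.norm_cpow_real, norm_mul, Complex.norm_I, mul_one, norm_neg,
    Complex.norm_real, Real.norm_eq_abs, abs_mul, abs_mul σ, hσ, one_mul, ← abs_mul]

lemma measurable_halfMult (β σ : ℝ) : Measurable (halfMult β σ) := by
  unfold halfMult; fun_prop

/-- The multipliers of both sides add up to a real one; this produces the cosine in the definition of
the Riesz derivative. -/
lemma halfMult_add {β k : ℝ} (hk : k ≠ 0) : halfMult β 1 k + halfMult β (-1) k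
    = ((2 * Real.cos (Real.pi * β / 2) * |2 * Real.pi * k| ^ (-β) : ℝ) : ℂ) := by
  have key : ∀ w : ℝ, 0 < w →
      (-(w : ℂ) * Complex.I) ^ (-(β : ℂ)) + (-((-w : ℝ) : ℂ) * Complex.I) ^ (-(β : ℂ))
      = ((2 * Real.cos (Real.pi * β / 2) * w ^ (-β) : ℝ) : ℂ) := by
    intro w hw
    have hw0 : (w : ℂ) ≠ 0 := Complex.ofReal_ne_zero.2 hw.ne'
    have e1 : (-(w : ℂ) * Complex.I) = (w : ℂ) * (-Complex.I) := by ring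
    have e2 : (-((-w : ℝ) : ℂ) * Complex.I) = (w : ℂ) * Complex.I := by push_cast; ring
    have hI : -Complex.I ≠ 0 := neg_ne_zero.2 Complex.I_ne_zero
    rw [e1, e2, Complex.cpow_def_of_ne_zero (mul_ne_zero hw0 hI),
      Complex.cpow_def_of_ne_zero (mul_ne_zero hw0 Complex.I_ne_zero),
      Complex.log_ofReal_mul hw hI, Complex.log_ofReal_mul hw Complex.I_ne_zero,
      Complex.log_neg_I, Complex.log_I, Real.rpow_def_of_pos hw, Complex.ofReal_mul,
      Complex.ofReal_mul, Complex.ofReal_cos, Complex.ofReal_exp, Complex.ofReal_ofNat,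
      Complex.two_cos]
    rw [add_mul (Complex.exp _), ← Complex.exp_add, ← Complex.exp_add]
    congr 2 <;> (push_cast; ring)
  have hpi := Real.pi_pos
  unfold halfMult
  rcases lt_or_gt_of_ne hk with h | h
  · have h1 := key (2 * Real.pi * (-k)) (by have : 0 < -k := by linarith
                                            positivity)
    have e3 : |2 * Real.pi * k| = 2 * Real.pi * -k := by
      rw [abs_of_neg (by nlinarith)]; ring
    rw [e3, ← h1, add_comm]
    congr 4 <;> (push_cast; ring)
  · have h1 := key (2 * Real.pi * k) (by positivity)
    rw [abs_of_pos (by positivity : 0 < 2 * Real.pi * k), ← h1]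
    congr 4 <;> (push_cast; ring)

/-- `∂² ∫₀^∞ s^(1-α) f(· - σ s) ds` as a Fourier multiplier. -/
lemma FourierPair.iteratedDeriv_potential {f φ : ℝ → ℂ} {Q : ℝ} (hf : FourierPair f φ Q)
    {α : ℝ} (h1 : 1 < α) (h2 : α < 2) {σ : ℝ} (hσ : |σ| = 1) (x : ℝ) :
    iteratedDeriv 2 (fun z => ∫ s in Ioi (0 : ℝ), ((s ^ (2 - α - 1) : ℝ) : ℂ) * f (z - σ * s)) x
      = -Real.Gamma (2 - α) * ∫ k, kern k x *
          (((2 * Real.pi * k) ^ 2 : ℝ) * (φ k * halfMult (2 - α) σ k)) := by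
  have e1 : (fun z => ∫ s in Ioi (0 : ℝ), ((s ^ (2 - α - 1) : ℝ) : ℂ) * f (z - σ * s))
      = fun z => (Real.Gamma (2 - α) : ℂ) * 𝓕 (fun k => φ k * halfMult (2 - α) σ k) z := by
    funext z
    rw [hf.integral_riesz_potential (by linarith) (by linarith) hσ z, fourier_eq_kern]
    rfl
  have hmeas := (measurable_halfMult (2 - α) σ).aestronglyMeasurable (μ := volume)
  have hint : ∀ n : ℕ, (n : ℕ∞) ≤ 2 →
      Integrable fun k : ℝ => k ^ n • (φ k * halfMult (2 - α) σ k) := by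
    intro n hn
    have hn' : (n : ℝ) ≤ 2 := by exact_mod_cast hn
    have hn0 : (0 : ℝ) ≤ n := n.cast_nonneg
    have := hf.integrable_mul (w := fun k => (k : ℂ) ^ n * halfMult (2 - α) σ k)
      ((by fun_prop : Continuous fun k : ℝ => (k : ℂ) ^ n).aestronglyMeasurable.mul hmeas)
      (p := n - (2 - α)) (C := 1) (by linarith) (by linarith) (fun k hk => ?_)
    · refine this.congr (Eventually.of_forall fun k => ?_)
      simp only [Complex.real_smul, Complex.ofReal_pow]
      ring
    · rw [norm_mul, norm_halfMult hσ, norm_pow, Complex.norm_real, Real.norm_eq_abs, one_mul]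
      have hpi := Real.pi_pos
      have hpos : 0 < |2 * Real.pi * k| := abs_pos.2 (by positivity)
      rw [sub_eq_add_neg (n : ℝ), Real.rpow_add hpos, Real.rpow_natCast]
      refine mul_le_mul_of_nonneg_right (pow_le_pow_left₀ (abs_nonneg _) ?_ _) (by positivity)
      rw [abs_mul, abs_of_pos (by positivity : 0 < 2 * Real.pi)]
      have : 1 ≤ 2 * Real.pi := by linarith [Real.pi_gt_three]
      nlinarith [abs_nonneg k]
  have h3 := Real.iteratedDeriv_fourier (N := 2) (n := 2) hint le_rfl
  rw [e1, iteratedDeriv_const_mul_field, h3, fourier_eq_kern, neg_mul (Real.Gamma (2 - α) : ℂ),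
    ← mul_neg, ← integral_neg]
  congr 2; ext k
  have hI := Complex.I_sq
  simp only [smul_eq_mul]
  push_cast
  linear_combination (kern k x * (2 * Real.pi * k) ^ 2 * (φ k * halfMult (2 - α) σ k)) * hI

lemma integral_Iio_eq (g : ℝ → ℂ) (z : ℝ) :
    ∫ ξ in Iio z, g ξ = ∫ s in Ioi (0 : ℝ), g (z - s) := by
  rw [← integral_indicator measurableSet_Iio, ← integral_indicator measurableSet_Ioi,
    ← integral_sub_left_eq_self _ _ z]
  congr 1; ext s
  by_cases hs : 0 < s <;> simp [indicator, hs]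

lemma integral_Ioi_eq (g : ℝ → ℂ) (z : ℝ) :
    ∫ ξ in Ioi z, g ξ = ∫ s in Ioi (0 : ℝ), g (z + s) := by
  rw [← integral_indicator measurableSet_Ioi, ← integral_indicator measurableSet_Ioi,
    ← integral_add_left_eq_self _ z]
  congr 1; ext s
  by_cases hs : 0 < s <;> simp [indicator, hs]

/-- The Riesz derivative is the Fourier multiplier `-|2πk|^α`. -/
lemma FourierPair.riesz_eq {f φ : ℝ → ℂ} {Q : ℝ} (hf : FourierPair f φ Q)
    {α : ℝ} (h1 : 1 < α) (h2 : α < 2) (x : ℝ) :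
    riesz α f x = -∫ k, kern k x * (φ k * ((|2 * Real.pi * k| ^ α : ℝ) : ℂ)) := by
  have hdiv : ∀ s : ℝ, 0 < s → ∀ w : ℂ,
      w / ((s ^ (α - 1) : ℝ) : ℂ) = ((s ^ (2 - α - 1) : ℝ) : ℂ) * w := fun s hs w => by
    rw [show 2 - α - 1 = -(α - 1) by ring, Real.rpow_neg hs.le, Complex.ofReal_inv, div_eq_inv_mul]
  have eL : leftRL α f x = ((1 / Real.Gamma (2 - α) : ℝ) : ℂ) * iteratedDeriv 2 (fun z =>
      ∫ s in Ioi (0 : ℝ), ((s ^ (2 - α - 1) : ℝ) : ℂ) * f (z - 1 * s)) x := by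
    unfold leftRL
    congr 2; ext z
    rw [integral_Iio_eq]
    refine setIntegral_congr_fun measurableSet_Ioi fun s hs => ?_
    simp only [sub_sub_cancel, one_mul]
    exact hdiv s hs _
  have eR : rightRL α f x = ((1 / Real.Gamma (2 - α) : ℝ) : ℂ) * iteratedDeriv 2 (fun z =>
      ∫ s in Ioi (0 : ℝ), ((s ^ (2 - α - 1) : ℝ) : ℂ) * f (z - (-1) * s)) x := by
    unfold rightRL
    congr 2; ext z
    rw [integral_Ioi_eq]
    refine setIntegral_congr_fun measurableSet_Ioi fun s hs => ?_
    simp only [add_sub_cancel_left, neg_mul, one_mul, sub_neg_eq_add]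
    exact hdiv s hs _
  have hint : ∀ σ : ℝ, |σ| = 1 → Integrable fun k => kern k x *
      (((2 * Real.pi * k) ^ 2 : ℝ) * (φ k * halfMult (2 - α) σ k)) := by
    intro σ hσ
    have := hf.integrable_mul
      (w := fun k => kern k x * ((((2 * Real.pi * k) ^ 2 : ℝ) : ℂ) * halfMult (2 - α) σ k))
      ((by unfold kern; fun_prop : Continuous fun k : ℝ => kern k x).aestronglyMeasurable.mul
      ((by fun_prop : Continuous fun k : ℝ =>
        (((2 * Real.pi * k) ^ 2 : ℝ) : ℂ)).aestronglyMeasurable.mul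
        (measurable_halfMult (2 - α) σ).aestronglyMeasurable))
      (p := α) (C := 1) (by linarith) (by linarith) (fun k hk => ?_)
    · refine this.congr (Eventually.of_forall fun k => ?_)
      ring
    · have hpi := Real.pi_pos
      have hpos : 0 < |2 * Real.pi * k| := abs_pos.2 (by positivity)
      rw [norm_mul, norm_kern, norm_mul, norm_halfMult hσ, Complex.norm_real, norm_pow,
        Real.norm_eq_abs, one_mul, one_mul, ← Real.rpow_natCast, ← Real.rpow_add hpos]
      refine le_of_eq ?_
      congr 1; push_cast; ring
  have hG : Real.Gamma (2 - α) ≠ 0 := (Real.Gamma_pos_of_pos (by linarith)).ne'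
  have hcos : Real.cos (α * Real.pi / 2) ≠ 0 := by
    refine (Real.cos_neg_of_pi_div_two_lt_of_lt ?_ ?_).ne <;> nlinarith [Real.pi_pos]
  have hsum : (∫ k, kern k x * (((2 * Real.pi * k) ^ 2 : ℝ) * (φ k * halfMult (2 - α) 1 k)))
      + (∫ k, kern k x * (((2 * Real.pi * k) ^ 2 : ℝ) * (φ k * halfMult (2 - α) (-1) k)))
      = ((-(2 * Real.cos (α * Real.pi / 2)) : ℝ) : ℂ)
        * ∫ k, kern k x * (φ k * ((|2 * Real.pi * k| ^ α : ℝ) : ℂ)) := by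
    rw [← integral_add (hint 1 (by simp)) (hint (-1) (by simp)), ← integral_const_mul]
    have h0 : ∀ᵐ k : ℝ, k ≠ 0 := by simp [ae_iff, measure_singleton]
    refine integral_congr_ae (h0.mono fun k hk => ?_)
    have h3 := halfMult_add (β := 2 - α) hk
    have hpi := Real.pi_pos
    have hpos : 0 < |2 * Real.pi * k| := abs_pos.2 (by positivity)
    have hc : Real.cos (Real.pi * (2 - α) / 2) = -Real.cos (α * Real.pi / 2) := by
      rw [← Real.cos_pi_sub]; congr 1; ring
    have hp : (2 * Real.pi * k) ^ 2 * |2 * Real.pi * k| ^ (-(2 - α)) = |2 * Real.pi * k| ^ α := by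
      rw [← sq_abs, ← Real.rpow_natCast, ← Real.rpow_add hpos]
      congr 1; push_cast; ring
    simp only
    rw [← hp]
    rw [hc] at h3
    push_cast at h3 ⊢
    linear_combination (kern k x * (2 * Real.pi * k) ^ 2 * φ k) * h3
  unfold riesz
  rw [if_neg h2.ne, eL, eR, hf.iteratedDeriv_potential h1 h2 (by simp),
    hf.iteratedDeriv_potential h1 h2 (by simp), ← mul_add, ← mul_add, hsum]
  have hG' : (Real.Gamma (2 - α) : ℂ) ≠ 0 := Complex.ofReal_ne_zero.2 hG
  have hcos' : (Real.cos (α * Real.pi / 2) : ℂ) ≠ 0 := Complex.ofReal_ne_zero.2 hcos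
  rw [Complex.ofReal_div, Complex.ofReal_div, Complex.ofReal_neg, Complex.ofReal_mul]
  field_simp
  simp

/-! ### Consistency of the fractional centered difference -/

/-- The symbols of the fractional difference and of the Riesz derivative agree to second order. -/
lemma abs_symbol_sub_le {α h : ℝ} (h1 : 1 < α) (h2 : α ≤ 2) (hh : 0 < h) (k : ℝ) :
    |(1 / h ^ α) * symbol α (k * h) - |2 * Real.pi * k| ^ α| ≤ h ^ 2 * |2 * Real.pi * k| ^ (α + 2) := by
  have hpi := Real.pi_pos
  have key : ∀ z : ℝ, 0 ≤ z → |(|Real.sin z|) ^ α - z ^ α| ≤ z ^ α * z ^ 2 := by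
    intro z hz
    have hle : |Real.sin z| ≤ z := by
      have := Real.abs_sin_le_abs (x := z)
      rwa [abs_of_nonneg hz] at this
    have hle' : |Real.sin z| ^ α ≤ z ^ α := Real.rpow_le_rpow (abs_nonneg _) hle (by linarith)
    rw [abs_sub_comm, abs_of_nonneg (sub_nonneg.2 hle')]
    have hzα : 0 ≤ z ^ α := Real.rpow_nonneg hz _
    have hsα : 0 ≤ |Real.sin z| ^ α := Real.rpow_nonneg (abs_nonneg _) _
    rcases lt_or_ge 1 z with hz1 | hz1
    · nlinarith [mul_nonneg hzα (by nlinarith : 0 ≤ z ^ 2 - 1)]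
    · rcases hz.eq_or_lt with rfl | hz0
      · simp [Real.zero_rpow (by linarith : α ≠ 0)]
      have hsin := (Real.sin_gt_sub_cube hz0).le
      have hs : z * (1 + -(z ^ 2 / 4)) ≤ |Real.sin z| := by
        refine le_trans ?_ (le_abs_self _)
        linarith [show z * (1 + -(z ^ 2 / 4)) = z - z ^ 3 / 4 by ring, pow_pos hz0 3]
      have hz2 : z ^ 2 ≤ 1 := by nlinarith
      have hb := one_add_mul_self_le_rpow_one_add (s := -(z ^ 2 / 4)) (by linarith) h1.le
      have hp : z ^ α * (1 + α * -(z ^ 2 / 4)) ≤ |Real.sin z| ^ α := by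
        calc z ^ α * (1 + α * -(z ^ 2 / 4)) ≤ z ^ α * (1 + -(z ^ 2 / 4)) ^ α := by gcongr
          _ = (z * (1 + -(z ^ 2 / 4))) ^ α := by rw [Real.mul_rpow hz (by linarith)]
          _ ≤ _ := Real.rpow_le_rpow (mul_nonneg hz (by linarith)) hs (by linarith)
      have h3 : z ^ α * (α * (z ^ 2 / 4)) ≤ z ^ α * z ^ 2 := by
        refine mul_le_mul_of_nonneg_left ?_ hzα
        nlinarith [sq_nonneg z]
      nlinarith
  set w := |2 * Real.pi * k| with hw
  have hw0 : 0 ≤ w := abs_nonneg _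
  have hz0 : 0 ≤ w * h / 2 := by positivity
  have hsin : |Real.sin (Real.pi * (k * h))| = |Real.sin (w * h / 2)| := by
    rw [hw, abs_mul, abs_of_pos (by positivity : 0 < 2 * Real.pi)]
    rcases abs_choice k with e | e <;> rw [e]
    · congr 2; ring
    · rw [show 2 * Real.pi * -k * h / 2 = -(Real.pi * (k * h)) by ring, Real.sin_neg, abs_neg]
  have e1 : (1 / h ^ α) * symbol α (k * h) = (2 / h) ^ α * |Real.sin (w * h / 2)| ^ α := by
    unfold symbol
    rw [abs_mul, hsin, Real.mul_rpow (abs_nonneg _) (abs_nonneg _), abs_two,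
      Real.div_rpow zero_le_two hh.le]
    ring
  have e2 : w ^ α = (2 / h) ^ α * (w * h / 2) ^ α := by
    rw [← Real.mul_rpow (by positivity) hz0]; congr 1; field_simp
  have e3 : w ^ (α + 2) = w ^ α * w ^ 2 := by
    rw [Real.rpow_add_of_nonneg hw0 (by linarith) zero_le_two]; norm_cast
  rw [e1, e3, e2, ← mul_sub, abs_mul, abs_of_nonneg (by positivity : (0 : ℝ) ≤ (2 / h) ^ α)]
  have hp : 0 ≤ (2 / h) ^ α := by positivity
  calc (2 / h) ^ α * |(|Real.sin (w * h / 2)|) ^ α - (w * h / 2) ^ α|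
      ≤ (2 / h) ^ α * ((w * h / 2) ^ α * (w * h / 2) ^ 2) :=
        mul_le_mul_of_nonneg_left (key _ hz0) hp
    _ ≤ _ := by
      have h4 : (w * h / 2) ^ 2 ≤ h ^ 2 * w ^ 2 := by nlinarith [sq_nonneg (w * h)]
      have h5 : 0 ≤ (2 / h) ^ α * (w * h / 2) ^ α := by positivity
      nlinarith [mul_le_mul_of_nonneg_left h4 h5]

/-- The constant in the consistency estimate. -/
def weightConst (α : ℝ) : ℝ := ∫ k : ℝ, |2 * Real.pi * k| ^ (α + 2) / (1 + |2 * Real.pi * k| ^ 6)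

lemma weightConst_nonneg (α : ℝ) : 0 ≤ weightConst α :=
  integral_nonneg fun k => by positivity

namespace FourierPair
variable {f φ : ℝ → ℂ} {Q : ℝ} (hf : FourierPair f φ Q)
include hf

/-- The difference operator on the whole line acts as multiplication by its symbol on the Fourier
side. -/
lemma hasSum_difference {α : ℝ} (h1 : 1 < α) (h2 : α ≤ 2) (x h : ℝ) :
    HasSum (fun n : ℤ => (coeff α n : ℂ) * f (x + n * h))
      (∫ k, kern k x * (φ k * (symbol α (k * h) : ℂ))) := by
  have hchr : ∀ (n : ℤ) (k : ℝ), kern k (x + n * h) = kern k x * chr n (-(k * h)) := by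
    intro n k
    unfold kern chr
    rw [← Complex.exp_add]; congr 1; push_cast; ring
  set F : ℤ → ℝ → ℂ := fun n k => (coeff α n : ℂ) * (kern k (x + n * h) * φ k) with hF
  have hFi : ∀ n, Integrable (F n) := fun n => by
    refine Integrable.const_mul ?_ _
    refine hf.integrable.bdd_mul (c := 1) ?_ (Eventually.of_forall fun k => (norm_kern _ _).le)
    exact (by unfold kern; fun_prop : Continuous fun k : ℝ => kern k (x + n * h)).aestronglyMeasurable
  have hnorm : ∀ n, ∫ k, ‖F n k‖ = |coeff α n| * ∫ k, ‖φ k‖ := fun n => by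
    rw [← integral_const_mul]
    congr 1; ext k
    rw [hF, norm_mul, norm_mul, norm_kern, one_mul, Complex.norm_real, Real.norm_eq_abs]
  have hs := hasSum_integral_of_summable_integral_norm hFi (by
    simp_rw [hnorm]; exact (summable_coeff h1 h2).abs.mul_right _)
  have e1 : ∀ n, ∫ k, F n k = (coeff α n : ℂ) * f (x + n * h) := fun n => by
    rw [hF, integral_const_mul, ← hf.eq_integral]
  simp_rw [e1] at hs
  suffices e3 : (∫ k, kern k x * (φ k * (symbol α (k * h) : ℂ))) = ∫ k, ∑' n, F n k by
    rw [e3]; exact hs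
  refine integral_congr_ae (Eventually.of_forall fun k => ?_)
  simp only
  have hsym := (hasSum_symbol h1 h2 (-(k * h))).mul_left (kern k x * φ k)
  have heven : symbol α (-(k * h)) = symbol α (k * h) := by simp [symbol, abs_mul]
  rw [heven] at hsym
  have e2 : (fun n => F n k) = fun n : ℤ =>
      kern k x * φ k * ((coeff α n : ℂ) * chr n (-(k * h))) := by
    funext n; simp only [hF, hchr]; ring
  rw [e2, hsym.tsum_eq]; ring

/-- Consistency on the whole line. The four derivatives that the error of order `h ^ 2` costs are
covered by the decay of `φ`. -/
lemma norm_difference_sub_riesz_le {α : ℝ} (h1 : 1 < α) (h2 : α < 2) {h : ℝ} (hh : 0 < h) (x : ℝ)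
    {S : ℂ} (hS : HasSum (fun n : ℤ => (coeff α n : ℂ) * f (x + n * h)) S) :
    ‖-((1 / h ^ α : ℝ) : ℂ) * S - riesz α f x‖ ≤ Q * weightConst α * h ^ 2 := by
  have hk : AEStronglyMeasurable (fun k : ℝ => kern k x) :=
    (by unfold kern; fun_prop : Continuous fun k : ℝ => kern k x).aestronglyMeasurable
  have hi1 : Integrable fun k => kern k x * (φ k * (symbol α (k * h) : ℂ)) := by
    refine Integrable.bdd_mul (c := 1) ?_ hk (Eventually.of_forall fun k => (norm_kern _ _).le)
    refine hf.integrable_mul (p := 0) (C := 2 ^ α) ?_ (by norm_num) (by norm_num) fun k _ => ?_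
    · exact (Complex.continuous_ofReal.comp ((continuous_symbol (by linarith)).comp
        (by fun_prop : Continuous fun k : ℝ => k * h))).aestronglyMeasurable
    · rw [Real.rpow_zero, mul_one, Complex.norm_real, Real.norm_of_nonneg (symbol_nonneg _ _)]
      unfold symbol
      refine Real.rpow_le_rpow (abs_nonneg _) ?_ (by linarith)
      rw [abs_mul, abs_two]
      linarith [Real.abs_sin_le_one (Real.pi * (k * h))]
  have hi2 : Integrable fun k => kern k x * (φ k * ((|2 * Real.pi * k| ^ α : ℝ) : ℂ)) := by
    refine Integrable.bdd_mul (c := 1) ?_ hk (Eventually.of_forall fun k => (norm_kern _ _).le)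
    refine hf.integrable_mul (p := α) (C := 1) ?_ (by linarith) (by linarith) fun k _ => ?_
    · exact (by fun_prop : Measurable fun k : ℝ =>
        ((|2 * Real.pi * k| ^ α : ℝ) : ℂ)).aestronglyMeasurable
    · rw [one_mul, Complex.norm_real, Real.norm_of_nonneg (by positivity)]
  rw [hS.unique (hf.hasSum_difference h1 h2.le x h), hf.riesz_eq h1 h2 x, neg_mul, sub_neg_eq_add,
    neg_add_eq_sub, ← integral_const_mul, ← integral_sub hi2 (hi1.const_mul _)]
  have hw := integrable_weight (p := α + 2) (by linarith) (by linarith)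
  calc _ ≤ ∫ k, Q * h ^ 2 * (|2 * Real.pi * k| ^ (α + 2) / (1 + |2 * Real.pi * k| ^ 6)) := by
        refine norm_integral_le_of_norm_le (hw.const_mul _) (Eventually.of_forall fun k => ?_)
        have e : kern k x * (φ k * ((|2 * Real.pi * k| ^ α : ℝ) : ℂ))
            - ((1 / h ^ α : ℝ) : ℂ) * (kern k x * (φ k * (symbol α (k * h) : ℂ)))
            = kern k x * (φ k * ((|2 * Real.pi * k| ^ α - (1 / h ^ α) * symbol α (k * h) : ℝ) : ℂ)) := by
          push_cast; ring
        rw [e, norm_mul, norm_kern, one_mul, norm_mul, Complex.norm_real, Real.norm_eq_abs,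
          abs_sub_comm]
        calc _ ≤ (Q / (1 + |2 * Real.pi * k| ^ 6)) * (h ^ 2 * |2 * Real.pi * k| ^ (α + 2)) :=
              mul_le_mul (hf.decay k) (abs_symbol_sub_le h1 h2.le hh k) (abs_nonneg _)
                (div_nonneg hf.nonneg (by positivity))
          _ = _ := by ring
    _ = _ := by rw [integral_const_mul]; unfold weightConst; ring

lemma sub {g ψ : ℝ → ℂ} {R : ℝ} (hg : FourierPair g ψ R) :
    FourierPair (f - g) (φ - ψ) (Q + R) where
  cont := hf.cont.sub hg.cont
  bdd_supp := by
    obtain ⟨M, r, h⟩ := hf.bdd_supp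
    obtain ⟨M', r', h'⟩ := hg.bdd_supp
    refine ⟨M + M', max r r', fun x => ⟨?_, fun hx => ?_⟩⟩
    · exact (norm_sub_le _ _).trans (add_le_add (h x).1 (h' x).1)
    · rw [Pi.sub_apply, (h x).2 ((le_max_left _ _).trans_lt hx),
        (h' x).2 ((le_max_right _ _).trans_lt hx), sub_zero]
  cont_freq := hf.cont_freq.sub hg.cont_freq
  decay k := by
    rw [add_div]
    exact (norm_sub_le _ _).trans (add_le_add (hf.decay k) (hg.decay k))
  eq_fourier := by
    funext x
    have hk : AEStronglyMeasurable (fun k : ℝ => kern k x) :=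
      (by unfold kern; fun_prop : Continuous fun k : ℝ => kern k x).aestronglyMeasurable
    have hb : ∀ᵐ k : ℝ, ‖kern k x‖ ≤ 1 := Eventually.of_forall fun k => (norm_kern _ _).le
    rw [Pi.sub_apply, hf.eq_integral, hg.eq_integral, fourier_eq_kern,
      ← integral_sub (hf.integrable.bdd_mul hk hb) (hg.integrable.bdd_mul hk hb)]
    congr 1; ext k
    rw [Pi.sub_apply]; ring

lemma riesz_sub {g ψ : ℝ → ℂ} {R : ℝ} (hg : FourierPair g ψ R) {α : ℝ} (h1 : 1 < α) (h2 : α < 2)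
    (x : ℝ) : riesz α (f - g) x = riesz α f x - riesz α g x := by
  have hi : ∀ {f φ : ℝ → ℂ} {Q : ℝ}, FourierPair f φ Q →
      Integrable fun k => kern k x * (φ k * ((|2 * Real.pi * k| ^ α : ℝ) : ℂ)) := by
    intro f φ Q hf
    have hk : AEStronglyMeasurable (fun k : ℝ => kern k x) :=
      (by unfold kern; fun_prop : Continuous fun k : ℝ => kern k x).aestronglyMeasurable
    refine Integrable.bdd_mul (c := 1) ?_ hk (Eventually.of_forall fun k => (norm_kern _ _).le)
    refine hf.integrable_mul (p := α) (C := 1) ?_ (by linarith) (by linarith) fun k _ => ?_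
    · exact (by fun_prop : Measurable fun k : ℝ =>
        ((|2 * Real.pi * k| ^ α : ℝ) : ℂ)).aestronglyMeasurable
    · rw [one_mul, Complex.norm_real, Real.norm_of_nonneg (by positivity)]
  rw [(hf.sub hg).riesz_eq h1 h2, hf.riesz_eq h1 h2, hg.riesz_eq h1 h2, neg_sub_neg,
    ← integral_sub (hi hg) (hi hf), ← integral_neg]
  congr 1; ext k
  rw [Pi.sub_apply]; ring

end FourierPair

/-- A function of class `C⁶` with bounded support and its inverse Fourier transform. -/
lemma fourierPair_of_contDiff {a b M : ℝ} (hab : a ≤ b) {f : ℝ → ℂ} (hC : ContDiff ℝ 6 f)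
    (hz : ∀ x, x ∉ Icc a b → f x = 0)
    (hM : ∀ j ≤ 6, ∀ x ∈ Icc a b, ‖iteratedDeriv j f x‖ ≤ M) :
    FourierPair f (𝓕⁻ f) (2 * ((b - a) * M)) := by
  have hzj : ∀ j x, x ∉ Icc a b → iteratedDeriv j f x = 0 := by
    intro j x hx
    have : f =ᶠ[𝓝 x] fun _ => 0 := by
      filter_upwards [isClosed_Icc.isOpen_compl.mem_nhds hx] with y hy using hz y hy
    rw [this.iteratedDeriv_eq]
    simp
  have hcont : ∀ j : ℕ, j ≤ 6 → Continuous (iteratedDeriv j f) := fun j hj =>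
    hC.continuous_iteratedDeriv j (by exact_mod_cast hj)
  have hcs : ∀ j, HasCompactSupport (iteratedDeriv j f) := fun j =>
    HasCompactSupport.intro isCompact_Icc (hzj j)
  have hint : ∀ j : ℕ, j ≤ 6 → Integrable (iteratedDeriv j f) := fun j hj =>
    (hcont j hj).integrable_of_hasCompactSupport (hcs j)
  have hfb : ∀ j ≤ 6, ∀ v, ‖𝓕 (iteratedDeriv j f) v‖ ≤ (b - a) * M := by
    intro j hj v
    rw [fourier_eq_kern]
    have e : ∫ k, kern k v * iteratedDeriv j f k = ∫ k in Icc a b, kern k v * iteratedDeriv j f k :=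
      (setIntegral_eq_integral_of_forall_compl_eq_zero fun k hk => by rw [hzj j k hk, mul_zero]).symm
    have := norm_setIntegral_le_of_norm_le_const (μ := volume) (s := Icc a b) (C := M)
      (f := fun k => kern k v * iteratedDeriv j f k) measure_Icc_lt_top (fun k hk => by
        rw [norm_mul, norm_kern, one_mul]; exact hM j hj k hk)
    rw [e]
    refine this.trans (le_of_eq ?_)
    rw [Real.volume_real_Icc_of_le hab]; ring
  have hdec : ∀ v, ‖𝓕 f v‖ ≤ 2 * ((b - a) * M) / (1 + |2 * Real.pi * v| ^ 6) := by
    intro v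
    have h0 := hfb 0 (by norm_num) v
    have h6 := hfb 6 le_rfl v
    have := Real.fourier_iteratedDeriv (N := 6) (n := 6) hC
      (fun n hn => hint n (by exact_mod_cast hn)) le_rfl
    rw [this] at h6
    rw [iteratedDeriv_zero] at h0
    rw [le_div_iff₀ (by positivity)]
    have e : ‖(2 * Real.pi * Complex.I * v : ℂ) ^ 6 • 𝓕 f v‖ = ‖𝓕 f v‖ * |2 * Real.pi * v| ^ 6 := by
      rw [norm_smul, norm_pow, mul_comm]
      congr 2
      simp [abs_mul]
    rw [e] at h6
    linarith
  have hcf : Continuous f := hC.continuous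
  have hfi : Integrable f := by simpa using hint 0 (by norm_num)
  have hFc : Continuous (𝓕 f) := by
    exact VectorFourier.fourierIntegral_continuous Real.continuous_fourierChar
      (L := innerₗ ℝ) (by exact continuous_inner) hfi
  have hFi : Integrable (𝓕 f) := by
    have hw := (integrable_weight (p := 0) (by norm_num) (by norm_num)).const_mul (2 * ((b - a) * M))
    refine hw.mono' hFc.aestronglyMeasurable (Eventually.of_forall fun v => ?_)
    refine (hdec v).trans (le_of_eq ?_)
    rw [Real.rpow_zero]; ring
  have hM0 : 0 ≤ M := (norm_nonneg _).trans (hM 0 (by norm_num) a (left_mem_Icc.2 hab))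
  refine ⟨hcf, ⟨M, max |a| |b|, fun x => ⟨?_, fun hx => hz x fun h => ?_⟩⟩, ?_, fun k => ?_,
    (hcf.fourier_fourierInv_eq hfi hFi).symm⟩
  · by_cases hx : x ∈ Icc a b
    · simpa using hM 0 (by norm_num) x hx
    · rw [hz x hx, norm_zero]; exact hM0
  · exact absurd (abs_le_max_abs_abs h.1 h.2) (not_le.2 hx)
  · have : 𝓕⁻ f = fun w => 𝓕 f (-w) := by
      funext w; exact Real.fourierInv_eq_fourier_neg f w
    rw [this]; exact hFc.comp continuous_neg
  · rw [Real.fourierInv_eq_fourier_neg]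
    have := hdec (-k)
    rwa [mul_neg, abs_neg] at this

/-! ### Smooth functions of one variable -/

/-- A function that starts from zero and whose derivative is `O(s^n)` is `O(s^(n+1))`. -/
lemma norm_le_mul_pow_succ {E : Type*} [NormedAddCommGroup E] [NormedSpace ℝ E] {g g' : ℝ → E}
    {r C : ℝ} {n : ℕ} (hC : 0 ≤ C) (h0 : g 0 = 0)
    (hd : ∀ s ∈ Icc 0 r, HasDerivWithinAt g (g' s) (Icc 0 r) s)
    (hb : ∀ s ∈ Icc 0 r, ‖g' s‖ ≤ C * s ^ n) : ∀ s ∈ Icc 0 r, ‖g s‖ ≤ C * s ^ (n + 1) := by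
  intro s hs
  have hsub : Icc 0 s ⊆ Icc 0 r := Icc_subset_Icc_right hs.2
  have := (convex_Icc (0 : ℝ) s).norm_image_sub_le_of_norm_hasDerivWithin_le (f := g) (f' := g')
    (C := C * s ^ n) (fun t ht => (hd t (hsub ht)).mono hsub)
    (fun t ht => (hb t (hsub ht)).trans
      (mul_le_mul_of_nonneg_left (pow_le_pow_left₀ ht.1 ht.2 n) hC))
    (left_mem_Icc.2 hs.1) (right_mem_Icc.2 hs.1)
  rw [h0, sub_zero, sub_zero, Real.norm_of_nonneg hs.1] at this
  refine this.trans (le_of_eq (by ring))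

lemma hasDerivWithinAt_affine {E : Type*} [NormedAddCommGroup E] [NormedSpace ℝ E] {F : ℝ → E}
    {F' : E} {S : Set ℝ} {x σ r s : ℝ} (hF : HasDerivWithinAt F F' S (x + σ * s))
    (hmap : ∀ s ∈ Icc 0 r, x + σ * s ∈ S) :
    HasDerivWithinAt (fun s => F (x + σ * s)) (σ • F') (Icc 0 r) s := by
  have h1 : HasDerivWithinAt (fun s : ℝ => x + σ * s) σ (Icc 0 r) s := by
    simpa using (((hasDerivAt_id s).const_mul σ).const_add x).hasDerivWithinAt
  exact HasDerivWithinAt.scomp s hF h1 hmap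

/-- A function `F 0` on the line that vanishes off `(a, b)`, together with its first six derivatives
on `[a, b]`. The extension by zero has to be smooth only for nonlocal operators. -/
structure Profile (α a b : ℝ) (F : ℕ → ℝ → ℂ) : Prop where
  vanishes : ∀ x, x ∉ Ioo a b → F 0 x = 0
  deriv : ∀ j < 6, ∀ x ∈ Icc a b, HasDerivWithinAt (F j) (F (j + 1) x) (Icc a b) x
  smooth : α < 2 → ContDiff ℝ 6 (F 0)

namespace Profile
variable {α a b : ℝ} {F G : ℕ → ℝ → ℂ} (hF : Profile α a b F)
include hF

lemma sub (hG : Profile α a b G) : Profile α a b (F - G) where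
  vanishes x hx := by simp [hF.vanishes x hx, hG.vanishes x hx]
  deriv j hj x hx := (hF.deriv j hj x hx).sub (hG.deriv j hj x hx)
  smooth h := (hF.smooth h).sub (hG.smooth h)

lemma iteratedDeriv_eq (hab : a < b) (h2 : α < 2) {j : ℕ} (hj : j ≤ 6) {x : ℝ} (hx : x ∈ Icc a b) :
    iteratedDeriv j (F 0) x = F j x := by
  have key : ∀ j ≤ 6, ∀ x ∈ Icc a b, iteratedDerivWithin j (F 0) (Icc a b) x = F j x := by
    intro j
    induction j with
    | zero => intro _ x _; simp
    | succ j ih =>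
      intro hj x hx
      rw [iteratedDerivWithin_succ, derivWithin_congr (ih (by omega)) (ih (by omega) x hx)]
      exact (hF.deriv j (by omega) x hx).derivWithin (uniqueDiffOn_Icc hab x hx)
  rw [← key j hj x hx]
  exact (iteratedDerivWithin_eq_iteratedDeriv (uniqueDiffOn_Icc hab)
    ((hF.smooth h2).contDiffAt.of_le (by exact_mod_cast hj)) hx).symm

lemma fourierPair (hab : a < b) (h2 : α < 2) {M : ℝ}
    (hM : ∀ j ≤ 6, ∀ x ∈ Icc a b, ‖F j x‖ ≤ M) :
    FourierPair (F 0) (𝓕⁻ (F 0)) (2 * ((b - a) * M)) :=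
  fourierPair_of_contDiff hab.le (hF.smooth h2)
    (fun x hx => hF.vanishes x fun h => hx (Ioo_subset_Icc_self h))
    (fun j hj x hx => by rw [hF.iteratedDeriv_eq hab h2 hj hx]; exact hM j hj x hx)

lemma riesz_two {x : ℝ} (hx : x ∈ Ioo a b) : riesz 2 (F 0) x = F 2 x := by
  have hd : ∀ j < 6, ∀ y ∈ Ioo a b, HasDerivAt (F j) (F (j + 1) y) y := fun j hj y hy =>
    (hF.deriv j hj y (Ioo_subset_Icc_self hy)).hasDerivAt (Icc_mem_nhds hy.1 hy.2)
  unfold riesz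
  rw [if_pos rfl, iteratedDeriv_succ, iteratedDeriv_one]
  have : _root_.deriv (F 0) =ᶠ[𝓝 x] F 1 := by
    filter_upwards [Ioo_mem_nhds hx.1 hx.2] with y hy using (hd 0 (by norm_num) y hy).deriv
  rw [this.deriv_eq]
  exact (hd 1 (by norm_num) x hx).deriv

lemma riesz_sub (hG : Profile α a b G) (hab : a < b) (h1 : 1 < α) (h2 : α ≤ 2) {M : ℝ}
    (hFM : ∀ j ≤ 6, ∀ x ∈ Icc a b, ‖F j x‖ ≤ M) (hGM : ∀ j ≤ 6, ∀ x ∈ Icc a b, ‖G j x‖ ≤ M)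
    {x : ℝ} (hx : x ∈ Ioo a b) :
    riesz α ((F - G) 0) x = riesz α (F 0) x - riesz α (G 0) x := by
  rcases h2.lt_or_eq with h2 | rfl
  · exact (hF.fourierPair hab h2 hFM).riesz_sub (hG.fourierPair hab h2 hGM) h1 h2 x
  · rw [hF.riesz_two hx, hG.riesz_two hx, (hF.sub hG).riesz_two hx]; rfl

/-- Taylor's formula for the second central difference. -/
lemma norm_central_difference_le {M : ℝ} (hM : ∀ x ∈ Icc a b, ‖F 4 x‖ ≤ M) {x h : ℝ} (hh : 0 ≤ h)
    (hl : a ≤ x - h) (hr : x + h ≤ b) :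
    ‖F 0 (x + h) + F 0 (x - h) - 2 * F 0 x - (h : ℂ) ^ 2 * F 2 x‖ ≤ 2 * M * h ^ 4 := by
  have hM0 : 0 ≤ M := (norm_nonneg _).trans (hM x ⟨by linarith, by linarith⟩)
  have hp : ∀ s ∈ Icc 0 h, x + 1 * s ∈ Icc a b := fun s hs =>
    ⟨by linarith [hs.1], by linarith [hs.2]⟩
  have hm : ∀ s ∈ Icc 0 h, x + (-1) * s ∈ Icc a b := fun s hs =>
    ⟨by linarith [hs.2], by linarith [hs.1]⟩
  have hdp : ∀ j < 6, ∀ s ∈ Icc 0 h,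
      HasDerivWithinAt (fun s => F j (x + 1 * s)) ((1 : ℝ) • F (j + 1) (x + 1 * s)) (Icc 0 h) s :=
    fun j hj s hs => hasDerivWithinAt_affine (hF.deriv j hj _ (hp s hs)) hp
  have hdm : ∀ j < 6, ∀ s ∈ Icc 0 h, HasDerivWithinAt (fun s => F j (x + (-1) * s))
      ((-1 : ℝ) • F (j + 1) (x + (-1) * s)) (Icc 0 h) s :=
    fun j hj s hs => hasDerivWithinAt_affine (hF.deriv j hj _ (hm s hs)) hm
  have hid : ∀ s ∈ Icc 0 h, HasDerivWithinAt (fun s : ℝ => (s : ℂ)) 1 (Icc 0 h) s := fun s _ =>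
    Complex.ofRealCLM.hasDerivAt.hasDerivWithinAt
  have g3 : ∀ s ∈ Icc 0 h, ‖F 3 (x + 1 * s) - F 3 (x + (-1) * s)‖ ≤ 2 * M * s ^ (0 + 1) := by
    refine norm_le_mul_pow_succ (g' := fun s => (1 : ℝ) • F 4 (x + 1 * s)
      - (-1 : ℝ) • F 4 (x + (-1) * s)) (by positivity) (by simp) (fun s hs => ?_) (fun s hs => ?_)
    · exact (hdp 3 (by norm_num) s hs).sub (hdm 3 (by norm_num) s hs)
    · rw [one_smul, neg_one_smul, sub_neg_eq_add, pow_zero, mul_one, two_mul]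
      exact (norm_add_le _ _).trans (add_le_add (hM _ (hp s hs)) (hM _ (hm s hs)))
  have g2 : ∀ s ∈ Icc 0 h, ‖F 2 (x + 1 * s) + F 2 (x + (-1) * s) - 2 * F 2 x‖
      ≤ 2 * M * s ^ (1 + 1) := by
    refine norm_le_mul_pow_succ (g' := fun s => F 3 (x + 1 * s) - F 3 (x + (-1) * s))
      (by positivity) (by simp; ring) (fun s hs => ?_) g3
    refine (((hdp 2 (by norm_num) s hs).add (hdm 2 (by norm_num) s hs)).sub_const _).congr_deriv ?_
    simp [sub_eq_add_neg]
  have g1 : ∀ s ∈ Icc 0 h, ‖F 1 (x + 1 * s) - F 1 (x + (-1) * s) - (s : ℂ) * (2 * F 2 x)‖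
      ≤ 2 * M * s ^ (2 + 1) := by
    refine norm_le_mul_pow_succ (g' := fun s => F 2 (x + 1 * s) + F 2 (x + (-1) * s) - 2 * F 2 x)
      (by positivity) (by simp) (fun s hs => ?_) g2
    refine (((hdp 1 (by norm_num) s hs).sub (hdm 1 (by norm_num) s hs)).sub
      ((hid s hs).mul_const (2 * F 2 x))).congr_deriv ?_
    simp
  have g0 : ∀ s ∈ Icc 0 h,
      ‖F 0 (x + 1 * s) + F 0 (x + (-1) * s) - 2 * F 0 x - (s : ℂ) ^ 2 * F 2 x‖
      ≤ 2 * M * s ^ (3 + 1) := by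
    refine norm_le_mul_pow_succ
      (g' := fun s => F 1 (x + 1 * s) - F 1 (x + (-1) * s) - (s : ℂ) * (2 * F 2 x))
      (by positivity) (by simp; ring) (fun s hs => ?_) g1
    refine ((((hdp 0 (by norm_num) s hs).add (hdm 0 (by norm_num) s hs)).sub_const _).sub
      (((hid s hs).pow 2).mul_const (F 2 x))).congr_deriv ?_
    simp [sub_eq_add_neg]; ring
  have := g0 h ⟨hh, le_rfl⟩
  rwa [one_mul, neg_one_mul, ← sub_eq_add_neg] at this

end Profile

lemma coeff_two_zero : coeff 2 0 = 2 := by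
  rw [coeff_zero]; norm_num [Real.Gamma_ofNat_eq_factorial, Nat.factorial]

lemma coeff_two_one : coeff 2 1 = -1 := by
  have := coeff_succ (α := 2) (by norm_num) 0
  norm_num [coeff_two_zero] at this
  linarith

lemma coeff_two_of_two_le (n : ℕ) : coeff 2 ((n : ℤ) + 2) = 0 := by
  induction n with
  | zero =>
    have := coeff_succ (α := 2) (by norm_num) 1
    norm_num at this
    simpa using this
  | succ n ih =>
    have := coeff_succ (α := 2) (by norm_num) (n + 2)
    push_cast at this
    rw [ih, mul_zero] at this
    have h3 : ((n : ℝ) + 2 + 1 + 2 / 2) ≠ 0 := by positivity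
    have := (mul_eq_zero.1 this).resolve_left h3
    rw [← this]; congr 1

/-- For `α = 2` the operator is the negative of the usual three-point difference. -/
lemma sum_coeff_two {M j : ℕ} (hj : j ∈ Ioo 0 M) {v : ℕ → ℂ} (h0 : v 0 = 0) (hM : v M = 0) :
    ∑ s ∈ Finset.Ioo 0 M, (coeff 2 ((j : ℤ) - (s : ℤ)) : ℂ) * v s
      = 2 * v j - v (j + 1) - v (j - 1) := by
  obtain ⟨i, rfl⟩ : ∃ i, j = i + 1 := ⟨j - 1, by have := hj.1; omega⟩
  have hiM : i + 1 < M := hj.2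
  set g : ℕ → ℂ := fun s => (coeff 2 (((i + 1 : ℕ) : ℤ) - (s : ℤ)) : ℂ) * v s with hg
  have hz : ∀ s, s ≠ i → s ≠ i + 1 → s ≠ i + 2 → g s = 0 := by
    intro s h1 h2 h3
    have : coeff 2 (((i + 1 : ℕ) : ℤ) - (s : ℤ)) = 0 := by
      rcases lt_or_ge s i with h | h
      · obtain ⟨n, hn⟩ : ∃ n : ℕ, ((i + 1 : ℕ) : ℤ) - (s : ℤ) = (n : ℤ) + 2 :=
          ⟨i - 1 - s, by omega⟩
        rw [hn, coeff_two_of_two_le]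
      · obtain ⟨n, hn⟩ : ∃ n : ℕ, ((i + 1 : ℕ) : ℤ) - (s : ℤ) = -((n : ℤ) + 2) :=
          ⟨s - 3 - i, by omega⟩
        rw [hn, coeff_neg, coeff_two_of_two_le]
    simp only [hg]
    rw [this, Complex.ofReal_zero, zero_mul]
  have e1 : ∑ s ∈ Finset.Ioo 0 M, g s = ∑ s ∈ Finset.range (M + 1), g s := by
    refine Finset.sum_subset (fun s hs => ?_) fun s hs hs' => ?_
    · simp only [Finset.mem_Ioo, Finset.mem_range] at hs ⊢; omega
    · have : s = 0 ∨ s = M := by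
        simp only [Finset.mem_Ioo, Finset.mem_range] at hs hs'; omega
      rcases this with rfl | rfl
      · simp [hg, h0]
      · simp [hg, hM]
  have e2 : ∑ s ∈ ({i, i + 1, i + 2} : Finset ℕ), g s = ∑ s ∈ Finset.range (M + 1), g s := by
    refine Finset.sum_subset (fun s hs => ?_) fun s _ hs' => ?_
    · simp only [Finset.mem_insert, Finset.mem_singleton, Finset.mem_range] at hs ⊢; omega
    · simp only [Finset.mem_insert, Finset.mem_singleton, not_or] at hs'
      exact hz s hs'.1 hs'.2.1 hs'.2.2
  rw [e1, ← e2, Finset.sum_insert (by simp), Finset.sum_insert (by simp), Finset.sum_singleton]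
  have c1 : ((i + 1 : ℕ) : ℤ) - (i : ℤ) = 1 := by push_cast; ring
  have c2 : ((i + 1 : ℕ) : ℤ) - ((i + 1 : ℕ) : ℤ) = 0 := by ring
  have c3 : ((i + 1 : ℕ) : ℤ) - ((i + 2 : ℕ) : ℤ) = -1 := by push_cast; ring
  simp only [hg, c1, c2, c3, coeff_neg, coeff_two_zero, coeff_two_one]
  push_cast
  ring

/-- The constant in the consistency estimate below. -/
def consistencyConst (α a b : ℝ) : ℝ := 2 + 2 * ((b - a) * weightConst α)

lemma consistencyConst_pos {α a b : ℝ} (hab : a < b) : 0 < consistencyConst α a b := by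
  have := mul_nonneg (sub_pos.2 hab).le (weightConst_nonneg α)
  unfold consistencyConst; linarith

/-- Second-order consistency of the fractional centered difference. -/
lemma Profile.consistency {α a b : ℝ} {F : ℕ → ℝ → ℂ} (hF : Profile α a b F) (hab : a < b)
    (h1 : 1 < α) (h2 : α ≤ 2) {B : ℝ} (hB : ∀ j ≤ 6, ∀ x ∈ Icc a b, ‖F j x‖ ≤ B) {M : ℕ} {h : ℝ}
    (hh : h = (b - a) / M) {j : ℕ} (hj : j ∈ Ioo 0 M) :
    ‖-((1 / h ^ α : ℝ) : ℂ) * ∑ s ∈ Finset.Ioo 0 M,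
        (coeff α ((j : ℤ) - (s : ℤ)) : ℂ) * F 0 (a + s * h) - riesz α (F 0) (a + j * h)‖
      ≤ consistencyConst α a b * B * h ^ 2 := by
  have hM0 : (0 : ℝ) < M := by exact_mod_cast hj.1.trans hj.2
  have hh0 : 0 < h := by rw [hh]; exact div_pos (by linarith) hM0
  have hMh : a + M * h = b := by rw [hh]; field_simp; ring
  have hB0 : 0 ≤ B := (norm_nonneg _).trans (hB 0 (by norm_num) a (left_mem_Icc.2 hab.le))
  have hw := mul_nonneg (sub_pos.2 hab).le (weightConst_nonneg α)
  have hmem : ∀ n : ℤ, a + n * h ∈ Ioo a b → 0 < n ∧ n < M := by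
    intro n hn
    have h3 : (0 : ℝ) < n := pos_of_mul_pos_left (by linarith [hn.1] : 0 < (n : ℝ) * h) hh0.le
    have h4 : (n : ℝ) < M := lt_of_mul_lt_mul_right (by linarith [hn.2]) hh0.le
    exact ⟨by exact_mod_cast h3, by exact_mod_cast h4⟩
  have hjM : (j : ℝ) + 1 ≤ M := by exact_mod_cast hj.2
  have hj1 : (1 : ℝ) ≤ j := by exact_mod_cast hj.1
  rcases h2.lt_or_eq with h2' | rfl
  · have hS : HasSum (fun n : ℤ => (coeff α n : ℂ) * F 0 (a + j * h + n * h))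
        (∑ s ∈ Finset.Ioo 0 M, (coeff α ((j : ℤ) - (s : ℤ)) : ℂ) * F 0 (a + s * h)) := by
      have e : ∑ s ∈ Finset.Ioo 0 M, (coeff α ((j : ℤ) - (s : ℤ)) : ℂ) * F 0 (a + s * h)
          = ∑ n ∈ (Finset.Ioo 0 M).image (fun s : ℕ => (s : ℤ) - j),
            (coeff α n : ℂ) * F 0 (a + j * h + n * h) := by
        rw [Finset.sum_image (fun s _ t _ hst => by simpa using hst)]
        refine Finset.sum_congr rfl fun s _ => ?_
        rw [← coeff_neg, neg_sub]
        congr 2; push_cast; ring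
      rw [e]
      refine hasSum_sum_of_ne_finset_zero fun n hn => ?_
      rw [hF.vanishes, mul_zero]
      intro hx
      have := hmem (j + n) (by push_cast; convert hx using 1; ring)
      refine hn (Finset.mem_image.2 ⟨(j + n).toNat, ?_, ?_⟩)
      · rw [Finset.mem_Ioo]; omega
      · omega
    refine ((hF.fourierPair hab h2' hB).norm_difference_sub_riesz_le h1 h2' hh0 (a + j * h) hS).trans
      (le_of_sub_nonneg ?_)
    have : consistencyConst α a b * B * h ^ 2 - 2 * ((b - a) * B) * weightConst α * h ^ 2
        = 2 * B * h ^ 2 := by unfold consistencyConst; ring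
    rw [this]; positivity
  · have hx : a + j * h ∈ Ioo a b := ⟨by nlinarith, by nlinarith⟩
    have ht := hF.norm_central_difference_le (hB 4 (by norm_num)) (x := a + j * h) hh0.le
      (by nlinarith) (by nlinarith)
    rw [sum_coeff_two hj (v := fun s => F 0 (a + s * h)) (hF.vanishes _ (by simp))
      (hF.vanishes _ (by rw [hMh]; simp)), hF.riesz_two hx]
    have ep : a + ((j + 1 : ℕ) : ℝ) * h = a + j * h + h := by push_cast; ring
    have em : a + ((j - 1 : ℕ) : ℝ) * h = a + j * h - h := by
      rw [Nat.cast_sub hj.1]; push_cast; ring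
    rw [ep, em]
    have hhc : (h : ℂ) ≠ 0 := Complex.ofReal_ne_zero.2 hh0.ne'
    have e : -((1 / h ^ (2 : ℝ) : ℝ) : ℂ) * (2 * F 0 (a + j * h) - F 0 (a + j * h + h)
        - F 0 (a + j * h - h)) - F 2 (a + j * h)
        = ((1 / h ^ 2 : ℝ) : ℂ) * (F 0 (a + j * h + h) + F 0 (a + j * h - h)
          - 2 * F 0 (a + j * h) - (h : ℂ) ^ 2 * F 2 (a + j * h)) := by
      rw [Real.rpow_two]; push_cast; field_simp; ring
    rw [e, norm_mul, Complex.norm_real, Real.norm_of_nonneg (by positivity)]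
    calc 1 / h ^ 2 * _ ≤ 1 / h ^ 2 * (2 * B * h ^ 4) := by gcongr
      _ = 2 * B * h ^ 2 := by field_simp
      _ ≤ _ := by
        unfold consistencyConst
        have := mul_nonneg (mul_nonneg hw hB0) (sq_nonneg h)
        nlinarith

/-! ### Partial derivatives of the solution up to the boundary -/

/-- Partial derivatives of `u` on the closed box `[a,b] × [c,d] × [0,T]`: `D w` is the derivative
along the word `w` in the directions `0`, `1`, `2` for `x`, `y`, `t` (the head of the word is the
outermost derivative), and `B` bounds all those of order at most seven. -/
structure Jet (a b c d T : ℝ) (u : ℝ → ℝ → ℝ → ℂ) (D : List (Fin 3) → ℝ → ℝ → ℝ → ℂ) (B : ℝ) :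
    Prop where
  nil : D [] = u
  bound : ∀ w : List (Fin 3), w.length ≤ 7 → ∀ x ∈ Icc a b, ∀ y ∈ Icc c d, ∀ t ∈ Icc 0 T,
    ‖D w x y t‖ ≤ B
  derivX : ∀ w : List (Fin 3), w.length ≤ 6 → ∀ x ∈ Icc a b, ∀ y ∈ Icc c d, ∀ t ∈ Icc 0 T,
    HasDerivWithinAt (fun x => D w x y t) (D (0 :: w) x y t) (Icc a b) x
  derivY : ∀ w : List (Fin 3), w.length ≤ 6 → ∀ x ∈ Icc a b, ∀ y ∈ Icc c d, ∀ t ∈ Icc 0 T,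
    HasDerivWithinAt (fun y => D w x y t) (D (1 :: w) x y t) (Icc c d) y
  derivT : ∀ w : List (Fin 3), w.length ≤ 6 → ∀ x ∈ Icc a b, ∀ y ∈ Icc c d, ∀ t ∈ Icc 0 T,
    HasDerivWithinAt (fun t => D w x y t) (D (2 :: w) x y t) (Icc 0 T) t

/-- Iterated partial derivatives within a set. -/
def partialWithin (K : Set (ℝ × ℝ × ℝ)) (F : ℝ × ℝ × ℝ → ℂ) : List (Fin 3) → ℝ × ℝ × ℝ → ℂ
  | [] => F
  | i :: w => fun p => fderivWithin ℝ (partialWithin K F w) K p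
      ((![(1, 0, 0), (0, 1, 0), (0, 0, 1)] : Fin 3 → ℝ × ℝ × ℝ) i)

lemma contDiffOn_partialWithin {K : Set (ℝ × ℝ × ℝ)} (hK : UniqueDiffOn ℝ K) {F : ℝ × ℝ × ℝ → ℂ}
    {m : ℕ} (hF : ContDiffOn ℝ m F K) (w : List (Fin 3)) :
    ∀ n : ℕ, w.length + n ≤ m → ContDiffOn ℝ n (partialWithin K F w) K := by
  induction w with
  | nil => intro n hn; exact hF.of_le (by simpa using hn)
  | cons i w ih =>
    intro n hn
    have h1 := ih (n + 1) (by simpa [add_assoc, add_comm, add_left_comm] using hn)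
    exact (h1.fderivWithin hK (by norm_cast)).clm_apply contDiffOn_const

/-- Smoothness on the compact box gives bounded partial derivatives up to the boundary. -/
lemma IsSmooth.exists_jet {α a b c d T : ℝ} (hab : a < b) (hcd : c < d) (hT : 0 < T)
    {u : ℝ → ℝ → ℝ → ℂ} (hu : IsSmooth 7 α a b c d T u) : ∃ D B, Jet a b c d T u D B := by
  set K : Set (ℝ × ℝ × ℝ) := Icc a b ×ˢ Icc c d ×ˢ Icc 0 T with hK
  have hKu : UniqueDiffOn ℝ K :=
    (uniqueDiffOn_Icc hab).prod ((uniqueDiffOn_Icc hcd).prod (uniqueDiffOn_Icc hT))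
  have hKc : IsCompact K := isCompact_Icc.prod (isCompact_Icc.prod isCompact_Icc)
  set F : ℝ × ℝ × ℝ → ℂ := fun p => u p.1 p.2.1 p.2.2 with hF
  set P := partialWithin K F with hP
  have hcd' := contDiffOn_partialWithin hKu hu.upToBoundary
  have hb : ∀ w : List (Fin 3), ∃ B : ℝ, w.length ≤ 7 → ∀ p ∈ K, ‖P w p‖ ≤ B := by
    intro w
    by_cases hw : w.length ≤ 7
    · obtain ⟨B, hB⟩ := hKc.exists_bound_of_continuousOn (hcd' w 0 (by omega)).continuousOn
      exact ⟨B, fun _ => hB⟩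
    · exact ⟨0, fun h => absurd h hw⟩
  choose Bw hBw using hb
  obtain ⟨B, hB⟩ := ((List.finite_length_le (Fin 3) 7).image Bw).bddAbove
  have hdiff : ∀ w : List (Fin 3), w.length ≤ 6 → ∀ p ∈ K,
      HasFDerivWithinAt (P w) (fderivWithin ℝ (P w) K p) K p := fun w hw p hp =>
    ((hcd' w 1 (by omega)).differentiableOn (by norm_num) p hp).hasFDerivWithinAt
  refine ⟨fun w x y t => P w (x, y, t), B, rfl, fun w hw x hx y hy t ht => ?_,
    fun w hw x hx y hy t ht => ?_, fun w hw x hx y hy t ht => ?_, fun w hw x hx y hy t ht => ?_⟩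
  · exact (hBw w hw _ ⟨hx, hy, ht⟩).trans (hB ⟨w, hw, rfl⟩)
  · refine (hdiff w hw (x, y, t) ⟨hx, hy, ht⟩).comp_hasDerivWithinAt (f := fun x => (x, y, t)) x ?_
      (fun x' hx' => ⟨hx', hy, ht⟩)
    exact (hasDerivWithinAt_id x _).prodMk (hasDerivWithinAt_const x _ (y, t))
  · refine (hdiff w hw (x, y, t) ⟨hx, hy, ht⟩).comp_hasDerivWithinAt (f := fun y => (x, y, t)) y ?_
      (fun y' hy' => ⟨hx, hy', ht⟩)
    exact (hasDerivWithinAt_const y _ x).prodMk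
      ((hasDerivWithinAt_id y _).prodMk (hasDerivWithinAt_const y _ t))
  · refine (hdiff w hw (x, y, t) ⟨hx, hy, ht⟩).comp_hasDerivWithinAt (f := fun t => (x, y, t)) t ?_
      (fun t' ht' => ⟨hx, hy, ht'⟩)
    exact (hasDerivWithinAt_const t _ x).prodMk
      ((hasDerivWithinAt_const t _ y).prodMk (hasDerivWithinAt_id t _))

/-! ### Functions with bounded mixed differences -/

/-- One of the differences `W`, `Δₓ W`, `Δ_y W`, `Δₓ Δ_y W`, as `e₁, e₂ ∈ {0, 1}`. -/
def corner (e₁ e₂ : ℂ) (x x' y y' : ℝ) (W : ℝ → ℝ → ℂ) : ℂ :=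
  W x y - e₁ * W x' y - e₂ * (W x y' - e₁ * W x' y')

/-- `e` selects the difference of two values of size `δ` (`e = 1`) or the value (`e = 0`); `ω` is
the factor `δ` or `1` by which the result is measured. -/
def Selects (e : ℂ) (ω δ : ℝ) : Prop := (e = 0 ∧ ω = 1) ∨ (e = 1 ∧ ω = δ)

/-- `W` and its first-order and mixed difference quotients on `[a,b] × [c,d]` are at most `m`. -/
def BoundedMixed (a b c d : ℝ) (W : ℝ → ℝ → ℂ) (m : ℝ) : Prop :=
  ∀ x ∈ Icc a b, ∀ x' ∈ Icc a b, ∀ y ∈ Icc c d, ∀ y' ∈ Icc c d, ∀ (e₁ e₂ : ℂ) (ω₁ ω₂ : ℝ),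
    Selects e₁ ω₁ |x - x'| → Selects e₂ ω₂ |y - y'| → ‖corner e₁ e₂ x x' y y' W‖ ≤ m * (ω₁ * ω₂)

namespace Jet
variable {a b c d T : ℝ} {u : ℝ → ℝ → ℝ → ℂ} {D : List (Fin 3) → ℝ → ℝ → ℝ → ℂ} {B : ℝ}
  (hD : Jet a b c d T u D B) {w : List (Fin 3)} {x y t : ℝ}
include hD

lemma norm_sub_le_x (hw : w.length ≤ 6) {x' : ℝ} (hx : x ∈ Icc a b) (hx' : x' ∈ Icc a b)
    (hy : y ∈ Icc c d) (ht : t ∈ Icc 0 T) : ‖D w x y t - D w x' y t‖ ≤ B * |x - x'| :=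
  (convex_Icc a b).norm_image_sub_le_of_norm_hasDerivWithin_le
    (fun z hz => hD.derivX w hw z hz y hy t ht)
    (fun z hz => hD.bound _ (by simp only [List.length_cons]; omega) z hz y hy t ht) hx' hx

lemma norm_sub_le_y (hw : w.length ≤ 6) {y' : ℝ} (hx : x ∈ Icc a b) (hy : y ∈ Icc c d)
    (hy' : y' ∈ Icc c d) (ht : t ∈ Icc 0 T) : ‖D w x y t - D w x y' t‖ ≤ B * |y - y'| :=
  (convex_Icc c d).norm_image_sub_le_of_norm_hasDerivWithin_le
    (fun z hz => hD.derivY w hw x hx z hz t ht)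
    (fun z hz => hD.bound _ (by simp only [List.length_cons]; omega) x hx z hz t ht) hy' hy

lemma norm_sub_le_t (hw : w.length ≤ 6) {s : ℝ} (hx : x ∈ Icc a b) (hy : y ∈ Icc c d)
    (ht : t ∈ Icc 0 T) (hs : s ∈ Icc 0 T) : ‖D w x y t - D w x y s‖ ≤ B * |t - s| :=
  (convex_Icc 0 T).norm_image_sub_le_of_norm_hasDerivWithin_le
    (fun z hz => hD.derivT w hw x hx y hy z hz)
    (fun z hz => hD.bound _ (by simp only [List.length_cons]; omega) x hx y hy z hz) hs ht

/-- A mixed difference quotient costs one derivative in each space variable. -/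
lemma boundedMixed (hw : w.length ≤ 5) (ht : t ∈ Icc 0 T) :
    BoundedMixed a b c d (fun x y => D w x y t) B := by
  intro x hx x' hx' y hy y' hy' e₁ e₂ ω₁ ω₂ h₁ h₂
  unfold corner
  rcases h₁ with ⟨rfl, rfl⟩ | ⟨rfl, rfl⟩ <;> rcases h₂ with ⟨rfl, rfl⟩ | ⟨rfl, rfl⟩
  · simpa using hD.bound w (by omega) x hx y hy t ht
  · simpa using hD.norm_sub_le_y (by omega) hx hy hy' ht
  · simpa using hD.norm_sub_le_x (by omega) hx hx' hy ht
  · have := (convex_Icc a b).norm_image_sub_le_of_norm_hasDerivWithin_le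
      (f := fun z => D w z y t - D w z y' t) (C := B * |y - y'|)
      (fun z hz => (hD.derivX w (by omega) z hz y hy t ht).sub
        (hD.derivX w (by omega) z hz y' hy' t ht))
      (fun z hz => hD.norm_sub_le_y (by simp only [List.length_cons]; omega) hz hy hy' ht) hx' hx
    rw [Real.norm_eq_abs] at this
    calc _ = ‖D w x y t - D w x y' t - (D w x' y t - D w x' y' t)‖ := by congr 1; ring
      _ ≤ _ := this
      _ = _ := by ring

end Jet

/-! ### Taylor's formula in time -/

section Taylor
variable {g : ℕ → ℝ → ℂ} {T B : ℝ}
  (hg : ∀ j < 3, ∀ t ∈ Icc 0 T, HasDerivWithinAt (g j) (g (j + 1) t) (Icc 0 T) t)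
  (hB : ∀ j ≤ 3, ∀ t ∈ Icc 0 T, ‖g j t‖ ≤ B)
include hg hB

lemma norm_sub_le_of_chain {j : ℕ} (hj : j < 3) {s t : ℝ} (hs : s ∈ Icc 0 T) (ht : t ∈ Icc 0 T) :
    ‖g j t - g j s‖ ≤ B * |t - s| :=
  (convex_Icc 0 T).norm_image_sub_le_of_norm_hasDerivWithin_le (fun z hz => hg j hj z hz)
    (fun z hz => hB _ (by omega) z hz) hs ht

lemma norm_first_step_le {τ : ℝ} (hτ : 0 ≤ τ) (hτT : τ ≤ T) :
    ‖g 0 τ - g 0 0 - τ * g 1 0‖ ≤ B * τ ^ 2 := by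
  have h0 : (0 : ℝ) ∈ Icc 0 T := ⟨le_rfl, hτ.trans hτT⟩
  have hB0 : 0 ≤ B := (norm_nonneg _).trans (hB 0 (by norm_num) 0 h0)
  have hsub : Icc 0 τ ⊆ Icc 0 T := Icc_subset_Icc_right hτT
  refine norm_le_mul_pow_succ (g := fun s : ℝ => g 0 s - g 0 0 - s * g 1 0)
    (g' := fun s => g 1 s - g 1 0) (r := τ) (n := 1) hB0 (by simp) (fun s hs => ?_)
    (fun s hs => ?_) τ ⟨hτ, le_rfl⟩
  · have hid : HasDerivWithinAt (fun s : ℝ => (s : ℂ)) 1 (Icc 0 τ) s :=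
      Complex.ofRealCLM.hasDerivAt.hasDerivWithinAt
    refine ((((hg 0 (by norm_num) s (hsub hs)).mono hsub).sub_const _).sub
      (hid.mul_const (g 1 0))).congr_deriv (by simp)
  · have := norm_sub_le_of_chain hg hB (j := 1) (by norm_num) h0 (hsub hs)
    rw [sub_zero, abs_of_nonneg hs.1] at this
    rwa [pow_one]

section Central
variable {t τ : ℝ} (hτ : 0 ≤ τ) (hl : 0 ≤ t - τ) (hr : t + τ ≤ T)
include hτ hl hr

lemma norm_central_sub_le {j : ℕ} (hj : j < 3) : ‖g j (t + τ) - g j (t - τ)‖ ≤ 2 * B * τ := by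
  have := norm_sub_le_of_chain hg hB hj (s := t - τ) (t := t + τ) ⟨hl, by linarith⟩
    ⟨by linarith, hr⟩
  rw [show t + τ - (t - τ) = 2 * τ by ring, abs_of_nonneg (by linarith)] at this
  linarith

lemma norm_central_second_le :
    ‖g 0 (t + τ) + g 0 (t - τ) - 2 * g 0 t‖ ≤ 2 * B * τ ^ 2 := by
  have hB0 : 0 ≤ B := (norm_nonneg _).trans (hB 0 (by norm_num) t ⟨by linarith, by linarith⟩)
  have hp : ∀ s ∈ Icc 0 τ, t + 1 * s ∈ Icc 0 T := fun s hs =>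
    ⟨by linarith [hs.1], by linarith [hs.2]⟩
  have hm : ∀ s ∈ Icc 0 τ, t + (-1) * s ∈ Icc 0 T := fun s hs =>
    ⟨by linarith [hs.2], by linarith [hs.1]⟩
  have := norm_le_mul_pow_succ (g := fun s : ℝ => g 0 (t + 1 * s) + g 0 (t + (-1) * s) - 2 * g 0 t)
    (g' := fun s => (1 : ℝ) • g 1 (t + 1 * s) + (-1 : ℝ) • g 1 (t + (-1) * s)) (r := τ) (n := 1)
    (C := 2 * B) (by positivity) (by simp; ring) (fun s hs =>
      ((hasDerivWithinAt_affine (hg 0 (by norm_num) _ (hp s hs)) hp).add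
        (hasDerivWithinAt_affine (hg 0 (by norm_num) _ (hm s hs)) hm)).sub_const _)
    (fun s hs => ?_) τ ⟨hτ, le_rfl⟩
  · simpa [sub_eq_add_neg] using this
  · have := norm_central_sub_le hg hB hs.1 (by linarith [hs.2]) (by linarith [hs.2])
      (j := 1) (t := t) (τ := s) (by norm_num)
    simpa [sub_eq_add_neg] using this

/-- The trapezoidal rule on the time step, with the error of third order. -/
lemma norm_trapezoid_le :
    ‖g 0 (t + τ) - g 0 (t - τ) - τ * (g 1 (t + τ) + g 1 (t - τ))‖ ≤ 2 * B * τ ^ 3 := by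
  have hB0 : 0 ≤ B := (norm_nonneg _).trans (hB 0 (by norm_num) t ⟨by linarith, by linarith⟩)
  have hp : ∀ s ∈ Icc 0 τ, t + 1 * s ∈ Icc 0 T := fun s hs =>
    ⟨by linarith [hs.1], by linarith [hs.2]⟩
  have hm : ∀ s ∈ Icc 0 τ, t + (-1) * s ∈ Icc 0 T := fun s hs =>
    ⟨by linarith [hs.2], by linarith [hs.1]⟩
  have hdp : ∀ j < 3, ∀ s ∈ Icc 0 τ,
      HasDerivWithinAt (fun s => g j (t + 1 * s)) ((1 : ℝ) • g (j + 1) (t + 1 * s)) (Icc 0 τ) s :=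
    fun j hj s hs => hasDerivWithinAt_affine (hg j hj _ (hp s hs)) hp
  have hdm : ∀ j < 3, ∀ s ∈ Icc 0 τ, HasDerivWithinAt (fun s => g j (t + (-1) * s))
      ((-1 : ℝ) • g (j + 1) (t + (-1) * s)) (Icc 0 τ) s :=
    fun j hj s hs => hasDerivWithinAt_affine (hg j hj _ (hm s hs)) hm
  have := norm_le_mul_pow_succ (g := fun s : ℝ => g 0 (t + 1 * s) - g 0 (t + (-1) * s)
      - s * (g 1 (t + 1 * s) + g 1 (t + (-1) * s)))
    (g' := fun s => -(s * (g 2 (t + 1 * s) - g 2 (t + (-1) * s)))) (r := τ) (n := 2)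
    (C := 2 * B) (by positivity) (by simp) (fun s hs => ?_) (fun s hs => ?_) τ ⟨hτ, le_rfl⟩
  · simpa [sub_eq_add_neg] using this
  · have hid : HasDerivWithinAt (fun s : ℝ => (s : ℂ)) 1 (Icc 0 τ) s :=
      Complex.ofRealCLM.hasDerivAt.hasDerivWithinAt
    refine (((hdp 0 (by norm_num) s hs).sub (hdm 0 (by norm_num) s hs)).sub
      (hid.mul ((hdp 1 (by norm_num) s hs).add (hdm 1 (by norm_num) s hs)))).congr_deriv ?_
    simp only [one_smul, neg_smul, Pi.add_apply]
    ring
  · have h2 := norm_central_sub_le hg hB hs.1 (by linarith [hs.2]) (by linarith [hs.2])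
      (j := 2) (t := t) (τ := s) (by norm_num)
    rw [norm_neg, norm_mul, Complex.norm_real, Real.norm_of_nonneg hs.1, one_mul, neg_one_mul,
      ← sub_eq_add_neg]
    calc s * ‖g 2 (t + s) - g 2 (t - s)‖ ≤ s * (2 * B * s) := mul_le_mul_of_nonneg_left h2 hs.1
      _ = _ := by ring

end Central
end Taylor

/-! ### Energy of smooth grid functions -/

/-- The discrete `H^(α/2) ⊗ H^(α/2)` norm on grid functions. -/
def gridEnergy (α hx hy : ℝ) (Mx My : ℕ) : Seminorm ℂ (Node Mx → Node My → ℂ) :=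
  energy (formMatrix (diffMatrix α hx Mx) hx) (formMatrix (diffMatrix α hy My) hy)

/-- The discrete two-dimensional Riesz derivative `𝓛ₓ + 𝓛_y`. -/
def gridOp (α hx hy : ℝ) (Mx My : ℕ) : (Node Mx → Node My → ℂ) →ₗ[ℂ] (Node Mx → Node My → ℂ) :=
  -(opX (diffMatrix α hx Mx) + opY (diffMatrix α hy My))

lemma node_mem {a b h : ℝ} {M : ℕ} (hab : a < b) (hM : 0 < M) (hh : h = (b - a) / M) {j : ℕ}
    (hj : j ≤ M) : a + j * h ∈ Icc a b := by
  have hM0 : (0 : ℝ) < M := by exact_mod_cast hM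
  have hj' : (j : ℝ) ≤ M := by exact_mod_cast hj
  have hMh : M * h = b - a := by rw [hh]; field_simp
  have hh0 : 0 < h := by rw [hh]; exact div_pos (by linarith) hM0
  have hj0 : (0 : ℝ) ≤ j := j.cast_nonneg
  constructor <;> nlinarith

lemma node_last {a b h : ℝ} {M : ℕ} (hM : 0 < M) (hh : h = (b - a) / M) : a + M * h = b := by
  have hM0 : (0 : ℝ) < M := by exact_mod_cast hM
  rw [hh]; field_simp; ring

lemma node_mem_Ioo {a b h : ℝ} {M : ℕ} (hab : a < b) (hh : h = (b - a) / M) {j : ℕ}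
    (hj : j ∈ Ioo 0 M) : a + j * h ∈ Ioo a b := by
  have hM0 : (0 : ℝ) < M := by exact_mod_cast hj.1.trans hj.2
  have hMh : M * h = b - a := by rw [hh]; field_simp
  have hh0 : 0 < h := by rw [hh]; exact div_pos (by linarith) hM0
  have h1 : (0 : ℝ) < j := by exact_mod_cast hj.1
  have h2 : (j : ℝ) < M := by exact_mod_cast hj.2
  constructor <;> nlinarith

lemma node_succ_sub (a h : ℝ) (j : ℕ) : a + (j + 1 : ℕ) * h - (a + j * h) = h := by
  push_cast; ring

section Sample
variable {α a b c d hx hy : ℝ} {Mx My : ℕ} (h1 : 1 < α) (h2 : α ≤ 2) (hab : a < b) (hcd : c < d)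
  (hMx : 0 < Mx) (hMy : 0 < My) (ehx : hx = (b - a) / Mx) (ehy : hy = (d - c) / My)
include h1 h2 hab hcd hMx hMy ehx ehy

/-- The energy of a sampled function is controlled by mixed difference quotients, uniformly in the
mesh. -/
lemma gridEnergy_sample_le {W : ℝ → ℝ → ℂ} {m : ℝ} (hm : 0 ≤ m) (hW : BoundedMixed a b c d W m)
    (hx0 : ∀ y ∈ Icc c d, W a y = 0 ∧ W b y = 0) (hy0 : ∀ x ∈ Icc a b, W x c = 0 ∧ W x d = 0) :
    gridEnergy α hx hy Mx My (interior Mx My (sample a c hx hy W))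
      ≤ 3 * √((b - a) * (d - c)) * m := by
  have hMx0 : (0 : ℝ) < Mx := by exact_mod_cast hMx
  have hMy0 : (0 : ℝ) < My := by exact_mod_cast hMy
  have hhx : 0 < hx := by rw [ehx]; exact div_pos (by linarith) hMx0
  have hhy : 0 < hy := by rw [ehy]; exact div_pos (by linarith) hMy0
  have ex := node_last hMx ehx
  have ey := node_last hMy ehy
  set V : ℕ → ℕ → ℂ := fun j k =>
    if j ∈ Ioo 0 Mx ∧ k ∈ Ioo 0 My then sample a c hx hy W j k else 0 with hV
  have hVW : ∀ j ≤ Mx, ∀ k ≤ My, V j k = W (a + j * hx) (c + k * hy) := by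
    intro j hj k hk
    simp only [hV]
    split_ifs with h
    · rfl
    · have hjm := node_mem hab hMx ehx hj
      have hkm := node_mem hcd hMy ehy hk
      have : j = 0 ∨ j = Mx ∨ k = 0 ∨ k = My := by
        simp only [mem_Ioo] at h; omega
      rcases this with rfl | rfl | rfl | rfl
      · simpa using (hx0 _ hkm).1.symm
      · rw [ex]; exact (hx0 _ hkm).2.symm
      · simpa using (hy0 _ hjm).1.symm
      · rw [ey]; exact (hy0 _ hjm).2.symm
  have hint : interior Mx My (sample a c hx hy W) = interior Mx My V := by
    funext i k
    have hi := Finset.mem_Ioo.1 i.2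
    have hk := Finset.mem_Ioo.1 k.2
    simp only [interior, hV]
    rw [if_pos ⟨hi, hk⟩]
  have s0 : ∀ δ : ℝ, Selects 0 1 δ := fun _ => Or.inl ⟨rfl, rfl⟩
  have s1 : ∀ (a h : ℝ) (j : ℕ), 0 < h → Selects 1 h |a + (j + 1 : ℕ) * h - (a + j * h)| :=
    fun a h j hh => Or.inr ⟨rfl, by rw [node_succ_sub, abs_of_pos hh]⟩
  rw [hint]
  have key := energy_interior_le (V := V) (Mx := Mx) (My := My) h1 h2 hhx hhy hm
    (fun k => by simp [hV]) (fun k => by simp [hV]) (fun j => by simp [hV]) (fun j => by simp [hV])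
    (fun j hj k hk => ?_) (fun j hj k hk => ?_) (fun j hj k hk => ?_) (fun j hj k hk => ?_)
  · rw [show (Mx : ℝ) * hx = b - a by linarith, show (My : ℝ) * hy = d - c by linarith] at key
    exact key
  all_goals
    have hj' := node_mem hab hMx ehx hj.le
    have hk' := node_mem hcd hMy ehy hk.le
    have hj1 := node_mem hab hMx ehx (Nat.succ_le_of_lt hj)
    have hk1 := node_mem hcd hMy ehy (Nat.succ_le_of_lt hk)
  · rw [hVW j hj.le k hk.le]
    simpa [corner] using hW _ hj' _ hj' _ hk' _ hk' 0 0 1 1 (s0 _) (s0 _)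
  · rw [hVW j hj.le k hk.le, hVW (j + 1) hj k hk.le]
    simpa [corner] using hW _ hj1 _ hj' _ hk' _ hk' 1 0 hx 1 (s1 a hx j hhx) (s0 _)
  · rw [hVW j hj.le k hk.le, hVW j hj.le (k + 1) hk]
    simpa [corner] using hW _ hj' _ hj' _ hk1 _ hk' 0 1 1 hy (s0 _) (s1 c hy k hhy)
  · rw [hVW j hj.le k hk.le, hVW j hj.le (k + 1) hk, hVW (j + 1) hj k hk.le, hVW (j + 1) hj (k + 1) hk]
    have := hW _ hj1 _ hj' _ hk1 _ hk' 1 1 hx hy (s1 a hx j hhx) (s1 c hy k hhy)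
    unfold corner at this
    rw [one_mul, one_mul, one_mul, ← mul_assoc] at this
    exact this

end Sample

/-! ### Spatial residuals -/

/-- Difference of the fractional centered difference and the Riesz derivative at a node. -/
def lineResidual (α a h : ℝ) (M : ℕ) (f : ℝ → ℂ) (j : ℕ) : ℂ :=
  -((1 / h ^ α : ℝ) : ℂ) * ∑ s ∈ Finset.Ioo 0 M, (coeff α ((j : ℤ) - (s : ℤ)) : ℂ) * f (a + s * h)
    - riesz α f (a + j * h)

/-- Profiles in one variable that depend on the other space variable and on time, with common
bounds for the profiles and for their Lipschitz constants. -/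
structure ProfileFamily (α a b c d T : ℝ) (P : ℝ → ℝ → ℕ → ℝ → ℂ) (B : ℝ) : Prop where
  profile : ∀ z ∈ Icc c d, ∀ t ∈ Icc 0 T, Profile α a b (P z t)
  bound : ∀ z ∈ Icc c d, ∀ t ∈ Icc 0 T, ∀ j ≤ 6, ∀ x ∈ Icc a b, ‖P z t j x‖ ≤ B
  lipschitz : ∀ z ∈ Icc c d, ∀ z' ∈ Icc c d, ∀ t ∈ Icc 0 T, ∀ j ≤ 6, ∀ x ∈ Icc a b,
    ‖(P z t - P z' t) j x‖ ≤ B * |z - z'|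
  lipschitz_time : ∀ z ∈ Icc c d, ∀ t ∈ Icc 0 T, ∀ s ∈ Icc 0 T, ∀ j ≤ 6, ∀ x ∈ Icc a b,
    ‖(P z t - P z s) j x‖ ≤ B * |t - s|
  boundary : ∀ t ∈ Icc 0 T, P c t 0 = 0 ∧ P d t 0 = 0

lemma lineResidual_zero {α a b h : ℝ} {M j : ℕ} (h1 : 1 < α) (h2 : α ≤ 2) (hab : a < b)
    (eh : h = (b - a) / M) (hj : j ∈ Ioo 0 M) : lineResidual α a h M 0 j = 0 := by
  have hp : Profile α a b (fun _ _ => 0) :=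
    ⟨fun _ _ => rfl, fun _ _ _ _ => hasDerivWithinAt_const _ _ _, fun _ => contDiff_const⟩
  have := hp.consistency hab h1 h2 (B := 0) (by simp) eh hj
  rw [mul_zero, zero_mul, norm_le_zero_iff] at this
  exact this

namespace ProfileFamily
variable {α a b c d T B h h' : ℝ} {M M' : ℕ} {P : ℝ → ℝ → ℕ → ℝ → ℂ}
  (hP : ProfileFamily α a b c d T P B)
  (h1 : 1 < α) (h2 : α ≤ 2) (hab : a < b)
  (eh : h = (b - a) / M) {j : ℕ} (hj : j ∈ Ioo 0 M)
include hP h1 h2 hab eh hj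

lemma norm_lineResidual_le {z t : ℝ} (hz : z ∈ Icc c d) (ht : t ∈ Icc 0 T) :
    ‖lineResidual α a h M (P z t 0) j‖ ≤ consistencyConst α a b * B * h ^ 2 :=
  (hP.profile z hz t ht).consistency hab h1 h2 (hP.bound z hz t ht) eh hj

lemma lineResidual_sub {z t z' t' : ℝ} (hz : z ∈ Icc c d) (ht : t ∈ Icc 0 T) (hz' : z' ∈ Icc c d)
    (ht' : t' ∈ Icc 0 T) : lineResidual α a h M ((P z t - P z' t') 0) j
      = lineResidual α a h M (P z t 0) j - lineResidual α a h M (P z' t' 0) j := by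
  have hr := (hP.profile z hz t ht).riesz_sub (hP.profile z' hz' t' ht') hab h1 h2
    (hP.bound z hz t ht) (hP.bound z' hz' t' ht') (node_mem_Ioo hab eh hj)
  unfold lineResidual
  rw [hr]
  simp only [Pi.sub_apply, mul_sub, Finset.sum_sub_distrib]
  ring

lemma norm_lineResidual_sub_le {z t z' t' δ : ℝ} (hz : z ∈ Icc c d) (ht : t ∈ Icc 0 T)
    (hz' : z' ∈ Icc c d) (ht' : t' ∈ Icc 0 T)
    (hδ : ∀ i ≤ 6, ∀ x ∈ Icc a b, ‖(P z t - P z' t') i x‖ ≤ δ) :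
    ‖lineResidual α a h M (P z t 0) j - lineResidual α a h M (P z' t' 0) j‖
      ≤ consistencyConst α a b * δ * h ^ 2 := by
  rw [← hP.lineResidual_sub h1 h2 hab eh hj hz ht hz' ht']
  exact ((hP.profile z hz t ht).sub (hP.profile z' hz' t' ht')).consistency hab h1 h2 hδ eh hj

end ProfileFamily

section Residual
variable {α a b c d T B h h' : ℝ} {M M' : ℕ} {P : ℝ → ℝ → ℕ → ℝ → ℂ}
  (hP : ProfileFamily α a b c d T P B)
  (h1 : 1 < α) (h2 : α ≤ 2) (hab : a < b) (hcd : c < d) (hM : 0 < M) (hM' : 0 < M')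
  (eh : h = (b - a) / M) (eh' : h' = (d - c) / M')
include hP h1 h2 hab hcd hM hM' eh eh'

/-- Bounds for the residuals of a family of profiles as a grid function. In the first index the
difference is bounded trivially, which costs one of the two orders in `h`. -/
lemma ProfileFamily.exists_residual_bounds (hh1 : h ≤ 1) {t : ℝ} (ht : t ∈ Icc 0 T) :
    ∃ V : ℕ → ℕ → ℂ, (∀ j ∈ Ioo 0 M, ∀ k, V j k = lineResidual α a h M (P (c + k * h') t 0) j) ∧
      (∀ k, V 0 k = 0) ∧ (∀ k, V M k = 0) ∧ (∀ j, V j 0 = 0) ∧ (∀ j, V j M' = 0) ∧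
      (∀ j < M, ∀ k < M', ‖V j k‖ ≤ 2 * consistencyConst α a b * B * h) ∧
      (∀ j < M, ∀ k < M', ‖V (j + 1) k - V j k‖ ≤ 2 * consistencyConst α a b * B * h * h) ∧
      (∀ j < M, ∀ k < M', ‖V j (k + 1) - V j k‖ ≤ 2 * consistencyConst α a b * B * h * h') ∧
      (∀ j < M, ∀ k < M', ‖V (j + 1) (k + 1) - V j (k + 1) - (V (j + 1) k - V j k)‖
        ≤ 2 * consistencyConst α a b * B * h * h * h') := by
  have hM0 : (0 : ℝ) < M := by exact_mod_cast hM
  have hM0' : (0 : ℝ) < M' := by exact_mod_cast hM'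
  have hh : 0 < h := by rw [eh]; exact div_pos (by linarith) hM0
  have hh' : 0 < h' := by rw [eh']; exact div_pos (by linarith) hM0'
  have hc : c ∈ Icc c d := left_mem_Icc.2 hcd.le
  have hB0 : 0 ≤ B := (norm_nonneg _).trans
    (hP.bound c hc t ht 0 (by norm_num) a (left_mem_Icc.2 hab.le))
  have hκ := consistencyConst_pos (α := α) hab
  set κ := consistencyConst α a b with hκdef
  have hκB : 0 ≤ κ * B := mul_nonneg hκ.le hB0
  have hh2 : h ^ 2 ≤ h := by nlinarith
  set V : ℕ → ℕ → ℂ := fun j k =>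
    if j ∈ Ioo 0 M then lineResidual α a h M (P (c + k * h') t 0) j else 0 with hV
  have hVin : ∀ j ∈ Ioo 0 M, ∀ k, V j k = lineResidual α a h M (P (c + k * h') t 0) j :=
    fun j hj k => by simp only [hV]; rw [if_pos hj]
  have hVout : ∀ j, j ∉ Ioo 0 M → ∀ k, V j k = 0 := fun j hj k => by simp only [hV]; rw [if_neg hj]
  have hval : ∀ j, ∀ k ≤ M', ‖V j k‖ ≤ κ * B * h ^ 2 := by
    intro j k hk
    by_cases hj : j ∈ Ioo 0 M
    · rw [hVin j hj]
      exact hP.norm_lineResidual_le h1 h2 hab eh hj (node_mem hcd hM' eh' hk) ht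
    · rw [hVout j hj, norm_zero]; positivity
  have hdk : ∀ j, ∀ k < M', ‖V j (k + 1) - V j k‖ ≤ κ * B * h' * h ^ 2 := by
    intro j k hk
    by_cases hj : j ∈ Ioo 0 M
    · rw [hVin j hj, hVin j hj, mul_assoc κ]
      have hk1 := node_mem hcd hM' eh' (Nat.succ_le_of_lt hk)
      have hk0 := node_mem hcd hM' eh' hk.le
      refine hP.norm_lineResidual_sub_le h1 h2 hab eh hj hk1 ht hk0 ht fun i hi x hx => ?_
      have := hP.lipschitz _ hk1 _ hk0 t ht i hi x hx
      rwa [Nat.succ_eq_add_one, node_succ_sub, abs_of_pos hh'] at this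
    · rw [hVout j hj, hVout j hj, sub_zero, norm_zero]; positivity
  have hzero : ∀ j k, P (c + (k : ℕ) * h') t 0 = 0 → V j k = 0 := by
    intro j k hk
    by_cases hj : j ∈ Ioo 0 M
    · rw [hVin j hj, hk, lineResidual_zero h1 h2 hab eh hj]
    · exact hVout j hj k
  refine ⟨V, hVin, hVout 0 (by simp), hVout M (by simp), fun j => hzero j 0 ?_,
    fun j => hzero j M' ?_, fun j hj k hk => ?_, fun j hj k hk => ?_, fun j hj k hk => ?_,
    fun j hj k hk => ?_⟩
  · simpa using (hP.boundary t ht).1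
  · rw [node_last hM' eh']; exact (hP.boundary t ht).2
  · refine (hval j k hk.le).trans ?_
    nlinarith [mul_le_mul_of_nonneg_left hh2 hκB, mul_nonneg hκB hh.le]
  · refine (norm_sub_le _ _).trans ((add_le_add (hval _ k hk.le) (hval _ k hk.le)).trans
      (le_of_eq (by ring)))
  · refine (hdk j k hk).trans ?_
    have := mul_le_mul_of_nonneg_left hh2 (mul_nonneg hκB hh'.le)
    nlinarith [mul_nonneg (mul_nonneg hκB hh'.le) hh.le]
  · have e : V (j + 1) (k + 1) - V j (k + 1) - (V (j + 1) k - V j k)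
        = V (j + 1) (k + 1) - V (j + 1) k - (V j (k + 1) - V j k) := by ring
    rw [e]
    refine (norm_sub_le _ _).trans ((add_le_add (hdk _ k hk) (hdk _ k hk)).trans
      (le_of_eq (by ring)))

/-- In the energy norm the residual is of first order only. -/
lemma ProfileFamily.gridEnergy_residual_le (hh1 : h ≤ 1) {t : ℝ} (ht : t ∈ Icc 0 T) :
    gridEnergy α h h' M M' (fun j k => lineResidual α a h M (P (c + (k : ℕ) * h') t 0) j)
      ≤ 3 * √((b - a) * (d - c)) * (2 * consistencyConst α a b * B * h) := by
  have hM0 : (0 : ℝ) < M := by exact_mod_cast hM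
  have hM0' : (0 : ℝ) < M' := by exact_mod_cast hM'
  have hh : 0 < h := by rw [eh]; exact div_pos (by linarith) hM0
  have hh' : 0 < h' := by rw [eh']; exact div_pos (by linarith) hM0'
  obtain ⟨V, hV, b1, b2, b3, b4, v1, v2, v3, v4⟩ :=
    hP.exists_residual_bounds h1 h2 hab hcd hM hM' eh eh' hh1 ht
  have e : (fun (j : Node M) (k : Node M') => lineResidual α a h M (P (c + (k : ℕ) * h') t 0) j)
      = interior M M' V := by
    funext j k
    exact (hV j (Finset.mem_Ioo.1 j.2) k).symm
  have key := energy_interior_le h1 h2 hh hh'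
    ((norm_nonneg _).trans (v1 0 hM 0 hM')) b1 b2 b3 b4 v1 v2 v3 v4
  have ex := node_last hM eh
  have ey := node_last hM' eh'
  rw [show (M : ℝ) * h = b - a by linarith, show (M' : ℝ) * h' = d - c by linarith] at key
  rw [e]; exact key

/-- The same with the roles of the two grid indices exchanged. -/
lemma ProfileFamily.gridEnergy_residual_le_swap (hh1 : h ≤ 1) {t : ℝ} (ht : t ∈ Icc 0 T) :
    gridEnergy α h' h M' M (fun k j => lineResidual α a h M (P (c + (k : ℕ) * h') t 0) j)
      ≤ 3 * √((d - c) * (b - a)) * (2 * consistencyConst α a b * B * h) := by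
  have hM0 : (0 : ℝ) < M := by exact_mod_cast hM
  have hM0' : (0 : ℝ) < M' := by exact_mod_cast hM'
  have hh : 0 < h := by rw [eh]; exact div_pos (by linarith) hM0
  have hh' : 0 < h' := by rw [eh']; exact div_pos (by linarith) hM0'
  obtain ⟨V, hV, b1, b2, b3, b4, v1, v2, v3, v4⟩ :=
    hP.exists_residual_bounds h1 h2 hab hcd hM hM' eh eh' hh1 ht
  have e : (fun (k : Node M') (j : Node M) => lineResidual α a h M (P (c + (k : ℕ) * h') t 0) j)
      = interior M' M (fun k j => V j k) := by
    funext k j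
    exact (hV j (Finset.mem_Ioo.1 j.2) k).symm
  have key := energy_interior_le (V := fun k j => V j k) h1 h2 hh' hh
    ((norm_nonneg _).trans (v1 0 hM 0 hM')) b3 b4 b1 b2 (fun k hk j hj => v1 j hj k hk)
    (fun k hk j hj => v3 j hj k hk) (fun k hk j hj => v2 j hj k hk)
    (fun k hk j hj => by
      have := v4 j hj k hk
      rw [show V (j + 1) (k + 1) - V (j + 1) k - (V j (k + 1) - V j k)
        = V (j + 1) (k + 1) - V j (k + 1) - (V (j + 1) k - V j k) by ring, mul_right_comm]
      exact this)
  have ex := node_last hM eh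
  have ey := node_last hM' eh'
  rw [show (M : ℝ) * h = b - a by linarith, show (M' : ℝ) * h' = d - c by linarith] at key
  rw [e]; exact key

end Residual

/-! ### The solution on the grid -/

section Solution
variable {α a b c d T B : ℝ} {u₀ : ℝ → ℝ → ℂ} {u : ℝ → ℝ → ℝ → ℂ}
  {D : List (Fin 3) → ℝ → ℝ → ℝ → ℂ}
  (hsol : IsDirichletSolution α a b c d T u₀ u) (hD : Jet a b c d T u D B)
include hsol hD

/-- Time derivatives inherit the homogeneous boundary condition. -/
lemma timeDeriv_boundary {x y : ℝ} (hT : 0 < T) (hx : x ∈ Icc a b) (hy : y ∈ Icc c d)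
    (hxy : ¬ (x ∈ Ioo a b ∧ y ∈ Ioo c d)) {j : ℕ} (hj : j ≤ 3) :
    ∀ t ∈ Icc 0 T, D (List.replicate j 2) x y t = 0 := by
  induction j with
  | zero => intro t ht; show D [] x y t = 0; rw [hD.nil]; exact hsol.vanishes x y hxy t ht
  | succ j ih =>
    intro t ht
    have h1 := hD.derivT (List.replicate j 2) (by simp; omega) x hx y hy t ht
    have h2 : HasDerivWithinAt (fun t => D (List.replicate j 2) x y t) 0 (Icc 0 T) t :=
      (hasDerivWithinAt_const t _ (0 : ℂ)).congr (fun s hs => ih (by omega) s hs) (ih (by omega) t ht)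
    exact (uniqueDiffOn_Icc hT t ht).eq_deriv _ h1 h2

variable (hs : IsSmooth 7 α a b c d T u)
include hs

lemma profileFamily_x : ProfileFamily α a b c d T
    (fun y t i x => D (List.replicate i 0) x y t) B where
  profile y hy t ht :=
    { vanishes := fun x hx => by
        show D [] x y t = 0
        rw [hD.nil]; exact hsol.vanishes x y (fun h => hx h.1) t ht
      deriv := fun j hj x hx => hD.derivX _ (by simp; omega) x hx y hy t ht
      smooth := fun h => by
        show ContDiff ℝ 6 fun x => D [] x y t
        rw [hD.nil, ← contDiffOn_univ]
        exact ((hs.extension h).of_le (by norm_cast)).comp (f := fun x : ℝ => (x, y, t))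
          (by fun_prop) (fun x _ => ⟨mem_univ _, mem_univ _, ht⟩) }
  bound y hy t ht j hj x hx := hD.bound _ (by simp; omega) x hx y hy t ht
  lipschitz y hy y' hy' t ht j hj x hx :=
    hD.norm_sub_le_y (by simpa using hj) hx hy hy' ht
  lipschitz_time y hy t ht s hs j hj x hx :=
    hD.norm_sub_le_t (by simpa using hj) hx hy ht hs
  boundary t ht := by
    constructor <;> funext x <;> show D [] x _ t = 0 <;> rw [hD.nil] <;>
      exact hsol.vanishes x _ (fun h => by have := h.2; simp at this) t ht

lemma profileFamily_y : ProfileFamily α c d a b T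
    (fun x t i y => D (List.replicate i 1) x y t) B where
  profile x hx t ht :=
    { vanishes := fun y hy => by
        show D [] x y t = 0
        rw [hD.nil]; exact hsol.vanishes x y (fun h => hy h.2) t ht
      deriv := fun j hj y hy => hD.derivY _ (by simp; omega) x hx y hy t ht
      smooth := fun h => by
        show ContDiff ℝ 6 fun y => D [] x y t
        rw [hD.nil, ← contDiffOn_univ]
        exact ((hs.extension h).of_le (by norm_cast)).comp (f := fun y : ℝ => (x, y, t))
          (by fun_prop) (fun y _ => ⟨mem_univ _, mem_univ _, ht⟩) }
  bound x hx t ht j hj y hy := hD.bound _ (by simp; omega) x hx y hy t ht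
  lipschitz x hx x' hx' t ht j hj y hy :=
    hD.norm_sub_le_x (by simpa using hj) hx hx' hy ht
  lipschitz_time x hx t ht s hs j hj y hy :=
    hD.norm_sub_le_t (by simpa using hj) hx hy ht hs
  boundary t ht := by
    constructor <;> funext y <;> show D [] _ y t = 0 <;> rw [hD.nil] <;>
      exact hsol.vanishes _ y (fun h => by have := h.1; simp at this) t ht

end Solution

/-! ### The semidiscrete equation -/

lemma gridOp_interior (α hx hy : ℝ) (Mx My : ℕ) (V : ℕ → ℕ → ℂ) (i : Node Mx) (k : Node My) :
    gridOp α hx hy Mx My (interior Mx My V) i k = diffX α hx Mx V i k + diffY α hy My V i k := by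
  have ex : opX (diffMatrix α hx Mx) (interior Mx My V) i k = -diffX α hx Mx V i k := by
    unfold diffX
    rw [neg_mul, neg_neg, Finset.mul_sum]
    refine (Finset.sum_coe_sort (Finset.Ioo 0 Mx) fun s : ℕ =>
      ((1 / hx ^ α * coeff α (((i : ℕ) : ℤ) - (s : ℤ)) : ℝ) : ℂ) * V s k).trans
      (Finset.sum_congr rfl fun s _ => ?_)
    push_cast; ring
  have ey : opY (diffMatrix α hy My) (interior Mx My V) i k = -diffY α hy My V i k := by
    unfold diffY
    rw [neg_mul, neg_neg, Finset.mul_sum]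
    refine (Finset.sum_coe_sort (Finset.Ioo 0 My) fun s : ℕ =>
      ((1 / hy ^ α * coeff α (((k : ℕ) : ℤ) - (s : ℤ)) : ℝ) : ℂ) * V i s).trans
      (Finset.sum_congr rfl fun s _ => ?_)
    push_cast; ring
  simp only [gridOp, LinearMap.neg_apply, LinearMap.add_apply, Pi.neg_apply, Pi.add_apply, ex, ey]
  ring

/-- The spatial residual of the solution at the interior nodes. -/
def residual (α a c hx hy : ℝ) (Mx My : ℕ) (u : ℝ → ℝ → ℝ → ℂ) (t : ℝ) :
    Node Mx → Node My → ℂ := fun i k =>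
  lineResidual α a hx Mx (fun x => u x (c + (k : ℕ) * hy) t) i
    + lineResidual α c hy My (fun y => u (a + (i : ℕ) * hx) y t) k

/-- The two parts of the residual in terms of the space derivatives of `u`, taken as profiles. -/
lemma Jet.residual_eq {a b c d T B : ℝ} {u : ℝ → ℝ → ℝ → ℂ}
    {D : List (Fin 3) → ℝ → ℝ → ℝ → ℂ} (hD : Jet a b c d T u D B) (α hx hy : ℝ) {Mx My : ℕ} (t : ℝ)
    (i : Node Mx) (k : Node My) :
    residual α a c hx hy Mx My u t i k
      = lineResidual α a hx Mx
          ((fun y t i x => D (List.replicate i 0) x y t) (c + (k : ℕ) * hy) t 0) i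
        + lineResidual α c hy My
          ((fun x t i y => D (List.replicate i 1) x y t) (a + (i : ℕ) * hx) t 0) k := by
  show _ = lineResidual α a hx Mx (fun x => D [] x (c + (k : ℕ) * hy) t) i
    + lineResidual α c hy My (fun y => D [] (a + (i : ℕ) * hx) y t) k
  rw [hD.nil]; rfl

section Solution
variable {α a b c d T B : ℝ} {u₀ : ℝ → ℝ → ℂ} {u : ℝ → ℝ → ℝ → ℂ}
  {D : List (Fin 3) → ℝ → ℝ → ℝ → ℂ}
  (hsol : IsDirichletSolution α a b c d T u₀ u) (hs : IsSmooth 7 α a b c d T u)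
  (hD : Jet a b c d T u D B)
  {hx hy : ℝ} {Mx My : ℕ} (h1 : 1 < α) (h2 : α ≤ 2) (hab : a < b) (hcd : c < d)
  (hMx : 0 < Mx) (hMy : 0 < My) (ehx : hx = (b - a) / Mx) (ehy : hy = (d - c) / My)
include hsol hs hD h1 h2 hab hcd hMx hMy ehx ehy

/-- The constant in the bounds for the residual. -/
def residualConst (α a b c d B : ℝ) : ℝ :=
  (consistencyConst α a b + consistencyConst α c d) * B

omit hMx hMy in
lemma norm_residual_le {t : ℝ} (ht : t ∈ Icc 0 T) (i : Node Mx) (k : Node My) :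
    ‖residual α a c hx hy Mx My u t i k‖ ≤ residualConst α a b c d B * (hx ^ 2 + hy ^ 2) := by
  have hi := Finset.mem_Ioo.1 i.2
  have hk := Finset.mem_Ioo.1 k.2
  have hxi := Ioo_subset_Icc_self (node_mem_Ioo hab ehx hi)
  have hyk := Ioo_subset_Icc_self (node_mem_Ioo hcd ehy hk)
  have hB0 : 0 ≤ B := (norm_nonneg _).trans (hD.bound [] (by simp) _ hxi _ hyk t ht)
  have a1 := consistencyConst_pos (α := α) hab
  have a2 := consistencyConst_pos (α := α) hcd
  rw [hD.residual_eq]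
  have e1 := (profileFamily_x hsol hD hs).norm_lineResidual_le h1 h2 hab ehx hi hyk ht
  have e2 := (profileFamily_y hsol hD hs).norm_lineResidual_le h1 h2 hcd ehy hk hxi ht
  refine (norm_add_le _ _).trans ((add_le_add e1 e2).trans ?_)
  have b1 := mul_nonneg (mul_nonneg a1.le hB0) (sq_nonneg hy)
  have b2 := mul_nonneg (mul_nonneg a2.le hB0) (sq_nonneg hx)
  unfold residualConst
  nlinarith

omit hMx hMy in
lemma norm_residual_sub_le {s t : ℝ} (ht : t ∈ Icc 0 T) (hs' : s ∈ Icc 0 T) (i : Node Mx)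
    (k : Node My) : ‖residual α a c hx hy Mx My u t i k - residual α a c hx hy Mx My u s i k‖
      ≤ residualConst α a b c d B * (hx ^ 2 + hy ^ 2) * |t - s| := by
  have hi := Finset.mem_Ioo.1 i.2
  have hk := Finset.mem_Ioo.1 k.2
  have hxi := Ioo_subset_Icc_self (node_mem_Ioo hab ehx hi)
  have hyk := Ioo_subset_Icc_self (node_mem_Ioo hcd ehy hk)
  have hB0 : 0 ≤ B := (norm_nonneg _).trans (hD.bound [] (by simp) _ hxi _ hyk t ht)
  have a1 := consistencyConst_pos (α := α) hab
  have a2 := consistencyConst_pos (α := α) hcd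
  have px := profileFamily_x hsol hD hs
  have py := profileFamily_y hsol hD hs
  rw [hD.residual_eq,
    hD.residual_eq]
  have e1 := px.norm_lineResidual_sub_le h1 h2 hab ehx hi hyk ht hyk hs'
    (px.lipschitz_time _ hyk t ht s hs')
  have e2 := py.norm_lineResidual_sub_le h1 h2 hcd ehy hk hxi ht hxi hs'
    (py.lipschitz_time _ hxi t ht s hs')
  rw [add_sub_add_comm]
  refine (norm_add_le _ _).trans ((add_le_add e1 e2).trans ?_)
  have b1 := mul_nonneg (mul_nonneg (mul_nonneg a1.le hB0) (sq_nonneg hy)) (abs_nonneg (t - s))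
  have b2 := mul_nonneg (mul_nonneg (mul_nonneg a2.le hB0) (sq_nonneg hx)) (abs_nonneg (t - s))
  unfold residualConst
  nlinarith

lemma gridEnergy_residual_le (hhx : hx ≤ 1) (hhy : hy ≤ 1) {t : ℝ} (ht : t ∈ Icc 0 T) :
    gridEnergy α hx hy Mx My (residual α a c hx hy Mx My u t)
      ≤ 6 * √((b - a) * (d - c)) * residualConst α a b c d B * (hx + hy) := by
  have hMx0 : (0 : ℝ) < Mx := by exact_mod_cast hMx
  have hMy0 : (0 : ℝ) < My := by exact_mod_cast hMy
  have hhx0 : 0 < hx := by rw [ehx]; exact div_pos (by linarith) hMx0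
  have hhy0 : 0 < hy := by rw [ehy]; exact div_pos (by linarith) hMy0
  have hB0 : 0 ≤ B := (norm_nonneg _).trans (hD.bound [] (by simp) _ (left_mem_Icc.2 hab.le) _
    (left_mem_Icc.2 hcd.le) t ht)
  have a1 := consistencyConst_pos (α := α) hab
  have a2 := consistencyConst_pos (α := α) hcd
  have e1 := (profileFamily_x hsol hD hs).gridEnergy_residual_le h1 h2 hab hcd hMx hMy ehx ehy hhx ht
  have e2 := (profileFamily_y hsol hD hs).gridEnergy_residual_le_swap h1 h2 hcd hab hMy hMx ehy ehx
    hhy ht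
  have e : residual α a c hx hy Mx My u t
      = (fun (i : Node Mx) (k : Node My) => lineResidual α a hx Mx
          ((fun y t i x => D (List.replicate i 0) x y t) (c + (k : ℕ) * hy) t 0) i)
        + (fun (i : Node Mx) (k : Node My) => lineResidual α c hy My
          ((fun x t i y => D (List.replicate i 1) x y t) (a + (i : ℕ) * hx) t 0) k) := by
    funext i k
    exact hD.residual_eq α hx hy t i k
  rw [e]
  refine (map_add_le_add _ _ _).trans ((add_le_add e1 e2).trans ?_)
  have hS : 0 ≤ √((b - a) * (d - c)) := Real.sqrt_nonneg _
  have b1 := mul_nonneg hS (mul_nonneg (mul_nonneg a1.le hB0) hhy0.le)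
  have b2 := mul_nonneg hS (mul_nonneg (mul_nonneg a2.le hB0) hhx0.le)
  unfold residualConst
  nlinarith

/-- The equation at the interior nodes. At `t = 0` and `t = T` it follows by continuity in time. -/
lemma semidiscrete_equation (hT : 0 < T) {t : ℝ} (ht : t ∈ Icc 0 T) :
    Complex.I • interior Mx My (sample a c hx hy fun x y => D [2] x y t)
      + gridOp α hx hy Mx My (interior Mx My (sample a c hx hy fun x y => u x y t))
      + interior Mx My (sample a c hx hy fun x y => u x y t)
        * star (interior Mx My (sample a c hx hy fun x y => u x y t))
        * interior Mx My (sample a c hx hy fun x y => u x y t)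
      = residual α a c hx hy Mx My u t := by
  funext i k
  have hi := Finset.mem_Ioo.1 i.2
  have hk := Finset.mem_Ioo.1 k.2
  have hxi := node_mem_Ioo hab ehx hi
  have hyk := node_mem_Ioo hcd ehy hk
  have hxm : ∀ s ≤ Mx, a + (s : ℕ) * hx ∈ Icc a b := fun s hs => node_mem hab hMx ehx hs
  have hym : ∀ s ≤ My, c + (s : ℕ) * hy ∈ Icc c d := fun s hs => node_mem hcd hMy ehy hs
  have hct : ∀ w : List (Fin 3), w.length ≤ 6 → ∀ x ∈ Icc a b, ∀ y ∈ Icc c d,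
      ContinuousOn (fun t => D w x y t) (Icc 0 T) := fun w hw x hx y hy t ht =>
    (hD.derivT w hw x hx y hy t ht).continuousWithinAt
  have hcu : ∀ x ∈ Icc a b, ∀ y ∈ Icc c d, ContinuousOn (fun t => u x y t) (Icc 0 T) := by
    intro x hx y hy
    have := hct [] (by simp) x hx y hy
    rwa [hD.nil] at this
  set f : ℝ → ℂ := fun t => Complex.I * D [2] (a + (i : ℕ) * hx) (c + (k : ℕ) * hy) t
      + (diffX α hx Mx (sample a c hx hy fun x y => u x y t) i k
        + diffY α hy My (sample a c hx hy fun x y => u x y t) i k)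
      + ((‖u (a + (i : ℕ) * hx) (c + (k : ℕ) * hy) t‖ ^ 2 : ℝ) : ℂ)
        * u (a + (i : ℕ) * hx) (c + (k : ℕ) * hy) t with hf
  have hfc : ContinuousOn f (Icc 0 T) := by
    have hu := hcu _ (Ioo_subset_Icc_self hxi) _ (Ioo_subset_Icc_self hyk)
    have h2 := hct [2] (by simp) _ (Ioo_subset_Icc_self hxi) _ (Ioo_subset_Icc_self hyk)
    refine ((continuousOn_const.mul h2).add (ContinuousOn.add ?_ ?_)).add
      ((Complex.continuous_ofReal.comp_continuousOn (hu.norm.pow 2)).mul hu)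
    · refine continuousOn_const.mul (continuousOn_finsetSum _ fun s hs => ?_)
      exact continuousOn_const.mul
        (hcu _ (hxm s (Finset.mem_Ioo.1 hs).2.le) _ (Ioo_subset_Icc_self hyk))
    · refine continuousOn_const.mul (continuousOn_finsetSum _ fun s hs => ?_)
      exact continuousOn_const.mul
        (hcu _ (Ioo_subset_Icc_self hxi) _ (hym s (Finset.mem_Ioo.1 hs).2.le))
  have hgc : ContinuousOn (fun t => residual α a c hx hy Mx My u t i k) (Icc 0 T) := by
    refine (LipschitzOnWith.of_dist_le_mul
      (K := (residualConst α a b c d B * (hx ^ 2 + hy ^ 2)).toNNReal) fun t ht s hs' => ?_).continuousOn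
    rw [dist_eq_norm, Real.dist_eq]
    exact (norm_residual_sub_le hsol hs hD h1 h2 hab hcd ehx ehy ht hs' i k).trans
      (mul_le_mul_of_nonneg_right (Real.le_coe_toNNReal _) (abs_nonneg _))
  have hEq : EqOn f (fun t => residual α a c hx hy Mx My u t i k) (Ioo 0 T) := by
    intro t ht
    have heq := hsol.equation _ hxi _ hyk t ht
    have hd : deriv (fun s => u (a + (i : ℕ) * hx) (c + (k : ℕ) * hy) s) t
        = D [2] (a + (i : ℕ) * hx) (c + (k : ℕ) * hy) t := by
      have := (hD.derivT [] (by simp) _ (Ioo_subset_Icc_self hxi) _ (Ioo_subset_Icc_self hyk) t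
        (Ioo_subset_Icc_self ht)).hasDerivAt (Icc_mem_nhds ht.1 ht.2)
      rw [hD.nil] at this
      exact this.deriv
    rw [hd] at heq
    simp only [hf, residual, lineResidual, diffX, diffY, sample]
    linear_combination heq
  have hfin := hEq.of_subset_closure hfc hgc Ioo_subset_Icc_self
    (by rw [closure_Ioo hT.ne]) ht
  refine Eq.trans ?_ hfin
  simp only [hf, Pi.add_apply, Pi.smul_apply, Pi.mul_apply, Pi.star_apply, gridOp_interior,
    smul_eq_mul, Complex.ofReal_pow, ← Complex.mul_conj']
  rfl

end Solution

/-! ### Time discretization errors in the energy norm -/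

section TimeErrors
variable {α a b c d T B : ℝ} {u₀ : ℝ → ℝ → ℂ} {u : ℝ → ℝ → ℝ → ℂ}
  {D : List (Fin 3) → ℝ → ℝ → ℝ → ℂ} (hD : Jet a b c d T u D B)
include hD

/-- Differences in space commute with time derivatives, so that Taylor's formula in time applies to
each of them, with its own bound. -/
lemma Jet.corner_chain {x x' y y' : ℝ} (hx : x ∈ Icc a b) (hx' : x' ∈ Icc a b)
    (hy : y ∈ Icc c d) (hy' : y' ∈ Icc c d) (e₁ e₂ : ℂ) : ∀ j < 3, ∀ t ∈ Icc 0 T,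
    HasDerivWithinAt (fun t => corner e₁ e₂ x x' y y' fun x y => D (List.replicate j 2) x y t)
      (corner e₁ e₂ x x' y y' fun x y => D (List.replicate (j + 1) 2) x y t) (Icc 0 T) t := by
  intro j hj t ht
  have h : ∀ x ∈ Icc a b, ∀ y ∈ Icc c d, HasDerivWithinAt (fun t => D (List.replicate j 2) x y t)
      (D (List.replicate (j + 1) 2) x y t) (Icc 0 T) t := fun x hx y hy =>
    hD.derivT _ (by simp; omega) x hx y hy t ht
  exact ((h x hx y hy).sub ((h x' hx' y hy).const_mul e₁)).sub
    (((h x hx y' hy').sub ((h x' hx' y' hy').const_mul e₁)).const_mul e₂)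

lemma Jet.corner_bound {x x' y y' : ℝ} (hx : x ∈ Icc a b) (hx' : x' ∈ Icc a b)
    (hy : y ∈ Icc c d) (hy' : y' ∈ Icc c d) {e₁ e₂ : ℂ} {ω₁ ω₂ : ℝ} (h₁ : Selects e₁ ω₁ |x - x'|)
    (h₂ : Selects e₂ ω₂ |y - y'|) : ∀ j ≤ 3, ∀ t ∈ Icc 0 T,
    ‖corner e₁ e₂ x x' y y' fun x y => D (List.replicate j 2) x y t‖ ≤ B * (ω₁ * ω₂) :=
  fun _ hj _ ht => hD.boundedMixed (by simp; omega) ht x hx x' hx' y hy y' hy' e₁ e₂ ω₁ ω₂ h₁ h₂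

lemma Jet.boundedMixed_first_step {τ : ℝ} (hτ : 0 ≤ τ) (hτT : τ ≤ T) :
    BoundedMixed a b c d (fun x y => u x y τ - u x y 0 - τ * D [2] x y 0) (B * τ ^ 2) := by
  intro x hx x' hx' y hy y' hy' e₁ e₂ ω₁ ω₂ h₁ h₂
  have := norm_first_step_le (hD.corner_chain hx hx' hy hy' e₁ e₂)
    (hD.corner_bound hx hx' hy hy' h₁ h₂) hτ hτT
  rw [← hD.nil]
  calc _ = _ := by
        congr 1
        simp only [corner, List.replicate_zero, List.replicate_succ]
        ring
    _ ≤ _ := this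
    _ = _ := by ring

variable {t τ : ℝ} (hτ : 0 ≤ τ) (hl : 0 ≤ t - τ) (hr : t + τ ≤ T)
include hτ hl hr

lemma Jet.boundedMixed_central :
    BoundedMixed a b c d (fun x y => u x y (t + τ) - u x y (t - τ)) (2 * B * τ) := by
  intro x hx x' hx' y hy y' hy' e₁ e₂ ω₁ ω₂ h₁ h₂
  have := norm_central_sub_le (hD.corner_chain hx hx' hy hy' e₁ e₂)
    (hD.corner_bound hx hx' hy hy' h₁ h₂) hτ hl hr (j := 0) (by norm_num)
  rw [← hD.nil]
  calc _ = _ := by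
        congr 1
        simp only [corner, List.replicate_zero]
        ring
    _ ≤ _ := this
    _ = _ := by ring

lemma Jet.boundedMixed_second : BoundedMixed a b c d
    (fun x y => u x y (t + τ) + u x y (t - τ) - 2 * u x y t) (2 * B * τ ^ 2) := by
  intro x hx x' hx' y hy y' hy' e₁ e₂ ω₁ ω₂ h₁ h₂
  have := norm_central_second_le (hD.corner_chain hx hx' hy hy' e₁ e₂)
    (hD.corner_bound hx hx' hy hy' h₁ h₂) hτ hl hr
  rw [← hD.nil]
  calc _ = _ := by
        congr 1
        simp only [corner, List.replicate_zero]
        ring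
    _ ≤ _ := this
    _ = _ := by ring

lemma Jet.boundedMixed_trapezoid : BoundedMixed a b c d (fun x y => u x y (t + τ) - u x y (t - τ)
    - τ * (D [2] x y (t + τ) + D [2] x y (t - τ))) (2 * B * τ ^ 3) := by
  intro x hx x' hx' y hy y' hy' e₁ e₂ ω₁ ω₂ h₁ h₂
  have := norm_trapezoid_le (hD.corner_chain hx hx' hy hy' e₁ e₂)
    (hD.corner_bound hx hx' hy hy' h₁ h₂) hτ hl hr
  rw [← hD.nil]
  calc _ = _ := by
        congr 1
        simp only [corner, List.replicate_zero, List.replicate_succ]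
        ring
    _ ≤ _ := this
    _ = _ := by ring

end TimeErrors

/-- The linearization of the cubic term at the middle of a time step is of second order. -/
lemma cubic_consistency {ι κ : Type} {N : Seminorm ℂ (ι → κ → ℂ)} {K R δ : ℝ} (hK : 0 ≤ K)
    (hmul : ∀ v w, N (v * w) ≤ K * N v * N w) (hstar : ∀ v, N (star v) = N v)
    {p m v : ι → κ → ℂ} (hp : N p ≤ R) (hm : N m ≤ R) (hv : N v ≤ R)
    (h1 : N (p - m) ≤ 2 * R * δ) (h2 : N (p + m - (2 : ℂ) • v) ≤ 2 * R * δ ^ 2) :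
    N (p * star p * p + m * star m * m - v * star v * (p + m)) ≤ 12 * K ^ 2 * R ^ 3 * δ ^ 2 := by
  have hR : 0 ≤ R := (apply_nonneg N v).trans hv
  have hmul' : ∀ {x y : ι → κ → ℂ} {X Y : ℝ}, N x ≤ X → N y ≤ Y → N (x * y) ≤ K * X * Y := by
    intro x y X Y hx hy
    refine (hmul x y).trans ?_
    have := apply_nonneg N x
    have := apply_nonneg N y
    gcongr
    exact mul_nonneg hK ((apply_nonneg N x).trans hx)
  have hhalf : ∀ x : ι → κ → ℂ, N ((1 / 2 : ℂ) • x) = N x / 2 := fun x => by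
    rw [map_smul_eq_mul]; norm_num; ring
  set s := p + m - (2 : ℂ) • v with hs
  have hpm : N (p + m) ≤ 2 * R := (map_add_le_add N p m).trans (by linarith)
  have e : p * star p * p + m * star m * m - v * star v * (p + m)
      = (1 / 2 : ℂ) • (((1 / 2 : ℂ) • (s * star (p + m)) + v * star s
          + (1 / 2 : ℂ) • ((p - m) * star (p - m))) * (p + m))
        + (1 / 2 : ℂ) • (((1 / 2 : ℂ) • ((p - m) * star (p + m) + (p + m) * star (p - m)))
          * (p - m)) := by
    funext i j
    simp only [hs, Pi.add_apply, Pi.sub_apply, Pi.mul_apply, Pi.smul_apply, Pi.star_apply, star_add,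
      star_sub, star_smul, smul_eq_mul, RCLike.star_def, map_ofNat]
    ring
  have a1 : N ((1 / 2 : ℂ) • (s * star (p + m))) ≤ K * (2 * R * δ ^ 2) * (2 * R) / 2 := by
    rw [hhalf]
    have := hmul' h2 ((hstar (p + m)).trans_le hpm)
    linarith
  have a2 : N (v * star s) ≤ K * R * (2 * R * δ ^ 2) := hmul' hv ((hstar s).trans_le h2)
  have a3 : N ((1 / 2 : ℂ) • ((p - m) * star (p - m))) ≤ K * (2 * R * δ) * (2 * R * δ) / 2 := by
    rw [hhalf]
    have := hmul' h1 ((hstar (p - m)).trans_le h1)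
    linarith
  have a4 : N ((1 / 2 : ℂ) • ((p - m) * star (p + m) + (p + m) * star (p - m)))
      ≤ K * (2 * R * δ) * (2 * R) := by
    rw [hhalf]
    have b1 := hmul' h1 ((hstar (p + m)).trans_le hpm)
    have b2 := hmul' hpm ((hstar (p - m)).trans_le h1)
    have := map_add_le_add N ((p - m) * star (p + m)) ((p + m) * star (p - m))
    nlinarith
  have a5 : N ((1 / 2 : ℂ) • (s * star (p + m)) + v * star s
      + (1 / 2 : ℂ) • ((p - m) * star (p - m))) ≤ 6 * K * R ^ 2 * δ ^ 2 := by
    have b1 := map_add_le_add N ((1 / 2 : ℂ) • (s * star (p + m)) + v * star s)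
      ((1 / 2 : ℂ) • ((p - m) * star (p - m)))
    have b2 := map_add_le_add N ((1 / 2 : ℂ) • (s * star (p + m))) (v * star s)
    calc _ ≤ K * (2 * R * δ ^ 2) * (2 * R) / 2 + K * R * (2 * R * δ ^ 2)
          + K * (2 * R * δ) * (2 * R * δ) / 2 := by linarith
      _ = _ := by ring
  have c1 := hmul' a5 hpm
  have c2 := hmul' a4 h1
  rw [e]
  refine (map_add_le_add N _ _).trans ?_
  rw [hhalf, hhalf]
  have : 0 ≤ K ^ 2 * R ^ 3 * δ ^ 2 := by positivity
  nlinarith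

/-! ### Properties of the energy norm of the grid -/

section GridEnergy
variable {α hx hy : ℝ} {Mx My : ℕ} (h1 : 1 < α) (h2 : α ≤ 2) (hhx : 0 < hx) (hhy : 0 < hy)
include h1 h2 hhx hhy

lemma norm_le_gridEnergy (v : Node Mx → Node My → ℂ) (i : Node Mx) (j : Node My) :
    ‖v i j‖ ≤ √(1 / (α - 1) * (1 / (α - 1))) * gridEnergy α hx hy Mx My v :=
  have hC : 0 ≤ 1 / (α - 1) := div_nonneg zero_le_one (by linarith)
  norm_le_energy (isDirichletOp_diffMatrix h1 h2 hhx Mx) (isDirichletOp_diffMatrix h1 h2 hhy My)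
    hC hC v i j

lemma gridEnergy_mul_le (v w : Node Mx → Node My → ℂ) : gridEnergy α hx hy Mx My (v * w)
    ≤ 4 * √(1 / (α - 1) * (1 / (α - 1))) * gridEnergy α hx hy Mx My v
      * gridEnergy α hx hy Mx My w :=
  have hC : 0 ≤ 1 / (α - 1) := div_nonneg zero_le_one (by linarith)
  energy_mul_le (isDirichletOp_diffMatrix h1 h2 hhx Mx) (isDirichletOp_diffMatrix h1 h2 hhy My)
    hC hC v w

lemma gridEnergy_star (v : Node Mx → Node My → ℂ) :
    gridEnergy α hx hy Mx My (star v) = gridEnergy α hx hy Mx My v :=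
  energy_star (isDirichletOp_diffMatrix h1 h2 hhx Mx) (isDirichletOp_diffMatrix h1 h2 hhy My) v

lemma gridEnergy_step {τ : ℝ} {p m F : Node Mx → Node My → ℂ} (hτ : 0 ≤ τ)
    (heq : p - m = (τ : ℂ) • (Complex.I • gridOp α hx hy Mx My (p + m) + F)) :
    gridEnergy α hx hy Mx My p ≤ gridEnergy α hx hy Mx My m + τ * gridEnergy α hx hy Mx My F := by
  refine energy_step (isDirichletOp_diffMatrix h1 h2 hhx Mx)
    (isDirichletOp_diffMatrix h1 h2 hhy My) hτ ?_
  rw [heq, gridOp, LinearMap.neg_apply, smul_neg, neg_smul, LinearMap.add_apply]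

lemma exists_sub_gridOp_eq (r : Node Mx → Node My → ℂ) :
    ∃ η : Node Mx → Node My → ℂ, η - gridOp α hx hy Mx My η = r := by
  have hC : 0 ≤ 1 / (α - 1) := div_nonneg zero_le_one (by linarith)
  obtain ⟨η, hη⟩ := exists_elliptic (isDirichletOp_diffMatrix h1 h2 hhx Mx)
    (isDirichletOp_diffMatrix h1 h2 hhy My) hC hC r
  refine ⟨η, ?_⟩
  rw [← hη, gridOp, LinearMap.neg_apply, sub_neg_eq_add, LinearMap.add_apply]

end GridEnergy

/-- Solutions of the elliptic problem are as small in the energy norm as the right-hand side is in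
the maximum norm. -/
lemma gridEnergy_elliptic_le {α a b c d hx hy : ℝ} {Mx My : ℕ} (h1 : 1 < α) (h2 : α ≤ 2)
    (hab : a < b) (hcd : c < d) (hMx : 0 < Mx) (hMy : 0 < My) (ehx : hx = (b - a) / Mx)
    (ehy : hy = (d - c) / My) {η r : Node Mx → Node My → ℂ} {ρ : ℝ} (hρ : 0 ≤ ρ)
    (hη : η - gridOp α hx hy Mx My η = r) (hr : ∀ i j, ‖r i j‖ ≤ ρ) :
    gridEnergy α hx hy Mx My η ≤ √((b - a) * (d - c)) * ρ := by
  have hMx0 : (0 : ℝ) < Mx := by exact_mod_cast hMx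
  have hMy0 : (0 : ℝ) < My := by exact_mod_cast hMy
  have hhx0 : 0 < hx := by rw [ehx]; exact div_pos (by linarith) hMx0
  have hhy0 : 0 < hy := by rw [ehy]; exact div_pos (by linarith) hMy0
  have hη' : η + (opX (diffMatrix α hx Mx) η + opY (diffMatrix α hy My) η) = r := by
    rw [← hη]; simp [gridOp, sub_eq_add_neg]
  have key := energy_sq_le_of_elliptic (isDirichletOp_diffMatrix h1 h2 hhx0 Mx)
    (isDirichletOp_diffMatrix h1 h2 hhy0 My) hη'
  have hcard : ∀ M : ℕ, Fintype.card (Node M) ≤ M := fun M => by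
    rw [Fintype.card_coe, Nat.card_Ioo]; omega
  have hsum : ∑ i, ∑ j, ‖r i j‖ ^ 2 ≤ Mx * (My * ρ ^ 2) := by
    calc ∑ i, ∑ j, ‖r i j‖ ^ 2 ≤ ∑ _i : Node Mx, ∑ _j : Node My, ρ ^ 2 :=
          Finset.sum_le_sum fun i _ => Finset.sum_le_sum fun j _ =>
            pow_le_pow_left₀ (norm_nonneg _) (hr i j) 2
      _ = Fintype.card (Node Mx) * (Fintype.card (Node My) * ρ ^ 2) := by
          simp only [Finset.sum_const, Finset.card_univ, nsmul_eq_mul]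
      _ ≤ _ := by
          gcongr
          · exact hcard Mx
          · exact hcard My
  have e : (√((b - a) * (d - c)) * ρ) ^ 2 = hx * hy * (Mx * (My * ρ ^ 2)) := by
    rw [mul_pow, Real.sq_sqrt (mul_nonneg (by linarith) (by linarith)), ehx, ehy]
    field_simp
  refine abs_le_of_sq_le_sq' ?_ (by positivity) |>.2
  rw [e]
  exact key.trans (mul_le_mul_of_nonneg_left hsum (by positivity))

/-! ### The scheme as a system of equations on the interior nodes -/

section Scheme
variable {α a c hx hy τ : ℝ} {Mx My N : ℕ} {u₀ : ℝ → ℝ → ℂ} {U : ℕ → ℕ → ℕ → ℂ}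
  (hU : IsSchemeSolution α a c hx hy τ Mx My N u₀ U)
include hU

/-- The scheme as an implicit midpoint step with step length `τ` for the sum of both ends. -/
lemma IsSchemeSolution.interior_step (hτ : τ ≠ 0) {n : ℕ} (hn : n + 2 ≤ N) :
    interior Mx My (U (n + 2)) - interior Mx My (U n)
      = (τ : ℂ) • (Complex.I • gridOp α hx hy Mx My (interior Mx My (U (n + 2)) + interior Mx My (U n))
        + Complex.I • (interior Mx My (U (n + 1)) * star (interior Mx My (U (n + 1)))
          * (interior Mx My (U (n + 2)) + interior Mx My (U n)))) := by
  funext i k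
  have hs := hU.step (n + 1) (by omega) (by omega) i (Finset.mem_Ioo.1 i.2) k (Finset.mem_Ioo.1 k.2)
  have hτ' : (τ : ℂ) ≠ 0 := Complex.ofReal_ne_zero.2 hτ
  have hss := congrArg (fun z => (τ : ℂ) * z) hs
  rw [map_add]
  simp only [Pi.add_apply, Pi.sub_apply, Pi.smul_apply, Pi.mul_apply, Pi.star_apply,
    gridOp_interior, smul_eq_mul]
  simp only [Nat.add_sub_cancel, Complex.ofReal_pow, ← Complex.mul_conj', Complex.ofReal_div,
    Complex.ofReal_one] at hss
  simp only [interior, RCLike.star_def]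
  have hcancel : (τ : ℂ) * (1 / τ) = 1 := by field_simp
  linear_combination hss + (U n i k - U (n + 2) i k) * hcancel

lemma IsSchemeSolution.interior_initial {u : ℝ → ℝ → ℝ → ℂ} {b d T : ℝ} (hab : a < b) (hcd : c < d)
    (ehx : hx = (b - a) / Mx) (ehy : hy = (d - c) / My)
    (hsol : IsDirichletSolution α a b c d T u₀ u) :
    interior Mx My (sample a c hx hy u₀) = interior Mx My (sample a c hx hy fun x y => u x y 0) ∧
      interior Mx My (U 0) = interior Mx My (sample a c hx hy u₀) := by
  constructor
  · funext i k
    exact (hsol.initial _ (Ioo_subset_Icc_self (node_mem_Ioo hab ehx (Finset.mem_Ioo.1 i.2))) _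
      (Ioo_subset_Icc_self (node_mem_Ioo hcd ehy (Finset.mem_Ioo.1 k.2)))).symm
  · funext i k
    exact hU.initial i (Finset.mem_Ioo.1 i.2) k (Finset.mem_Ioo.1 k.2)

lemma IsSchemeSolution.interior_firstStep {v : Node Mx → Node My → ℂ}
    (hv : interior Mx My (sample a c hx hy u₀) = v) (h0 : interior Mx My (U 0) = v) :
    interior Mx My (U 1) = v + (τ : ℂ) • (Complex.I • gridOp α hx hy Mx My v
      + Complex.I • (v * star v * v)) := by
  subst hv
  funext i k
  have hs := hU.firstStep i (Finset.mem_Ioo.1 i.2) k (Finset.mem_Ioo.1 k.2)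
  have h0' := congrFun (congrFun h0 i) k
  simp only [Pi.add_apply, Pi.smul_apply, Pi.mul_apply, Pi.star_apply, gridOp_interior, smul_eq_mul]
  simp only [interior, RCLike.star_def, Complex.mul_conj'] at h0' ⊢
  rw [hs, h0', Complex.ofReal_pow]
  ring

end Scheme

/-! ### Convergence -/

section Convergence
variable {α a b c d T B : ℝ} {u₀ : ℝ → ℝ → ℂ} {u : ℝ → ℝ → ℝ → ℂ}
  {D : List (Fin 3) → ℝ → ℝ → ℝ → ℂ}
  (hsol : IsDirichletSolution α a b c d T u₀ u) (hs : IsSmooth 7 α a b c d T u)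
  (hD : Jet a b c d T u D B)
  {hx hy : ℝ} {Mx My : ℕ} (h1 : 1 < α) (h2 : α ≤ 2) (hab : a < b) (hcd : c < d) (hT : 0 < T)
  (hMx : 0 < Mx) (hMy : 0 < My) (ehx : hx = (b - a) / Mx) (ehy : hy = (d - c) / My)
include hsol hD h1 h2 hab hcd hT hMx hMy ehx ehy

/-- Bounds on differences give energy bounds for functions built from time derivatives of `u`. -/
lemma gridEnergy_le_of_boundary {W : ℝ → ℝ → ℂ} {m : ℝ} (hm : 0 ≤ m)
    (hW : BoundedMixed a b c d W m)
    (hW0 : ∀ x y, (∀ j ≤ 3, ∀ t ∈ Icc 0 T, D (List.replicate j 2) x y t = 0) → W x y = 0) :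
    gridEnergy α hx hy Mx My (interior Mx My (sample a c hx hy W))
      ≤ 3 * √((b - a) * (d - c)) * m := by
  have ha := left_mem_Icc.2 hab.le
  have hb := right_mem_Icc.2 hab.le
  have hc := left_mem_Icc.2 hcd.le
  have hd := right_mem_Icc.2 hcd.le
  refine gridEnergy_sample_le h1 h2 hab hcd hMx hMy ehx ehy hm hW (fun y hy => ⟨?_, ?_⟩)
    (fun x hx => ⟨?_, ?_⟩) <;> refine hW0 _ _ fun j hj => ?_
  · exact timeDeriv_boundary hsol hD hT ha hy (by simp) hj
  · exact timeDeriv_boundary hsol hD hT hb hy (by simp) hj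
  · exact timeDeriv_boundary hsol hD hT hx hc (by simp) hj
  · exact timeDeriv_boundary hsol hD hT hx hd (by simp) hj

variable (hhx : hx ≤ 1) (hhy : hy ≤ 1) {τ : ℝ} (hτ : 0 < τ)
include hs hτ

/-- Consistency of one time step of the solution, with the spatial residuals still present. -/
lemma exists_step_residual {R K : ℝ} (hR : R = 3 * √((b - a) * (d - c)) * B) (hK : 0 ≤ K)
    (hmul : ∀ v w, gridEnergy α hx hy Mx My (v * w)
      ≤ K * gridEnergy α hx hy Mx My v * gridEnergy α hx hy Mx My w)
    (hstar : ∀ v, gridEnergy α hx hy Mx My (star v) = gridEnergy α hx hy Mx My v)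
    {v r : ℝ → Node Mx → Node My → ℂ}
    (hv : ∀ t, v t = interior Mx My (sample a c hx hy fun x y => u x y t))
    (hr : ∀ t, r t = residual α a c hx hy Mx My u t) {t : ℝ} (hl : 0 ≤ t - τ) (ht : t + τ ≤ T) :
    ∃ ρ, v (t + τ) - v (t - τ) = (τ : ℂ) • (Complex.I • gridOp α hx hy Mx My (v (t + τ) + v (t - τ))
        + Complex.I • (v t * star (v t) * (v (t + τ) + v (t - τ)))
        + Complex.I • -(r (t + τ) + r (t - τ)) + ρ) ∧
      gridEnergy α hx hy Mx My ρ ≤ (12 * K ^ 2 * R ^ 3 + 2 * R) * τ ^ 2 := by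
  have htp : t + τ ∈ Icc 0 T := ⟨by linarith, ht⟩
  have htm : t - τ ∈ Icc 0 T := ⟨hl, by linarith⟩
  have htt : t ∈ Icc 0 T := ⟨by linarith, by linarith⟩
  have hB0 : 0 ≤ B := (norm_nonneg _).trans (hD.bound [] (by simp) _ (left_mem_Icc.2 hab.le) _
    (left_mem_Icc.2 hcd.le) t htt)
  have hzero : ∀ {x y : ℝ} {t : ℝ}, t ∈ Icc 0 T →
      (∀ j ≤ 3, ∀ t ∈ Icc 0 T, D (List.replicate j 2) x y t = 0) → u x y t = 0 := by
    intro x y t ht h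
    have := h 0 (by norm_num) t ht
    rw [← hD.nil]; exact this
  have hone : ∀ {x y : ℝ} {t : ℝ}, t ∈ Icc 0 T →
      (∀ j ≤ 3, ∀ t ∈ Icc 0 T, D (List.replicate j 2) x y t = 0) → D [2] x y t = 0 :=
    fun ht h => h 1 (by norm_num) _ ht
  have hN : ∀ t ∈ Icc 0 T, gridEnergy α hx hy Mx My (v t) ≤ R := by
    intro t ht
    rw [hv, hR]
    refine gridEnergy_le_of_boundary hsol hD h1 h2 hab hcd hT hMx hMy ehx ehy hB0 ?_
      fun x y h => hzero ht h
    have := hD.boundedMixed (w := []) (by simp) ht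
    rwa [hD.nil] at this
  have hd1 : gridEnergy α hx hy Mx My (v (t + τ) - v (t - τ)) ≤ 2 * R * τ := by
    have := gridEnergy_le_of_boundary hsol hD h1 h2 hab hcd hT hMx hMy ehx ehy (by positivity)
      (hD.boundedMixed_central hτ.le hl ht) fun x y h => by rw [hzero htp h, hzero htm h, sub_zero]
    rw [hv, hv]
    exact this.trans (le_of_eq (by rw [hR]; ring))
  have hd2 : gridEnergy α hx hy Mx My (v (t + τ) + v (t - τ) - (2 : ℂ) • v t) ≤ 2 * R * τ ^ 2 := by
    have := gridEnergy_le_of_boundary hsol hD h1 h2 hab hcd hT hMx hMy ehx ehy (by positivity)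
      (hD.boundedMixed_second hτ.le hl ht) fun x y h => by
        rw [hzero htp h, hzero htm h, hzero htt h]; ring
    rw [hv, hv, hv]
    exact this.trans (le_of_eq (by rw [hR]; ring))
  have hcub := cubic_consistency hK hmul hstar (hN _ htp) (hN _ htm) (hN _ htt) hd1 hd2
  set w : ℝ → Node Mx → Node My → ℂ := fun t =>
    interior Mx My (sample a c hx hy fun x y => D [2] x y t) with hw
  have heq : ∀ t ∈ Icc 0 T, w t = Complex.I •
      (gridOp α hx hy Mx My (v t) + v t * star (v t) * v t - r t) := by
    intro t ht
    have h := semidiscrete_equation hsol hs hD h1 h2 hab hcd hMx hMy ehx ehy hT ht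
    rw [← hv, ← hr] at h
    rw [← h]
    funext i k
    simp only [Pi.add_apply, Pi.sub_apply, Pi.smul_apply, smul_eq_mul, hw]
    have := Complex.I_sq
    linear_combination (interior Mx My (sample a c hx hy fun x y => D [2] x y t) i k) * this
  -- `w` is the time derivative, and `E` the error of the trapezoidal rule.
  set E := v (t + τ) - v (t - τ) - (τ : ℂ) • (w (t + τ) + w (t - τ)) with hE
  have hEb : gridEnergy α hx hy Mx My E ≤ 2 * R * τ ^ 3 := by
    have := gridEnergy_le_of_boundary hsol hD h1 h2 hab hcd hT hMx hMy ehx ehy (by positivity)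
      (hD.boundedMixed_trapezoid hτ.le hl ht) fun x y h => by
        rw [hzero htp h, hzero htm h, hone htp h, hone htm h]; ring
    rw [hE, hv, hv]
    exact this.trans (le_of_eq (by rw [hR]; ring))
  refine ⟨Complex.I • (v (t + τ) * star (v (t + τ)) * v (t + τ)
    + v (t - τ) * star (v (t - τ)) * v (t - τ) - v t * star (v t) * (v (t + τ) + v (t - τ)))
    + ((1 / τ : ℝ) : ℂ) • E, ?_, ?_⟩
  · have hτ' : (τ : ℂ) ≠ 0 := Complex.ofReal_ne_zero.2 hτ.ne'
    have hcancel : (τ : ℂ) • (((1 / τ : ℝ) : ℂ) • E) = E := by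
      rw [smul_smul]; push_cast; rw [mul_one_div_cancel hτ', one_smul]
    have h3 : v (t + τ) - v (t - τ) = (τ : ℂ) • (w (t + τ) + w (t - τ)) + E := by rw [hE]; abel
    rw [h3, heq _ htp, heq _ htm, smul_add (τ : ℂ) _ (_ + _), smul_add (τ : ℂ) _ (((1 / τ : ℝ) : ℂ) • E),
      hcancel, map_add, ← add_assoc]
    congr 1
    funext i k
    simp only [Pi.add_apply, Pi.sub_apply, Pi.smul_apply, Pi.mul_apply, Pi.neg_apply, smul_eq_mul]
    ring
  · refine (map_add_le_add _ _ _).trans ?_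
    rw [map_smul_eq_mul, map_smul_eq_mul, Complex.norm_I, one_mul, Complex.norm_real,
      Real.norm_of_nonneg (by positivity)]
    have h4 : 1 / τ * gridEnergy α hx hy Mx My E ≤ 2 * R * τ ^ 2 := by
      calc _ ≤ 1 / τ * (2 * R * τ ^ 3) := by gcongr
        _ = _ := by field_simp
    linarith

include hhx hhy

/-- The error of the first, explicit step. -/
lemma gridEnergy_first_error_le (hτT : τ ≤ T) {U₁ v₀ : Node Mx → Node My → ℂ}
    (hv₀ : v₀ = interior Mx My (sample a c hx hy fun x y => u x y 0))
    (hU₁ : U₁ = v₀ + (τ : ℂ) • (Complex.I • gridOp α hx hy Mx My v₀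
      + Complex.I • (v₀ * star v₀ * v₀))) :
    gridEnergy α hx hy Mx My (interior Mx My (sample a c hx hy fun x y => u x y τ) - U₁)
      ≤ (3 * √((b - a) * (d - c)) * B + 6 * √((b - a) * (d - c)) * residualConst α a b c d B)
        * (τ ^ 2 + hx ^ 2 + hy ^ 2) := by
  have ht0 : (0 : ℝ) ∈ Icc 0 T := ⟨le_rfl, hT.le⟩
  have htτ : τ ∈ Icc 0 T := ⟨hτ.le, hτT⟩
  have hB0 : 0 ≤ B := (norm_nonneg _).trans (hD.bound [] (by simp) _ (left_mem_Icc.2 hab.le) _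
    (left_mem_Icc.2 hcd.le) 0 ht0)
  have hκ : 0 ≤ residualConst α a b c d B := mul_nonneg
    (add_pos (consistencyConst_pos hab) (consistencyConst_pos hcd)).le hB0
  set w : Node Mx → Node My → ℂ := interior Mx My (sample a c hx hy fun x y => D [2] x y 0) with hw
  set r := residual α a c hx hy Mx My u 0 with hr
  set E : Node Mx → Node My → ℂ :=
    interior Mx My (sample a c hx hy fun x y => u x y τ) - v₀ - (τ : ℂ) • w with hE
  have hEb : gridEnergy α hx hy Mx My E ≤ 3 * √((b - a) * (d - c)) * (B * τ ^ 2) := by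
    have := gridEnergy_le_of_boundary hsol hD h1 h2 hab hcd hT hMx hMy ehx ehy (by positivity)
      (hD.boundedMixed_first_step hτ.le hτT) fun x y h => by
        have e0 := h 0 (by norm_num) 0 ht0
        have e1 := h 0 (by norm_num) τ htτ
        have e2 := h 1 (by norm_num) 0 ht0
        simp only [List.replicate_zero, hD.nil] at e0 e1
        simp only [List.replicate_succ, List.replicate_zero] at e2
        rw [e0, e1, e2]; ring
    rw [hE, hv₀]
    exact this
  have h := semidiscrete_equation hsol hs hD h1 h2 hab hcd hMx hMy ehx ehy hT ht0
  rw [← hv₀, ← hw, ← hr] at h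
  have e : interior Mx My (sample a c hx hy fun x y => u x y τ) - U₁
      = E - ((τ : ℂ) * Complex.I) • r := by
    rw [hU₁, hE, ← h]
    funext i k
    simp only [Pi.add_apply, Pi.sub_apply, Pi.smul_apply, smul_eq_mul]
    have := Complex.I_sq
    linear_combination (τ * w i k) * this
  -- The first-order bound for the residual suffices: it carries a factor `τ`, and `τ h ≤ τ² + h²`.
  have hrb := gridEnergy_residual_le hsol hs hD h1 h2 hab hcd hMx hMy ehx ehy hhx hhy ht0
  rw [e]
  refine (map_sub_le_add _ _ _).trans ?_
  rw [map_smul_eq_mul, norm_mul, Complex.norm_I, mul_one, Complex.norm_real,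
    Real.norm_of_nonneg hτ.le]
  have hS := Real.sqrt_nonneg ((b - a) * (d - c))
  set S := √((b - a) * (d - c))
  calc _ ≤ 3 * S * (B * τ ^ 2) + τ * (6 * S * residualConst α a b c d B * (hx + hy)) := by gcongr
    _ = 3 * S * B * τ ^ 2 + 6 * S * residualConst α a b c d B * (τ * (hx + hy)) := by ring
    _ ≤ 3 * S * B * (τ ^ 2 + hx ^ 2 + hy ^ 2)
        + 6 * S * residualConst α a b c d B * (τ ^ 2 + hx ^ 2 + hy ^ 2) := by
      gcongr
      · nlinarith [sq_nonneg hx, sq_nonneg hy]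
      · nlinarith [sq_nonneg (τ - hx), sq_nonneg (τ - hy), sq_nonneg hx, sq_nonneg hy]
    _ = _ := by ring

end Convergence

/-- Convergence of the scheme for one solution whose derivatives are bounded. -/
lemma exists_error_bound {α a b c d T B : ℝ} {u₀ : ℝ → ℝ → ℂ} {u : ℝ → ℝ → ℝ → ℂ}
    {D : List (Fin 3) → ℝ → ℝ → ℝ → ℂ} (hsol : IsDirichletSolution α a b c d T u₀ u)
    (hs : IsSmooth 7 α a b c d T u) (hD : Jet a b c d T u D B) (h1 : 1 < α) (h2 : α ≤ 2)
    (hab : a < b) (hcd : c < d) (hT : 0 < T) :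
    ∃ τ₀ : ℝ, 0 < τ₀ ∧ ∃ h₀ : ℝ, 0 < h₀ ∧ ∃ C₀ : ℝ, 0 < C₀ ∧
      ∀ (N Mx My : ℕ), 0 < N → 0 < Mx → 0 < My →
      ∀ (τ hx hy : ℝ), τ = T / N → hx = (b - a) / Mx → hy = (d - c) / My →
        τ < τ₀ → hx < h₀ → hy < h₀ →
        ∀ U : ℕ → ℕ → ℕ → ℂ, IsSchemeSolution α a c hx hy τ Mx My N u₀ U →
          ∀ n : ℕ, 1 ≤ n → n ≤ N →
            supNorm Mx My (fun j k => sample a c hx hy (fun x y => u x y (n * τ)) j k - U n j k)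
              ≤ C₀ * (τ ^ 2 + hx ^ 2 + hy ^ 2) := by
  have ht0 : (0 : ℝ) ∈ Icc 0 T := ⟨le_rfl, hT.le⟩
  have hB0 : 0 ≤ B := (norm_nonneg _).trans (hD.bound [] (by simp) _ (left_mem_Icc.2 hab.le) _
    (left_mem_Icc.2 hcd.le) 0 ht0)
  obtain ⟨S, hS⟩ : ∃ S : ℝ, S = √((b - a) * (d - c)) := ⟨_, rfl⟩
  have hS0 : 0 ≤ S := by rw [hS]; exact Real.sqrt_nonneg _
  -- `C₁` bounds the maximum norm by the energy, `K` is the constant of the product estimate, `R`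
  -- bounds the energy of the exact solution.
  obtain ⟨C₁, hC₁⟩ : ∃ C₁ : ℝ, C₁ = √(1 / (α - 1) * (1 / (α - 1))) := ⟨_, rfl⟩
  have hC₁0 : 0 ≤ C₁ := by rw [hC₁]; exact Real.sqrt_nonneg _
  obtain ⟨R, hR⟩ : ∃ R : ℝ, R = 3 * S * B := ⟨_, rfl⟩
  have hR0 : 0 ≤ R := by rw [hR]; positivity
  obtain ⟨κ, hκ⟩ : ∃ κ : ℝ, κ = residualConst α a b c d B := ⟨_, rfl⟩
  have hκ0 : 0 ≤ κ := by
    rw [hκ]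
    exact mul_nonneg (add_pos (consistencyConst_pos hab) (consistencyConst_pos hcd)).le hB0
  obtain ⟨K, hK⟩ : ∃ K : ℝ, K = 4 * C₁ := ⟨_, rfl⟩
  have hK0 : 0 ≤ K := by rw [hK]; positivity
  obtain ⟨E, hE⟩ : ∃ E : ℝ, E = 12 * K ^ 2 * R ^ 3 + 3 * R + 6 * S * κ := ⟨_, rfl⟩
  have hKR : 0 ≤ 12 * K ^ 2 * R ^ 3 := by positivity
  have hSκ : 0 ≤ S * κ := mul_nonneg hS0 hκ0
  have hE0 : 0 ≤ E := by rw [hE]; linarith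
  obtain ⟨τ₁, hτ₁, ε₀, hε₀, C, hC, hstab⟩ := stability K R E T hK0 hR0 hE0
  refine ⟨min τ₁ (min 1 (ε₀ / 3)), by positivity, min 1 (ε₀ / 3), by positivity,
    C₁ * C + 1, by positivity, ?_⟩
  intro N Mx My hN hMx hMy τ hx hy eτ ehx ehy lτ lx ly U hU
  have hN0 : (0 : ℝ) < N := by exact_mod_cast hN
  have hMx0 : (0 : ℝ) < Mx := by exact_mod_cast hMx
  have hMy0 : (0 : ℝ) < My := by exact_mod_cast hMy
  have hτ : 0 < τ := by rw [eτ]; positivity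
  have hhx0 : 0 < hx := by rw [ehx]; exact div_pos (by linarith) hMx0
  have hhy0 : 0 < hy := by rw [ehy]; exact div_pos (by linarith) hMy0
  have hNτ : N * τ = T := by rw [eτ]; field_simp
  obtain ⟨lτ1, lτ'⟩ := lt_min_iff.1 lτ
  obtain ⟨lτ2, lτ3⟩ := lt_min_iff.1 lτ'
  obtain ⟨lx1, lx2⟩ := lt_min_iff.1 lx
  obtain ⟨ly1, ly2⟩ := lt_min_iff.1 ly
  obtain ⟨ε, hε⟩ : ∃ ε : ℝ, ε = τ ^ 2 + hx ^ 2 + hy ^ 2 := ⟨_, rfl⟩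
  rw [← hε]
  have hεle : ε ≤ ε₀ := by
    have e1 := pow_le_of_le_one hτ.le lτ2.le two_ne_zero
    have e2 := pow_le_of_le_one hhx0.le lx1.le two_ne_zero
    have e3 := pow_le_of_le_one hhy0.le ly1.le two_ne_zero
    rw [hε]; linarith
  have hεpos : 0 ≤ ε := by rw [hε]; positivity
  have hτε : τ ^ 2 ≤ ε := by rw [hε]; linarith [sq_nonneg hx, sq_nonneg hy]
  have hhε : hx ^ 2 + hy ^ 2 ≤ ε := by rw [hε]; linarith [sq_nonneg τ]
  obtain ⟨Nm, hNm⟩ : ∃ Nm, Nm = gridEnergy α hx hy Mx My := ⟨_, rfl⟩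
  obtain ⟨L, hL⟩ : ∃ L, L = gridOp α hx hy Mx My := ⟨_, rfl⟩
  have hmul : ∀ v w, Nm (v * w) ≤ K * Nm v * Nm w := by
    rw [hNm, hK, hC₁]; exact gridEnergy_mul_le h1 h2 hhx0 hhy0
  have hstar : ∀ v, Nm (star v) = Nm v := by
    rw [hNm]; exact gridEnergy_star h1 h2 hhx0 hhy0
  have hstep : ∀ (τ : ℝ) (p m F : Node Mx → Node My → ℂ), 0 ≤ τ →
      p - m = (τ : ℂ) • (Complex.I • L (p + m) + F) → Nm p ≤ Nm m + τ * Nm F := by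
    rw [hNm, hL]; exact fun τ p m F => gridEnergy_step h1 h2 hhx0 hhy0
  obtain ⟨v, hv⟩ : ∃ v : ℝ → Node Mx → Node My → ℂ, ∀ t, v t =
    interior Mx My (sample a c hx hy fun x y => u x y t) := ⟨_, fun _ => rfl⟩
  obtain ⟨r, hr⟩ : ∃ r : ℝ → Node Mx → Node My → ℂ, ∀ t, r t = residual α a c hx hy Mx My u t :=
    ⟨_, fun _ => rfl⟩
  have htn : ∀ n ≤ N, (n : ℝ) * τ ∈ Icc 0 T := fun n hn => by
    have hn' : (n : ℝ) ≤ N := by exact_mod_cast hn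
    exact ⟨by positivity, hNτ ▸ mul_le_mul_of_nonneg_right hn' hτ.le⟩
  -- The corrector: `N` bounds it and its time differences by maximum norms of the residual, which
  -- are of second order, whereas `N (r t)` is of first order only.
  have hell : ∀ t, ∃ η : Node Mx → Node My → ℂ, η - L η = -r t := fun t => by
    rw [hL]; exact exists_sub_gridOp_eq h1 h2 hhx0 hhy0 _
  choose η hη using hell
  have hNell : ∀ {η r : Node Mx → Node My → ℂ} {ρ : ℝ}, 0 ≤ ρ → η - L η = r →
      (∀ i j, ‖r i j‖ ≤ ρ) → Nm η ≤ S * ρ := by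
    rw [hNm, hL, hS]; exact gridEnergy_elliptic_le h1 h2 hab hcd hMx hMy ehx ehy
  have hηb : ∀ n ≤ N, Nm (η (n * τ)) ≤ S * (κ * (hx ^ 2 + hy ^ 2)) := fun n hn =>
    hNell (by positivity) (hη _) fun i j => by
      rw [Pi.neg_apply, Pi.neg_apply, norm_neg, hr, hκ]
      exact norm_residual_le hsol hs hD h1 h2 hab hcd ehx ehy (htn n hn) i j
  have hηd : ∀ n, n + 2 ≤ N → Nm (η ((n + 2 : ℕ) * τ) - η (n * τ))
      ≤ S * (κ * (hx ^ 2 + hy ^ 2) * (2 * τ)) := fun n hn => by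
    refine hNell (by positivity) (r := -(r ((n + 2 : ℕ) * τ) - r (n * τ))) ?_ fun i j => ?_
    · rw [map_sub, neg_sub', ← hη, ← hη]; abel
    · have := norm_residual_sub_le hsol hs hD h1 h2 hab hcd ehx ehy (htn _ hn)
        (htn n (by omega)) i j
      rw [show ((n + 2 : ℕ) : ℝ) * τ - n * τ = 2 * τ by push_cast; ring,
        abs_of_pos (by positivity)] at this
      rw [Pi.neg_apply, Pi.neg_apply, norm_neg, Pi.sub_apply, Pi.sub_apply, hr, hr, hκ]
      exact this
  have hρ : ∀ n, ∃ ρ, n + 2 ≤ N →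
      v ((n + 2 : ℕ) * τ) - v (n * τ) = (τ : ℂ) • (Complex.I • L (v ((n + 2 : ℕ) * τ) + v (n * τ))
        + Complex.I • (v ((n + 1 : ℕ) * τ) * star (v ((n + 1 : ℕ) * τ))
          * (v ((n + 2 : ℕ) * τ) + v (n * τ)))
        + Complex.I • -(r ((n + 2 : ℕ) * τ) + r (n * τ)) + ρ) ∧
      Nm ρ ≤ (12 * K ^ 2 * R ^ 3 + 2 * R) * τ ^ 2 := fun n => by
    by_cases hn : n + 2 ≤ N
    · have ep : ((n + 1 : ℕ) : ℝ) * τ + τ = (n + 2 : ℕ) * τ := by push_cast; ring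
      have em : ((n + 1 : ℕ) : ℝ) * τ - τ = n * τ := by push_cast; ring
      obtain ⟨ρ, hρ⟩ := exists_step_residual hsol hs hD h1 h2 hab hcd hT hMx hMy ehx ehy hτ
        (R := R) (by rw [hR, hS]) hK0 (hNm ▸ hmul) (hNm ▸ hstar) (v := v) (r := r) hv hr (t := (n + 1 : ℕ) * τ)
        (by rw [em]; positivity) (by rw [ep]; exact (htn _ hn).2)
      rw [ep, em, ← hL, ← hNm] at hρ
      exact ⟨ρ, fun _ => hρ⟩
    · exact ⟨0, fun h => absurd h hn⟩
  choose ρ hρ using hρ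
  obtain ⟨hi1, hi0⟩ := hU.interior_initial hab hcd ehx ehy hsol
  have hU0 : interior Mx My (U 0) = v 0 := (hi0.trans hi1).trans (hv 0).symm
  have hmain := hstab (ι := Node Mx) (κ := Node My) Nm L hmul hstar hstep (fun n => v (n * τ))
    (fun n => interior Mx My (U n)) (fun n => η (n * τ)) ρ N τ ε hτ hNτ.le hεpos lτ1.le hεle
    (fun n hn => hL ▸ hU.interior_step hτ.ne' hn) (fun n hn => ?_) (fun n hn => ?_) (fun n hn => ?_)
    (fun n hn => ?_) (fun n hn => ?_) ?_ ?_
  · intro n _ hn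
    have hpt := hmain n hn
    unfold supNorm
    have hC0 : 0 ≤ (C₁ * C + 1) * ε := by positivity
    rw [← Real.coe_toNNReal _ hC0, NNReal.coe_le_coe]
    refine Finset.sup_le fun p hp => ?_
    rw [Finset.mem_product] at hp
    rw [← NNReal.coe_le_coe, Real.coe_toNNReal _ hC0, coe_nnnorm]
    have := norm_le_gridEnergy h1 h2 hhx0 hhy0 (v (n * τ) - interior Mx My (U n)) ⟨p.1, hp.1⟩
      ⟨p.2, hp.2⟩
    rw [← hNm, ← hC₁, hv] at this
    rw [hv] at hpt
    refine this.trans ?_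
    calc _ ≤ C₁ * (C * ε) := mul_le_mul_of_nonneg_left hpt hC₁0
      _ ≤ _ := by rw [add_mul, mul_assoc]; linarith
  · have hLη : ∀ t s, η t + η s - L (η t + η s) = -(r t + r s) := fun t s => by
      rw [map_add, neg_add, ← hη, ← hη]; abel
    show v ((n + 2 : ℕ) * τ) - v (n * τ) = _
    rw [hLη]
    exact (hρ n hn).1
  · exact (hρ n hn).2.trans (mul_le_mul (by linarith) hτε (sq_nonneg _) hE0)
  · refine (hηb n hn).trans ?_
    rw [← mul_assoc]
    exact mul_le_mul (by linarith) hhε (by positivity) hE0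
  · calc _ ≤ S * (κ * (hx ^ 2 + hy ^ 2) * (2 * τ)) := hηd n hn
      _ = 2 * (S * κ) * (τ * (hx ^ 2 + hy ^ 2)) := by ring
      _ ≤ E * (τ * ε) := mul_le_mul (by linarith) (mul_le_mul_of_nonneg_left hhε hτ.le)
          (by positivity) hE0
      _ = E * τ * ε := by ring
  · have hbm := hD.boundedMixed (w := []) (by simp) (htn n hn)
    rw [hD.nil] at hbm
    rw [hNm, hv, hR, hS]
    refine gridEnergy_le_of_boundary hsol hD h1 h2 hab hcd hT hMx hMy ehx ehy hB0 hbm fun x y h => ?_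
    have := h 0 (by norm_num) _ (htn n hn)
    rw [← hD.nil]; exact this
  · show Nm (v ((0 : ℕ) * τ) - interior Mx My (U 0)) ≤ _
    rw [Nat.cast_zero, zero_mul, hU0, sub_self, map_zero]
    positivity
  · have h3 := gridEnergy_first_error_le hsol hs hD h1 h2 hab hcd hT hMx hMy ehx ehy lx1.le ly1.le hτ
      (by simpa using (htn 1 hN).2) (U₁ := interior Mx My (U 1)) (v₀ := v 0) (hv 0)
      (hU.interior_firstStep (hi1.trans (hv 0).symm) hU0)
    rw [← hNm, ← hS, ← hκ, ← hε, ← hR, ← hv] at h3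
    show Nm (v ((1 : ℕ) * τ) - interior Mx My (U 1)) ≤ _
    rw [Nat.cast_one, one_mul]
    refine h3.trans (mul_le_mul_of_nonneg_right ?_ hεpos)
    rw [hE]; linarith

end FracNLS
end

theorem theorem3 :
    ∃ m : ℕ, ∀ (α : ℝ), 1 < α → α ≤ 2 →
      ∀ (a b c d T : ℝ), a < b → c < d → 0 < T →
      ∀ (u₀ : ℝ → ℝ → ℂ) (u : ℝ → ℝ → ℝ → ℂ),
        FracNLS.IsDirichletSolution α a b c d T u₀ u →
        FracNLS.IsSmooth m α a b c d T u →
        ∃ τ₀ : ℝ, 0 < τ₀ ∧ ∃ h₀ : ℝ, 0 < h₀ ∧ ∃ C₀ : ℝ, 0 < C₀ ∧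
          ∀ (N Mx My : ℕ), 0 < N → 0 < Mx → 0 < My →
          ∀ (τ hx hy : ℝ), τ = T / N → hx = (b - a) / Mx → hy = (d - c) / My →
            τ < τ₀ → hx < h₀ → hy < h₀ →
            ∀ U : ℕ → ℕ → ℕ → ℂ,
              FracNLS.IsSchemeSolution α a c hx hy τ Mx My N u₀ U →
              ∀ n : ℕ, 1 ≤ n → n ≤ N →
                FracNLS.supNorm Mx My
                    (fun j k => FracNLS.sample a c hx hy (fun x y => u x y (n * τ)) j k - U n j k)
                  ≤ C₀ * (τ ^ 2 + hx ^ 2 + hy ^ 2) := by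
  -- Six derivatives in space for the consistency estimate, and one more in time or in the other
  -- space variable for Lipschitz bounds of the residual.
  refine ⟨7, fun α h1 h2 a b c d T hab hcd hT u₀ u hsol hs => ?_⟩
  obtain ⟨D, B, hD⟩ := hs.exists_jet hab hcd hT
  exact FracNLS.exists_error_bound hsol hs hD h1 h2 hab hcd hT
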